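/- **Conventions.** Manifolds are smooth, Hausdorff, second countable and without boundary. For $m\ge 0$, let $\mathrm{Man}_m$ be the category of $m$-dimensional manifolds with smooth codimension zero embeddings as morphisms. *Space* means simplicial set. Let $\mathrm{Fin}$ be the category with objects $\underline k=\{1,\dots,k\}$, $k\ge 0$, and all maps as morphisms; its nerve $N\mathrm{Fin}$ is regarded as a simplicial (discrete) space, with $r$-simplices the strings $\underline k_0\leftarrow\underline k_1\leftarrow\cdots\leftarrow\underline k_r$. **Configuration categories.** For an $m$-manifold $M$ and a string $\underline k_0\leftarrow\cdots\leftarrow\underline k_r$ in $\mathrm{Fin}$, let $X(\underline k_0\leftarrow\cdots\leftarrow\underline k_r)$ be the space of strings $$\underline k_r\times\mathbb R^m\to\cdots\to\underline k_0\times\mathbb R^m\to M$$ of smooth codimension zero embeddings (with the weak, that is compact-open, $C^\infty$ topology) which induce the given maps $\underline k_{i}\to\underline k_{i-1}$ on sets of components. The group $\prod_i \mathrm O(m)^{k_i}$ acts on it through the linear action of $\mathrm O(m)^{k_i}$ on $\underline k_i\times\mathbb R^m$. The configuration category $\mathrm{con}(M)$ (multipatch model) is the simplicial space over $N\mathrm{Fin}$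 whose space of $r$-simplices $\mathrm{con}(M)_r$ is the coproduct of the homotopy orbit spaces $$X(\underline k_0\leftarrow\cdots\leftarrow\underline k_r)_{h\prod_i \mathrm O(m)^{k_i}}$$ over all strings $\underline k_0\leftarrow\cdots\leftarrow\underline k_r$. For an integer $k\ge 0$, $\mathrm{con}(M;k)\subset\mathrm{con}(M)$ is the simplicial subspace given by the strings with all $k_i\le k$. Both are covariant functors of $M\in\mathrm{Man}_m$ with values in simplicial spaces over $N\mathrm{Fin}$. For simplicial spaces $X,Y$ over $N\mathrm{Fin}$, let $\mathbb R\mathrm{map}_{\mathrm{Fin}}(X,Y)$ be the derived mapping space over $N\mathrm{Fin}$ with respect to levelwise weak equivalences, that is, the simplicial mapping space $\mathrm{map}_{N\mathrm{Fin}}(X,Y^f)$ where $Y\to Y^f$ is a levelwise weak equivalence over $N\mathrm{Fin}$ and $Y^f\to N\mathrm{Fin}$ is a fibration in the injective model structure on simplicial spaces (in which all objects are cofibrant). **Coverings.** A *nonempty* family of morphisms $(f_i\colon V_i\to M)_{i\in I}$ in $\mathrm{Man}_m$ is a $\mathcal J_k$-covering if every subset of $M$ of cardinality at most $k$ is contained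 in the image of some $f_i$. For finite nonempty $S\subset I$ put $U_S=\bigcap_{i\in S}f_i(V_i)$, an open submanifold of $M$. A contravariant functor $F$ from $\mathrm{Man}_m$ to spaces is a *homotopy $\mathcal J_k$-sheaf* if for every $\mathcal J_k$-covering the canonical map $$F(M)\longrightarrow \operatorname*{holim}_{\emptyset\ne S\subset I\ \text{finite}}F(U_S)$$ is a weak equivalence. A covariant functor $G$ from $\mathrm{Man}_m$ to simplicial spaces over $N\mathrm{Fin}$ is a *homotopy $\mathcal J_k$-cosheaf* if for every $\mathcal J_k$-covering and every $r\ge 0$ the canonical map $$\operatorname*{hocolim}_{\emptyset\ne S\subset I\ \text{finite}}G(U_S)_r\longrightarrow G(M)_r$$ is a weak equivalence. (Homotopy colimits of simplicial spaces over $N\mathrm{Fin}$ are computed degreewise.) **Theorem 3.4.** Let $m,n,k\ge 0$ be integers. 1. The functor $M\mapsto \mathrm{con}(M;k)$ on $\mathrm{Man}_m$ is a homotopy $\mathcal J_k$-cosheaf. 2. For every $n$-dimensional manifold $N$, the contravariant functor $M\mapsto\mathbb R\mathrm{map}_{\mathrm{Fin}}(\mathrm{con}(M;k),\mathrm{con}(N))$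 on $\mathrm{Man}_m$ is a homotopy $\mathcal J_k$-sheaf. -/

import Mathlib

open CategoryTheory Opposite MonoidalCategory
open scoped Manifold ContDiff

universe u v w

namespace ConfigCat

noncomputable section

/-! ## Smooth manifolds, iterated tangent bundles and the weak `C^∞` topology -/

/-- A smooth manifold over an arbitrary real model with corners. This bundled form is only used to
iterate the tangent bundle construction. -/
structure ModelledMfd where
  E : Type
  [normedAddCommGroup : NormedAddCommGroup E]
  [normedSpace : NormedSpace ℝ E]
  H : Type
  [topModel : TopologicalSpace H]
  I : ModelWithCorners ℝ E H
  carrier : Type u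
  [top : TopologicalSpace carrier]
  [charted : ChartedSpace H carrier]
  [smooth : IsManifold I ∞ carrier]

attribute [instance] ModelledMfd.normedAddCommGroup ModelledMfd.normedSpace ModelledMfd.topModel
  ModelledMfd.top ModelledMfd.charted ModelledMfd.smooth

namespace ModelledMfd

/-- Smooth maps. -/
abbrev Smooth (X : ModelledMfd.{u}) (Y : ModelledMfd.{v}) : Type (max u v) :=
  C^∞⟮X.I, X.carrier; Y.I, Y.carrier⟯

/-- The tangent bundle, as a smooth manifold. -/
def tangent (X : ModelledMfd.{u}) : ModelledMfd.{u} :=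
  haveI : ContMDiffVectorBundle ∞ X.E (TangentSpace X.I : X.carrier → Type) X.I :=
    inferInstance
  haveI : IsManifold X.I.tangent ∞ (TangentBundle X.I X.carrier) := inferInstance
  { E := X.E × X.E
    H := ModelProd X.H X.E
    I := X.I.tangent
    carrier := TangentBundle X.I X.carrier }

/-- The differential of a smooth map, as a smooth map between tangent bundles. -/
def tangentSmooth {X : ModelledMfd.{u}} {Y : ModelledMfd.{v}} (f : X.Smooth Y) :
    X.tangent.Smooth Y.tangent :=
  ⟨tangentMap X.I Y.I f, f.contMDiff.contMDiff_tangentMap (by simp)⟩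

theorem tangentSmooth_comp {X : ModelledMfd.{u}} {Y : ModelledMfd.{v}} {Z : ModelledMfd.{w}}
    (g : Y.Smooth Z) (f : X.Smooth Y) :
    tangentSmooth (ContMDiffMap.comp g f) =
      ContMDiffMap.comp (tangentSmooth g) (tangentSmooth f) := by
  apply ContMDiffMap.ext
  intro p
  exact tangentMap_comp_at p (g.contMDiff.mdifferentiable (by simp) _)
    (f.contMDiff.mdifferentiable (by simp) _)

/-- The `j`-fold iterated tangent bundle `T(T(⋯ X))`. -/
def iterTangent : ℕ → ModelledMfd.{u} → ModelledMfd.{u}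
  | 0, X => X
  | j + 1, X => iterTangent j X.tangent

/-- The `j`-fold iterated differential of a smooth map. -/
def iterTangentSmooth : ∀ (j : ℕ) {X : ModelledMfd.{u}} {Y : ModelledMfd.{v}},
    X.Smooth Y → (iterTangent j X).Smooth (iterTangent j Y)
  | 0, _, _, f => f
  | j + 1, _, _, f => iterTangentSmooth j (tangentSmooth f)

theorem iterTangentSmooth_comp : ∀ (j : ℕ) {X : ModelledMfd.{u}} {Y : ModelledMfd.{v}}
    {Z : ModelledMfd.{w}} (g : Y.Smooth Z) (f : X.Smooth Y),
    iterTangentSmooth j (ContMDiffMap.comp g f) =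
      ContMDiffMap.comp (iterTangentSmooth j g) (iterTangentSmooth j f)
  | 0, _, _, _, _, _ => rfl
  | j + 1, _, _, _, g, f => by
    simp only [iterTangentSmooth, tangentSmooth_comp]
    exact iterTangentSmooth_comp j _ _

/-- The `j`-fold iterated differential, as a continuous map. -/
def iterTangentCont (j : ℕ) {X : ModelledMfd.{u}} {Y : ModelledMfd.{v}} (f : X.Smooth Y) :
    C((iterTangent j X).carrier, (iterTangent j Y).carrier) :=
  ⟨iterTangentSmooth j f, (iterTangentSmooth j f).contMDiff.continuous⟩

end ModelledMfd

/-- A smooth manifold without boundary, of dimension `m` (Hausdorff, second countable). -/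
structure Man (m : ℕ) where
  carrier : Type u
  [top : TopologicalSpace carrier]
  [charted : ChartedSpace (EuclideanSpace ℝ (Fin m)) carrier]
  [smooth : IsManifold (𝓡 m) ∞ carrier]
  [t2 : T2Space carrier]
  [secondCountable : SecondCountableTopology carrier]

attribute [instance] Man.top Man.charted Man.smooth Man.t2 Man.secondCountable

namespace Man

variable {m : ℕ}

/-- Forget that the model is Euclidean space. -/
abbrev toModelled (M : Man.{u} m) : ModelledMfd.{u} where
  E := EuclideanSpace ℝ (Fin m)
  H := EuclideanSpace ℝ (Fin m)
  I := 𝓡 m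
  carrier := M.carrier

/-- Smooth embeddings of codimension zero: injective local diffeomorphisms. -/
@[ext]
structure Emb (M : Man.{u} m) (N : Man.{v} m) where
  toFun : M.carrier → N.carrier
  injective : Function.Injective toFun
  isLocalDiffeomorph : IsLocalDiffeomorph (𝓡 m) (𝓡 m) ∞ toFun

namespace Emb

instance (M : Man.{u} m) (N : Man.{v} m) : CoeFun (Emb M N) (fun _ => M.carrier → N.carrier) :=
  ⟨Emb.toFun⟩

/-- The underlying smooth map. -/
def toSmooth {M : Man.{u} m} {N : Man.{v} m} (f : Emb M N) :
    M.toModelled.Smooth N.toModelled :=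
  ⟨f.toFun, f.isLocalDiffeomorph.contMDiff⟩

/-- The weak (compact-open) `C^∞` topology: the coarsest topology for which all the iterated
differentials `f ↦ T^j f ∈ C(T^j M, T^j N)` are continuous, where the target has the compact-open
topology. -/
instance (M : Man.{u} m) (N : Man.{v} m) : TopologicalSpace (Emb M N) :=
  ⨅ j : ℕ, TopologicalSpace.induced
    (fun f : Emb M N => ModelledMfd.iterTangentCont j f.toSmooth) inferInstance

/-- The identity. -/
def refl (M : Man.{u} m) : Emb M M where
  toFun := id
  injective := Function.injective_id
  isLocalDiffeomorph := (Diffeomorph.refl (𝓡 m) M.carrier ∞).isLocalDiffeomorph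

/-- Composition of codimension zero embeddings. -/
def comp {M : Man.{u} m} {N : Man.{v} m} {P : Man.{w} m} (g : Emb N P) (f : Emb M N) :
    Emb M P where
  toFun := g.toFun ∘ f.toFun
  injective := g.injective.comp f.injective
  isLocalDiffeomorph := fun x =>
    IsLocalDiffeomorphAt.comp (hf := f.isLocalDiffeomorph x)
      (hg := g.isLocalDiffeomorph (f.toFun x))

theorem continuous_comp_left {M : Man.{u} m} {N : Man.{v} m} {P : Man.{w} m} (g : Emb N P) :
    Continuous (fun f : Emb M N => g.comp f) := by
  refine continuous_iInf_rng.2 fun j => continuous_induced_rng.2 ?_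
  have h : Continuous (fun f : Emb M N => ModelledMfd.iterTangentCont j f.toSmooth) :=
    continuous_iInf_dom (i := j) continuous_induced_dom
  have h2 := (ContinuousMap.continuous_postcomp
    (ModelledMfd.iterTangentCont j g.toSmooth)).comp h
  refine h2.congr fun f => ?_
  apply ContinuousMap.ext
  intro x
  have h3 := ModelledMfd.iterTangentSmooth_comp j g.toSmooth f.toSmooth
  exact (congrArg (fun s => s x) h3).symm

/-- The image of a codimension zero embedding is open. -/
theorem isOpen_range {M : Man.{u} m} {N : Man.{v} m} (f : Emb M N) :
    IsOpen (Set.range f.toFun) :=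
  f.isLocalDiffeomorph.isOpen_range

end Emb

/-- The category of `m`-manifolds and smooth codimension zero embeddings. -/
instance : Category (Man.{u} m) where
  Hom M N := Emb M N
  id M := Emb.refl M
  comp f g := Emb.comp g f

/-- Euclidean space `ℝ^m`. -/
def euclid (m : ℕ) : Man.{0} m where
  carrier := EuclideanSpace ℝ (Fin m)

/-- An open subset of a manifold, as a manifold. -/
def ofOpen (M : Man.{u} m) (U : TopologicalSpace.Opens M.carrier) : Man.{u} m where
  carrier := U

theorem isLocalDiffeomorph_val (M : Man.{u} m) (U : TopologicalSpace.Opens M.carrier) :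
    IsLocalDiffeomorph (𝓡 m) (𝓡 m) ∞ (Subtype.val : U → M.carrier) := by
  intro x
  let e := U.openPartialHomeomorphSubtypeCoe ⟨x⟩
  have hval : ∀ y ∈ e.target, (e.symm y : M.carrier) = y := fun y hy => e.right_inv hy
  exact ⟨{ toPartialEquiv := e.toPartialEquiv
           open_source := e.open_source
           open_target := e.open_target
           contMDiffOn_toFun := contMDiff_subtype_val.contMDiffOn
           contMDiffOn_invFun := fun y hy =>
             (ContMDiffWithinAt.subtypeVal_comp_iff U _ _ _).1
               (contMDiffWithinAt_id.congr (fun z hz => hval z hz) (hval y hy)) },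
    Set.mem_univ _, fun _ _ => rfl⟩

theorem isLocalDiffeomorph_inclusion (M : Man.{u} m) {U V : TopologicalSpace.Opens M.carrier}
    (h : U ≤ V) :
    IsLocalDiffeomorph (𝓡 m) (𝓡 m) ∞ (TopologicalSpace.Opens.inclusion h : U → V) := by
  intro x
  have : Nonempty U := ⟨x⟩
  let e := Topology.IsOpenEmbedding.toOpenPartialHomeomorph _
    (TopologicalSpace.Opens.isOpenEmbedding_of_le h)
  have hval : ∀ y ∈ e.target, (e.symm y : M.carrier) = y := fun y hy =>
    congrArg Subtype.val (e.right_inv hy)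
  exact ⟨{ toPartialEquiv := e.toPartialEquiv
           open_source := e.open_source
           open_target := e.open_target
           contMDiffOn_toFun := (contMDiff_inclusion h).contMDiffOn
           contMDiffOn_invFun := fun y hy =>
             (ContMDiffWithinAt.subtypeVal_comp_iff U _ _ _).1
               ((contMDiff_subtype_val y).contMDiffWithinAt.congr
                 (fun z hz => hval z hz) (hval y hy)) },
    Set.mem_univ _, fun _ _ => rfl⟩

/-- The inclusion of an open subset into a bigger one. -/
def inclusion (M : Man.{u} m) {U V : TopologicalSpace.Opens M.carrier} (h : U ≤ V) :
    M.ofOpen U ⟶ M.ofOpen V where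
  toFun := TopologicalSpace.Opens.inclusion h
  injective := Set.inclusion_injective h
  isLocalDiffeomorph := M.isLocalDiffeomorph_inclusion h

/-- The inclusion of an open subset into the manifold. -/
def inclusionTop (M : Man.{u} m) (U : TopologicalSpace.Opens M.carrier) : M.ofOpen U ⟶ M where
  toFun := Subtype.val
  injective := Subtype.val_injective
  isLocalDiffeomorph := M.isLocalDiffeomorph_val U

end Man

/-! ## The category of finite sets and its nerve -/

/-- The category with objects `{1, …, n}` for `n ≥ 0` and all maps as morphisms. -/
structure FinObj : Type u where
  card : ℕ

instance : Category.{0} FinObj.{u} where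
  Hom a b := Fin a.card → Fin b.card
  id _ := id
  comp f g := g ∘ f

/-- Strings `k_0 ← k_1 ← ⋯ ← k_r` of composable maps of finite sets. -/
abbrev FinString (r : SimplexCategory) : Type u := ComposableArrows FinObj.{u}ᵒᵖ r.len

namespace FinString

variable {r s : SimplexCategory}

/-- The cardinality `k_a`. -/
def card (σ : FinString.{u} r) (a : Fin (r.len + 1)) : ℕ := (σ.obj a).unop.card

/-- The map `k_b → k_a`, for `a ≤ b`. -/
def map (σ : FinString.{u} r) {a b : Fin (r.len + 1)} (h : a ≤ b) :
    Fin (σ.card b) → Fin (σ.card a) := (σ.toPrefunctor.map (homOfLE h)).unop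

/-- The simplicial operators. -/
abbrev reindex (θ : s ⟶ r) (σ : FinString.{u} r) : FinString.{u} s :=
  (nerve FinObj.{u}ᵒᵖ).map θ.op σ

end FinString

/-- Simplicial spaces: simplicial objects in the category of simplicial sets. -/
abbrev SimplicialSpace : Type (u + 1) := SimplicialObject SSet.{u}

/-- The nerve of the category of finite sets, as a simplicial discrete space. Its `r`-simplices are
the strings `k_0 ← k_1 ← ⋯ ← k_r`. -/
def nerveFin : SimplicialSpace.{u} := nerve FinObj.{u}ᵒᵖ ⋙ Functor.const SimplexCategoryᵒᵖ

/-! ## The configuration category (multipatch model) -/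

/-- The linear action of the orthogonal group on `ℝ^m`. -/
def rotate {m : ℕ} (A : Matrix.orthogonalGroup (Fin m) ℝ) (z : EuclideanSpace ℝ (Fin m)) :
    EuclideanSpace ℝ (Fin m) := WithLp.toLp 2 ((A : Matrix (Fin m) (Fin m) ℝ).mulVec z.ofLp)

/-- For a string `k_0 ← ⋯ ← k_r`, the strings of morphisms in the Grothendieck construction of
`U ↦ emb(U, M)` lying over it, where `U` runs through the manifolds `k × ℝ^m`.

An embedding `k × ℝ^m → M` is the same as a `k`-tuple of embeddings `ℝ^m → M` with disjoint images,
and an embedding `k × ℝ^m → l × ℝ^m` inducing `v` on components is the same as a `k`-tuple of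
embeddings `ℝ^m → ℝ^m` such that those with the same label under `v` have disjoint images.

`obj a` is the embedding `k_a × ℝ^m → M`, and `arr h` is the embedding `k_b × ℝ^m → k_a × ℝ^m`
for `a ≤ b`. -/
@[ext]
structure PatchString {m : ℕ} (M : Man.{u} m) {r : SimplexCategory} (σ : FinString.{u} r) where
  obj : ∀ a : Fin (r.len + 1), Fin (σ.card a) → Man.Emb (Man.euclid m) M
  arr : ∀ (a b : Fin (r.len + 1)), a ≤ b → Fin (σ.card b) →
    Man.Emb (Man.euclid m) (Man.euclid m)
  obj_disjoint : ∀ a (i j : Fin (σ.card a)), i ≠ j →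
    Disjoint (Set.range (obj a i).toFun) (Set.range (obj a j).toFun)
  arr_disjoint : ∀ a b (h : a ≤ b) (i j : Fin (σ.card b)), i ≠ j → σ.map h i = σ.map h j →
    Disjoint (Set.range (arr a b h i).toFun) (Set.range (arr a b h j).toFun)
  arr_refl : ∀ a (i : Fin (σ.card a)) z, arr a a le_rfl i z = z
  arr_comp : ∀ a b c (h : a ≤ b) (h' : b ≤ c) (i : Fin (σ.card c)) z,
    arr a b h (σ.map h' i) (arr b c h' i z) = arr a c (h.trans h') i z
  obj_arr : ∀ a b (h : a ≤ b) (i : Fin (σ.card b)) z,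
    obj a (σ.map h i) (arr a b h i z) = obj b i z

namespace PatchString

variable {m : ℕ} {M : Man.{u} m} {r s : SimplexCategory} {σ : FinString.{u} r}

/-- The topology on strings of morphisms: the coarsest topology for which all the components are
continuous, that is, the subspace topology of the product of the spaces of embeddings (which carry
the weak `C^∞` topology). -/
instance : TopologicalSpace (PatchString M σ) :=
  (⨅ (a : Fin (r.len + 1)) (i : Fin (σ.card a)),
      TopologicalSpace.induced (fun x => x.obj a i) inferInstance) ⊓
    ⨅ (a : Fin (r.len + 1)) (b : Fin (r.len + 1)) (h : a ≤ b) (i : Fin (σ.card b)),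
      TopologicalSpace.induced (fun x => x.arr a b h i) inferInstance

theorem continuous_obj (a : Fin (r.len + 1)) (i : Fin (σ.card a)) :
    Continuous (fun x : PatchString M σ => x.obj a i) :=
  continuous_iff_le_induced.2 (inf_le_left.trans ((iInf_le _ a).trans (iInf_le _ i)))

theorem continuous_arr (a b : Fin (r.len + 1)) (h : a ≤ b) (i : Fin (σ.card b)) :
    Continuous (fun x : PatchString M σ => x.arr a b h i) :=
  continuous_iff_le_induced.2 (inf_le_right.trans ((iInf_le _ a).trans ((iInf_le _ b).trans
    ((iInf_le _ h).trans (iInf_le _ i)))))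

theorem continuous_of_components {T : Type w} [TopologicalSpace T] {F : T → PatchString M σ}
    (h1 : ∀ a i, Continuous (fun t => (F t).obj a i))
    (h2 : ∀ a b h i, Continuous (fun t => (F t).arr a b h i)) : Continuous F :=
  continuous_inf_rng.2
    ⟨continuous_iInf_rng.2 fun a => continuous_iInf_rng.2 fun i =>
      continuous_induced_rng.2 (h1 a i),
    continuous_iInf_rng.2 fun a => continuous_iInf_rng.2 fun b => continuous_iInf_rng.2 fun h =>
      continuous_iInf_rng.2 fun i => continuous_induced_rng.2 (h2 a b h i)⟩

/-- The simplicial operators. -/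
def reindex (θ : s ⟶ r) (x : PatchString M σ) : PatchString M (σ.reindex θ) where
  obj a := x.obj (θ.toOrderHom a)
  arr a b h := x.arr (θ.toOrderHom a) (θ.toOrderHom b) (θ.toOrderHom.monotone h)
  obj_disjoint a := x.obj_disjoint (θ.toOrderHom a)
  arr_disjoint _ _ h := x.arr_disjoint _ _ (θ.toOrderHom.monotone h)
  arr_refl a := x.arr_refl (θ.toOrderHom a)
  arr_comp _ _ _ h h' :=
    x.arr_comp _ _ _ (θ.toOrderHom.monotone h) (θ.toOrderHom.monotone h')
  obj_arr _ _ h := x.obj_arr _ _ (θ.toOrderHom.monotone h)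

theorem continuous_reindex (θ : s ⟶ r) :
    Continuous (reindex θ : PatchString M σ → PatchString M (σ.reindex θ)) :=
  continuous_of_components
    (fun a i => continuous_obj (σ := σ) (θ.toOrderHom a) i)
    (fun _ _ h i => continuous_arr (σ := σ) _ _ (θ.toOrderHom.monotone h) i)

/-- Functoriality in the manifold, by postcomposition. -/
def postcomp {N : Man.{u} m} (g : M ⟶ N) (x : PatchString M σ) : PatchString N σ where
  obj a i := Man.Emb.comp g (x.obj a i)
  arr := x.arr
  obj_disjoint a i j hij := by
    have h := x.obj_disjoint a i j hij
    simp only [Man.Emb.comp, Set.range_comp]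
    exact (Set.disjoint_image_iff (Man.Emb.injective g)).2 h
  arr_disjoint := x.arr_disjoint
  arr_refl := x.arr_refl
  arr_comp := x.arr_comp
  obj_arr a b h i z := congrArg (Man.Emb.toFun g) (x.obj_arr a b h i z)

theorem continuous_postcomp {N : Man.{u} m} (g : M ⟶ N) :
    Continuous (postcomp g : PatchString M σ → PatchString N σ) :=
  continuous_of_components
    (fun a i => (Man.Emb.continuous_comp_left (show Man.Emb M N from g)).comp
      (continuous_obj a i))
    (fun a b h i => continuous_arr a b h i)

end PatchString

/-- The space of `p`-simplices of the nerve of the action groupoid of `∏_a O(m)^{k_a}` on the space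
of strings of patches over `k_0 ← ⋯ ← k_r`: strings `str 0, …, str p` together with group elements
`rot c d` taking `str d` to `str c`, subject to the cocycle condition. The group acts by
precomposition on embeddings `k_a × ℝ^m → M`, and by conjugation on embeddings
`k_b × ℝ^m → k_a × ℝ^m`. -/
@[ext]
structure PatchGrid {m : ℕ} (M : Man.{u} m) {r : SimplexCategory} (σ : FinString.{u} r)
    (p : SimplexCategory) where
  str : Fin (p.len + 1) → PatchString M σ
  rot : Fin (p.len + 1) → Fin (p.len + 1) → ∀ a : Fin (r.len + 1), Fin (σ.card a) →
    Matrix.orthogonalGroup (Fin m) ℝ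
  rot_mul : ∀ c d e a i, rot c d a i * rot d e a i = rot c e a i
  obj_rot : ∀ c d a i z, (str c).obj a i (rotate (rot c d a i) z) = (str d).obj a i z
  arr_rot : ∀ c d a b (h : a ≤ b) i z,
    (str c).arr a b h i (rotate (rot c d b i) z) =
      rotate (rot c d a (σ.map h i)) ((str d).arr a b h i z)

namespace PatchGrid

variable {m : ℕ} {M : Man.{u} m} {r s p q : SimplexCategory} {σ : FinString.{u} r}

instance : TopologicalSpace (PatchGrid M σ p) :=
  TopologicalSpace.induced (fun x => (x.str, x.rot)) inferInstance

theorem continuous_strRot :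
    Continuous (fun x : PatchGrid M σ p => (x.str, x.rot)) := continuous_induced_dom

/-- The simplicial operators in the direction of the nerve of the configuration category. -/
def reindex (θ : s ⟶ r) (x : PatchGrid M σ p) : PatchGrid M (σ.reindex θ) p where
  str c := (x.str c).reindex θ
  rot c d a := x.rot c d (θ.toOrderHom a)
  rot_mul c d e a := x.rot_mul c d e (θ.toOrderHom a)
  obj_rot c d a := x.obj_rot c d (θ.toOrderHom a)
  arr_rot c d _ _ h := x.arr_rot c d _ _ (θ.toOrderHom.monotone h)

theorem continuous_reindex (θ : s ⟶ r) :
    Continuous (reindex θ : PatchGrid M σ p → PatchGrid M (σ.reindex θ) p) := by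
  refine continuous_induced_rng.2 (Continuous.prodMk ?_ ?_)
  · exact continuous_pi fun c => (PatchString.continuous_reindex θ).comp
      ((continuous_apply c).comp (continuous_fst.comp continuous_strRot))
  · refine continuous_pi fun c => continuous_pi fun d => continuous_pi fun a => ?_
    exact (continuous_apply (θ.toOrderHom a)).comp ((continuous_apply d).comp
      ((continuous_apply c).comp (continuous_snd.comp continuous_strRot)))

/-- The simplicial operators in the direction of the action groupoid. -/
def reindexGroup (α : q ⟶ p) (x : PatchGrid M σ p) : PatchGrid M σ q where
  str c := x.str (α.toOrderHom c)
  rot c d := x.rot (α.toOrderHom c) (α.toOrderHom d)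
  rot_mul _ _ _ := x.rot_mul _ _ _
  obj_rot _ _ := x.obj_rot _ _
  arr_rot _ _ := x.arr_rot _ _

theorem continuous_reindexGroup (α : q ⟶ p) :
    Continuous (reindexGroup α : PatchGrid M σ p → PatchGrid M σ q) := by
  refine continuous_induced_rng.2 (Continuous.prodMk ?_ ?_)
  · exact continuous_pi fun c =>
      (continuous_apply (α.toOrderHom c)).comp (continuous_fst.comp continuous_strRot)
  · refine continuous_pi fun c => continuous_pi fun d => ?_
    exact (continuous_apply (α.toOrderHom d)).comp
      ((continuous_apply (α.toOrderHom c)).comp (continuous_snd.comp continuous_strRot))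

/-- Functoriality in the manifold. -/
def postcomp {N : Man.{u} m} (g : M ⟶ N) (x : PatchGrid M σ p) : PatchGrid N σ p where
  str c := (x.str c).postcomp g
  rot := x.rot
  rot_mul := x.rot_mul
  obj_rot c d a i z := congrArg (Man.Emb.toFun g) (x.obj_rot c d a i z)
  arr_rot := x.arr_rot

theorem continuous_postcomp {N : Man.{u} m} (g : M ⟶ N) :
    Continuous (postcomp g : PatchGrid M σ p → PatchGrid N σ p) := by
  refine continuous_induced_rng.2 (Continuous.prodMk ?_ ?_)
  · exact continuous_pi fun c => (PatchString.continuous_postcomp g).comp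
      ((continuous_apply c).comp (continuous_fst.comp continuous_strRot))
  · exact continuous_snd.comp continuous_strRot

end PatchGrid

/-- The strings in which all cardinalities are at most `k`. -/
abbrev BoundedString (k : ℕ∞) (r : SimplexCategory) : Type u :=
  {σ : FinString.{u} r // ∀ a, (σ.card a : ℕ∞) ≤ k}

/-- The simplicial operators. -/
abbrev BoundedString.reindex {k : ℕ∞} {r s : SimplexCategory} (θ : s ⟶ r)
    (σ : BoundedString.{u} k r) : BoundedString.{u} k s :=
  ⟨σ.1.reindex θ, fun a => σ.2 (θ.toOrderHom a)⟩

/-- The standard topological simplex. -/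
abbrev topSimplex (p : SimplexCategory) : Type := stdSimplex ℝ (Fin (p.len + 1))

/-- The map of standard topological simplices induced by `α`. -/
def topSimplexMap {p q : SimplexCategory} (α : q ⟶ p) : C(topSimplex q, topSimplex p) :=
  ⟨stdSimplex.map α.toOrderHom, stdSimplex.continuous_map _⟩

theorem topSimplexMap_id {p : SimplexCategory} (z : topSimplex p) : topSimplexMap (𝟙 p) z = z :=
  stdSimplex.map_id_apply z

theorem topSimplexMap_comp {p q l : SimplexCategory} (α : q ⟶ p) (β : l ⟶ q) (z : topSimplex l) :
    topSimplexMap (β ≫ α) z = topSimplexMap α (topSimplexMap β z) :=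
  (stdSimplex.map_comp_apply β.toOrderHom α.toOrderHom z).symm

/-- The `p`-simplices of the space of `r`-simplices of the configuration category of `M`, truncated
at cardinality `k`. This space is the coproduct, over all strings `k_0 ← ⋯ ← k_r` with all
`k_a ≤ k`, of the homotopy orbit spaces of `∏_a O(m)^{k_a}` acting on the space of strings of
patches over `k_0 ← ⋯ ← k_r`. The homotopy orbit space is taken as the diagonal of the bisimplicial
set obtained by applying the singular simplicial set functor to the nerve of the action groupoid. -/
abbrev ConfigSimplex {m : ℕ} (k : ℕ∞) (M : Man.{u} m) (r p : SimplexCategory) : Type u :=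
  Σ σ : BoundedString.{u} k r, C(topSimplex p, PatchGrid M σ.1 p)

namespace ConfigSimplex

variable {m : ℕ} {k : ℕ∞} {M N P : Man.{u} m} {r s t p q l : SimplexCategory}

/-- The simplicial operators in the space direction. -/
def mapSpace (α : q ⟶ p) (x : ConfigSimplex k M r p) : ConfigSimplex k M r q :=
  ⟨x.1, ⟨fun z => (x.2 (topSimplexMap α z)).reindexGroup α,
    (PatchGrid.continuous_reindexGroup α).comp
      (x.2.continuous.comp (topSimplexMap α).continuous)⟩⟩

/-- The simplicial operators in the category direction. -/
def mapString (θ : s ⟶ r) (x : ConfigSimplex k M r p) : ConfigSimplex k M s p :=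
  ⟨x.1.reindex θ, ⟨fun z => (x.2 z).reindex θ,
    (PatchGrid.continuous_reindex θ).comp x.2.continuous⟩⟩

/-- Functoriality in the manifold. -/
def mapMan (g : M ⟶ N) (x : ConfigSimplex k M r p) : ConfigSimplex k N r p :=
  ⟨x.1, ⟨fun z => (x.2 z).postcomp g, (PatchGrid.continuous_postcomp g).comp x.2.continuous⟩⟩

theorem mapSpace_id (x : ConfigSimplex k M r p) : mapSpace (𝟙 p) x = x :=
  Sigma.ext rfl (heq_of_eq (ContinuousMap.ext fun z => congrArg x.2 (topSimplexMap_id z)))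

theorem mapSpace_comp (α : q ⟶ p) (β : l ⟶ q) (x : ConfigSimplex k M r p) :
    mapSpace (β ≫ α) x = mapSpace β (mapSpace α x) :=
  Sigma.ext rfl (heq_of_eq (ContinuousMap.ext fun z =>
    congrArg (fun y => (x.2 y).reindexGroup (β ≫ α)) (topSimplexMap_comp α β z)))

theorem mapString_id (x : ConfigSimplex k M r p) : mapString (𝟙 r) x = x := rfl

theorem mapString_comp (θ : s ⟶ r) (η : t ⟶ s) (x : ConfigSimplex k M r p) :
    mapString (η ≫ θ) x = mapString η (mapString θ x) := rfl

theorem mapMan_id (x : ConfigSimplex k M r p) : mapMan (𝟙 M) x = x := rfl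

theorem mapMan_comp (g : M ⟶ N) (h : N ⟶ P) (x : ConfigSimplex k M r p) :
    mapMan (g ≫ h) x = mapMan h (mapMan g x) := rfl

end ConfigSimplex

/-- The space of `r`-simplices of the configuration category. -/
def configLevel {m : ℕ} (k : ℕ∞) (M : Man.{u} m) (r : SimplexCategory) : SSet.{u} where
  obj p := ConfigSimplex k M r p.unop
  map α := ↾(ConfigSimplex.mapSpace α.unop)
  map_id _ := ConcreteCategory.hom_ext _ _ fun x => ConfigSimplex.mapSpace_id x
  map_comp α β := ConcreteCategory.hom_ext _ _ fun x =>
    ConfigSimplex.mapSpace_comp α.unop β.unop x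

/-- The configuration category of `M`, truncated at cardinality `k`, as a simplicial space. -/
def configSpace {m : ℕ} (k : ℕ∞) (M : Man.{u} m) : SimplicialSpace.{u} where
  obj r := configLevel k M r.unop
  map θ := { app _ := ↾(ConfigSimplex.mapString θ.unop) }

/-- Functoriality of the configuration category in the manifold. -/
def configSpaceMap {m : ℕ} (k : ℕ∞) {M N : Man.{u} m} (g : M ⟶ N) :
    configSpace k M ⟶ configSpace k N where
  app _ := { app _ := ↾(ConfigSimplex.mapMan g) }

/-- The reference map from the configuration category to the nerve of the category of finite
sets. -/
def configSpaceToFin {m : ℕ} (k : ℕ∞) (M : Man.{u} m) : configSpace k M ⟶ nerveFin.{u} where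
  app r := { app p := ↾(fun x : ConfigSimplex k M r.unop p.unop => x.1.1) }

/-- The functor `M ↦ con(M; k)` from `m`-manifolds and codimension zero embeddings to simplicial
spaces over the nerve of the category of finite sets. For `k = ⊤`, this is `con(M)`. -/
def con (m : ℕ) (k : ℕ∞) : Man.{u} m ⥤ Over nerveFin.{u} where
  obj M := Over.mk (configSpaceToFin k M)
  map g := Over.homMk (configSpaceMap k g)

/-! ## Weak equivalences, homotopy limits and colimits -/

/-- Weak homotopy equivalences of simplicial sets: for every Kan complex `K`, precomposition with
`f` induces a bijection from homotopy classes of maps `Y ⟶ K` to homotopy classes of maps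
`X ⟶ K`. -/
def IsWeakEquiv {X Y : SSet.{u}} (f : X ⟶ Y) : Prop :=
  ∀ K : SSet.{u}, SSet.KanComplex K →
    (∀ g : X ⟶ K, ∃ h : Y ⟶ K, Nonempty (SSet.Homotopy (f ≫ h) g)) ∧
    (∀ h h' : Y ⟶ K, Nonempty (SSet.Homotopy (f ≫ h) (f ≫ h')) → Nonempty (SSet.Homotopy h h'))

/-- Levelwise weak equivalences of simplicial spaces. -/
def IsLevelwiseWeakEquiv {X Y : SimplicialSpace.{u}} (f : X ⟶ Y) : Prop :=
  ∀ r, IsWeakEquiv (f.app r)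

section HomotopyColimit

variable {J : Type u} [SmallCategory J] (X : Jᵒᵖ ⥤ SSet.{u})

/-- The simplicial operators on chains `c_0 → ⋯ → c_p` in `J`. -/
abbrev chainReindex {p q : SimplexCategory} (α : q ⟶ p) (c : ComposableArrows J p.len) :
    ComposableArrows J q.len := α.toOrderHom.monotone.functor ⋙ c

/-- The morphism from the last vertex of `α^* c` to the last vertex of `c`. -/
def lastVertexMap {p q : SimplexCategory} (α : q ⟶ p) (c : ComposableArrows J p.len) :
    (chainReindex α c).obj (Fin.last _) ⟶ c.obj (Fin.last _) :=
  c.toPrefunctor.map (homOfLE (Fin.le_last (α.toOrderHom (Fin.last _))))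

/-- The `p`-simplices of the Bousfield-Kan homotopy colimit of a contravariant functor `X` on `J`:
pairs consisting of a chain `c_0 → ⋯ → c_p` in `J` and a `p`-simplex of `X (c_p)`. -/
abbrev HocolimSimplex (p : SimplexCategory) : Type u :=
  Σ c : ComposableArrows J p.len, (X.obj (op (c.obj (Fin.last _)))).obj (op p)

/-- The simplicial operators of the homotopy colimit. -/
def HocolimSimplex.map {p q : SimplexCategory} (α : q ⟶ p) (x : HocolimSimplex X p) :
    HocolimSimplex X q :=
  ⟨chainReindex α x.1, (X.map (lastVertexMap α x.1).op).app (op q) ((X.obj _).map α.op x.2)⟩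

theorem HocolimSimplex.map_id {p : SimplexCategory} (x : HocolimSimplex X p) :
    HocolimSimplex.map X (𝟙 p) x = x := by
  refine Sigma.ext rfl (heq_of_eq ?_)
  have h : lastVertexMap (𝟙 p) x.1 = 𝟙 (x.1.obj (Fin.last _)) := x.1.map_id _
  have h2 : (X.obj (op (x.1.obj (Fin.last _)))).map (𝟙 p).op x.2 = x.2 :=
    ConcreteCategory.congr_hom ((X.obj _).map_id (op p)) x.2
  have h3 : (X.map (𝟙 (x.1.obj (Fin.last _))).op).app (op p) x.2 = x.2 :=
    ConcreteCategory.congr_hom (NatTrans.congr_app (X.map_id _) (op p)) x.2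
  exact (congrArg (fun f => (X.map f.op).app (op p) _) h).trans
    ((congrArg _ h2).trans h3)

theorem HocolimSimplex.map_comp {p q l : SimplexCategory} (α : q ⟶ p) (β : l ⟶ q)
    (x : HocolimSimplex X p) :
    HocolimSimplex.map X (β ≫ α) x = HocolimSimplex.map X β (HocolimSimplex.map X α x) := by
  refine Sigma.ext rfl (heq_of_eq ?_)
  have h : lastVertexMap (β ≫ α) x.1 =
      lastVertexMap β (chainReindex α x.1) ≫ lastVertexMap α x.1 :=
    x.1.map_comp (homOfLE (α.toOrderHom.monotone (Fin.le_last _))) (homOfLE (Fin.le_last _))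
  have h1 : (X.obj (op (x.1.obj (Fin.last _)))).map (β ≫ α).op x.2 =
      (X.obj _).map β.op ((X.obj _).map α.op x.2) :=
    ConcreteCategory.congr_hom ((X.obj _).map_comp α.op β.op) x.2
  have h2 : ∀ y, (X.map (lastVertexMap β (chainReindex α x.1) ≫ lastVertexMap α x.1).op).app
      (op l) y = (X.map (lastVertexMap β (chainReindex α x.1)).op).app (op l)
        ((X.map (lastVertexMap α x.1).op).app (op l) y) := fun y =>
    ConcreteCategory.congr_hom (NatTrans.congr_app
      (X.map_comp (lastVertexMap α x.1).op (lastVertexMap β (chainReindex α x.1)).op) (op l)) y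
  have h3 : ∀ y, (X.map (lastVertexMap α x.1).op).app (op l) ((X.obj _).map β.op y) =
      (X.obj _).map β.op ((X.map (lastVertexMap α x.1).op).app (op q) y) := fun y =>
    ConcreteCategory.congr_hom ((X.map (lastVertexMap α x.1).op).naturality β.op) y
  refine (congrArg (fun f => (X.map f.op).app (op l) _) h).trans ?_
  refine (congrArg _ h1).trans ((h2 _).trans ?_)
  exact congrArg _ (h3 _)

/-- The Bousfield-Kan homotopy colimit of a contravariant functor on `J`. -/
def hocolim : SSet.{u} where
  obj p := HocolimSimplex X p.unop
  map α := ↾(HocolimSimplex.map X α.unop)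
  map_id _ := ConcreteCategory.hom_ext _ _ fun x => HocolimSimplex.map_id X x
  map_comp α β := ConcreteCategory.hom_ext _ _ fun x =>
    HocolimSimplex.map_comp X α.unop β.unop x

variable {X}

/-- The map from the homotopy colimit to the vertex of a cocone. -/
def hocolimDesc (s : Limits.Cocone X) : hocolim X ⟶ s.pt where
  app p := ↾(fun x : HocolimSimplex X p.unop => (s.ι.app _).app p x.2)
  naturality p q α := ConcreteCategory.hom_ext _ _ fun (x : HocolimSimplex X p.unop) => by
    have h1 : ∀ y, (s.ι.app _).app q ((X.map (lastVertexMap α.unop x.1).op).app q y) =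
        (s.ι.app _).app q y := fun y =>
      ConcreteCategory.congr_hom (NatTrans.congr_app (s.w (lastVertexMap α.unop x.1).op) q) y
    exact (h1 _).trans
      (ConcreteCategory.congr_hom ((s.ι.app (op (x.1.obj (Fin.last _)))).naturality α) x.2)

end HomotopyColimit

section MappingSpaces

variable {C : Type w} [Category.{v} C]

/-- The functor `K ↦ F × K`, for a fixed diagram `F` of simplicial sets. -/
def tensorDiagram (F : C ⥤ SSet.{u}) : SSet.{u} ⥤ C ⥤ SSet.{u} :=
  tensoringRight SSet.{u} ⋙ (Functor.whiskeringLeft C SSet.{u} SSet.{u}).obj F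

/-- The projection `F × K ⟶ F`. -/
def tensorDiagramFst (F : C ⥤ SSet.{u}) (K : SSet.{u}) : (tensorDiagram F).obj K ⟶ F where
  app c := SemiCartesianMonoidalCategory.fst (F.obj c) K

end MappingSpaces

section HomotopyLimit

variable {J : Type u} [SmallCategory J]

/-- The diagram of simplicial sets `j ↦ N(J/j)`. -/
def overNerve (J : Type u) [SmallCategory J] : J ⥤ SSet.{u} := Over.mapFunctor J ⋙ nerveFunctor

/-- The Bousfield-Kan homotopy limit of `G : J ⥤ SSet`: its `p`-simplices are the natural
transformations `N(J/j) × Δ[p] ⟶ G(j)`. -/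
def holim (G : J ⥤ SSet.{u}) : SSet.{u} :=
  (SSet.stdSimplex ⋙ tensorDiagram (overNerve J)).op ⋙ yoneda.obj G

/-- A `p`-simplex `x` of the vertex of a cone over `G` induces the natural transformation
`N(J/j) × Δ[p] ⟶ Δ[p] ⟶ G(j)`, where the first map is the projection. -/
def holimLiftSimplex {G : J ⥤ SSet.{u}} (s : Limits.Cone G) {p : SimplexCategoryᵒᵖ}
    (x : s.pt.obj p) : (tensorDiagram (overNerve J)).obj (SSet.stdSimplex.obj p.unop) ⟶ G where
  app j := SemiCartesianMonoidalCategory.snd ((overNerve J).obj j) (SSet.stdSimplex.obj p.unop) ≫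
    SSet.yonedaEquiv.symm x ≫ s.π.app j
  naturality i j f := by
    exact congrArg (fun g => SemiCartesianMonoidalCategory.snd ((overNerve J).obj i)
      (SSet.stdSimplex.obj p.unop) ≫ SSet.yonedaEquiv.symm x ≫ g) (s.w f).symm

/-- The map from the vertex of a cone to the homotopy limit. -/
def holimLift {G : J ⥤ SSet.{u}} (s : Limits.Cone G) : s.pt ⟶ holim G where
  app p := ↾fun x => holimLiftSimplex s x
  naturality p q α := ConcreteCategory.hom_ext _ _ fun x => by
    refine NatTrans.ext (funext fun j => ?_)
    exact congrArg (fun g => SemiCartesianMonoidalCategory.snd ((overNerve J).obj j)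
      (SSet.stdSimplex.obj q.unop) ≫ g ≫ s.π.app j)
      (SSet.yonedaEquiv_symm_naturality_left α.unop x).symm

end HomotopyLimit

section MappingSpacesOver

variable {B : SimplicialSpace.{u}}

/-- The functor `(X, K) ↦ X × K` for simplicial spaces `X` over `B` and simplicial sets `K`. -/
def tensorOver : Over B ⥤ SSet.{u} ⥤ Over B where
  obj X :=
    { obj K := Over.mk (tensorDiagramFst X.left K ≫ X.hom)
      map g := Over.homMk ((tensorDiagram X.left).map g)
      map_id _ := rfl
      map_comp _ _ := rfl }
  map {X Y} f :=
    { app K := Over.homMk (Functor.whiskerRight f.left (tensorRight K))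
        (congrArg (fun g => tensorDiagramFst X.left K ≫ g) (Over.w f)) }
  map_id _ := rfl
  map_comp _ _ := rfl

/-- The simplicial mapping space `map_B(X, Y)`, as a contravariant functor of `X`: the `p`-simplices
are the maps `X × Δ[p] ⟶ Y` over `B`. -/
def mapOver (Y : Over B) : (Over B)ᵒᵖ ⥤ SSet.{u} where
  obj X := (SSet.stdSimplex ⋙ tensorOver.obj X.unop).op ⋙ yoneda.obj Y
  map f := Functor.whiskerRight
    (NatTrans.op (Functor.whiskerLeft SSet.stdSimplex (tensorOver.map f.unop))) (yoneda.obj Y)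

end MappingSpacesOver

/-- Injective fibrations of simplicial spaces: maps with the right lifting property with respect to
all monomorphisms that are levelwise weak equivalences. -/
def IsInjectiveFibration {X Y : SimplicialSpace.{u}} (f : X ⟶ Y) : Prop :=
  ∀ ⦃A A' : SimplicialSpace.{u}⦄ (i : A ⟶ A'), Mono i → IsLevelwiseWeakEquiv i →
    HasLiftingProperty i f

/-- `j : Y ⟶ Y'` is a fibrant replacement in the category of simplicial spaces over `B`, for the
model structure induced by the injective model structure on simplicial spaces. -/
structure IsFibrantReplacement {B : SimplicialSpace.{u}} {Y Y' : Over B} (j : Y ⟶ Y') : Prop where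
  weakEquiv : IsLevelwiseWeakEquiv j.left
  fibration : IsInjectiveFibration Y'.hom

/-- The contravariant functor `M ↦ map_Fin(con(M; k), Y)`. For an injectively fibrant replacement
`Y` of `con(N)` over the nerve of the category of finite sets, this is the derived mapping space
functor `M ↦ ℝmap_Fin(con(M; k), con(N))`, since all objects are cofibrant in the injective model
structure. -/
def mapFin (m : ℕ) (k : ℕ∞) (Y : Over nerveFin.{u}) : (Man.{u} m)ᵒᵖ ⥤ SSet.{u} :=
  (con m k).op ⋙ mapOver Y

/-! ## Homotopy sheaves and cosheaves -/

section Sheaves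

variable {m : ℕ}

/-- A family of codimension zero embeddings `V_i → M` is a covering for `J_k` if it is nonempty and
every subset of `M` of cardinality at most `k` is contained in the image of some `V_i`. -/
structure IsCovering (k : ℕ) {M : Man.{u} m} {ι : Type u} {V : ι → Man.{u} m}
    (f : ∀ i, V i ⟶ M) : Prop where
  nonempty : Nonempty ι
  subset_range : ∀ A : Finset M.carrier, A.card ≤ k →
    ∃ i, (A : Set M.carrier) ⊆ Set.range (Man.Emb.toFun (f i))

variable {M : Man.{u} m} {ι : Type u} {V : ι → Man.{u} m} (f : ∀ i, V i ⟶ M)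

/-- The poset of finite nonempty subsets. -/
abbrev FinSubset (ι : Type u) : Type u := {S : Finset ι // S.Nonempty}

/-- The intersection `U_S` of the images of the `V_i` for `i ∈ S`. -/
def interOpen (S : FinSubset ι) : TopologicalSpace.Opens M.carrier :=
  ⟨⋂ i ∈ S.1, Set.range (Man.Emb.toFun (f i)),
    isOpen_biInter_finset fun i _ => Man.Emb.isOpen_range (f i)⟩

theorem interOpen_mono {S T : FinSubset ι} (h : S ≤ T) : interOpen f T ≤ interOpen f S :=
  Set.biInter_subset_biInter_left h

/-- The contravariant diagram `S ↦ U_S` of manifolds. -/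
def interDiagram : (FinSubset ι)ᵒᵖ ⥤ Man.{u} m where
  obj S := M.ofOpen (interOpen f S.unop)
  map g := M.inclusion (interOpen_mono f (leOfHom g.unop))

/-- The inclusions `U_S → M`. -/
def interCocone : Limits.Cocone (interDiagram f) where
  pt := M
  ι := { app S := M.inclusionTop (interOpen f S.unop) }

/-- The inclusions `U_S → M`, in the opposite category. -/
def interCone : Limits.Cone (interDiagram f).rightOp where
  pt := op M
  π := { app S := (M.inclusionTop (interOpen f S)).op }

end Sheaves

/-- `F` is a homotopy sheaf for `J_k`: for every covering, the canonical map from `F(M)` to the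
homotopy limit of the `F(U_S)` is a weak equivalence. -/
def IsHomotopySheaf {m : ℕ} (k : ℕ) (F : (Man.{u} m)ᵒᵖ ⥤ SSet.{u}) : Prop :=
  ∀ ⦃M : Man.{u} m⦄ ⦃ι : Type u⦄ ⦃V : ι → Man.{u} m⦄ (f : ∀ i, V i ⟶ M), IsCovering k f →
    IsWeakEquiv (holimLift (F.mapCone (interCone f)))

/-- `F` is a homotopy cosheaf for `J_k`: for every covering, the canonical map to `F(M)` from the
homotopy colimit of the `F(U_S)` is a levelwise weak equivalence. Homotopy colimits of simplicial
spaces over `B` are computed degreewise. -/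
def IsHomotopyCosheaf {m : ℕ} (k : ℕ) {B : SimplicialSpace.{u}} (F : Man.{u} m ⥤ Over B) : Prop :=
  ∀ ⦃M : Man.{u} m⦄ ⦃ι : Type u⦄ ⦃V : ι → Man.{u} m⦄ (f : ∀ i, V i ⟶ M), IsCovering k f →
    ∀ r : SimplexCategoryᵒᵖ, IsWeakEquiv (hocolimDesc
      ((F ⋙ Over.forget B ⋙ (evaluation SimplexCategoryᵒᵖ SSet.{u}).obj r).mapCocone
        (interCocone f)))

end

end ConfigCat

namespace ConfigCat

open Simplicial HomotopicalAlgebra SSet.modelCategoryQuillen CartesianMonoidalCategory Limits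

local infixr:80 " ⨟ " => CategoryStruct.comp

noncomputable section

/-! ## Homotopies with values in Kan complexes -/

section Homotopies

variable {X Y Z K A B E : SSet.{u}}

/-! Cosheaf property. A simplex of the level-`r` space of the configuration category of `M` is a
continuous family of grids of patches over a topological simplex. For a covering `V_i → M`, let
`A_i` be the subcomplex of families all of whose patches lie in the image of `V_i`. Postcomposition
with an open embedding is injective and inducing, so the level-`r` space of `U_S` is the
intersection of the `A_i` with `i ∈ S`. The homotopy colimit of such finite intersections is
equivalent to the union of the `A_i` (`isWeakEquiv_hocolimDesc`): over a subcomplex of `A_i` the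
chains of index sets contract through `S ⊆ S ∪ {i} ⊇ {i}`.

It remains to see that the union of the `A_i` includes into everything by a weak equivalence
(`isWeakEquiv_coveredSub_ι`). This is a theorem on small simplices. The first patches of a string
can be contracted to their centres, of which there are at most `k`; so the centres lie in a single
`V_i`, and sufficient shrinking carries a whole neighbourhood of the string into `A_i`. The
subcomplex `small N` consists of the families that land in the cover piecewise, on sets of size
`2⁻ᴺ`, after shrinking by `N`. These subcomplexes exhaust everything by compactness, `small 0` is
the union of the `A_i`, and subdividing once while shrinking by one unit deforms `small (N + 1)`
into `small N`. The subdivision is the edgewise one, which is naturally equivalent to the identity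
(`isWeakEquiv_edgewiseFront`).

Sheaf property. Mapping out of a homotopy colimit is isomorphic to the homotopy limit of the mapping
spaces (`isIso_mapOverHocolim`). The map from the homotopy colimit to the configuration category of
`M` factors through the product with the nerve of the poset of finite nonempty index sets, which is
contractible. The first factor is a levelwise injective weak equivalence, and restriction along such
a map into a fibrant object is a trivial fibration (`isWeakEquiv_mapOver_of_mono`); the projection
has a section of the same kind.

The homotopy theory behind this is developed from the definition of weak equivalences by homotopy
classes of maps into Kan complexes. The class `acyclic` is defined by a left lifting property, hence
is stable under cobase change and under filtrations (`acyclic_of_chain`), and for monomorphisms it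
agrees with the weak equivalences (`acyclic_iff`). Other maps are replaced by inclusions into
mapping cylinders. -/

/-- A homotopy given by a map out of the cylinder. -/
def homotopyMk {f g : X ⟶ Y} (h : X ⊗ Δ[1] ⟶ Y) (h₀ : SSet.ι₀ ⨟ h = f) (h₁ : SSet.ι₁ ⨟ h = g) :
    SSet.Homotopy f g where
  h := h
  h₀ := h₀
  h₁ := h₁
  -- The homotopy is relative to the empty subcomplex, so this condition is vacuous.
  rel := by
    ext p ⟨⟨x, hx⟩, y⟩
    exact hx.elim

/-- Two maps of simplicial sets are homotopic. -/
def HRel (f g : X ⟶ Y) : Prop := Nonempty (SSet.Homotopy f g)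

theorem hRel_iff {f g : X ⟶ Y} : HRel f g ↔
    ∃ h : X ⊗ Δ[1] ⟶ Y, SSet.ι₀ ⨟ h = f ∧ SSet.ι₁ ⨟ h = g :=
  ⟨fun ⟨H⟩ => ⟨H.h, H.h₀, H.h₁⟩, fun ⟨h, h0, h1⟩ => ⟨homotopyMk h h0 h1⟩⟩

theorem HRel.refl (f : X ⟶ Y) : HRel f f :=
  hRel_iff.2 ⟨fst _ _ ⨟ f, rfl, rfl⟩

theorem HRel.postcomp {f g : X ⟶ Y} (H : HRel f g) (h : Y ⟶ Z) : HRel (f ⨟ h) (g ⨟ h) := by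
  obtain ⟨k, rfl, rfl⟩ := hRel_iff.1 H
  exact hRel_iff.2 ⟨k ⨟ h, rfl, rfl⟩

theorem HRel.precomp {f g : Y ⟶ Z} (H : HRel f g) (h : X ⟶ Y) : HRel (h ⨟ f) (h ⨟ g) := by
  obtain ⟨k, rfl, rfl⟩ := hRel_iff.1 H
  exact hRel_iff.2 ⟨h ▷ _ ⨟ k, rfl, rfl⟩

/-- Homotopies between maps out of `X ⊗ A` are homotopies between the curried maps. -/
theorem hRel_curry_iff {f g : A ⊗ X ⟶ K} :
    HRel (MonoidalClosed.curry f) (MonoidalClosed.curry g) ↔ HRel f g := by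
  constructor
  · intro H
    obtain ⟨h, h0, h1⟩ := hRel_iff.1 H
    refine hRel_iff.2 ⟨(α_ _ _ _).hom ⨟ MonoidalClosed.uncurry h, ?_, ?_⟩
    · have : SSet.ι₀ ⨟ (α_ A X Δ[1]).hom ⨟ MonoidalClosed.uncurry h =
        A ◁ SSet.ι₀ ⨟ MonoidalClosed.uncurry h := rfl
      rw [this, ← MonoidalClosed.uncurry_natural_left, h0, MonoidalClosed.uncurry_curry]
    · have : SSet.ι₁ ⨟ (α_ A X Δ[1]).hom ⨟ MonoidalClosed.uncurry h =
        A ◁ SSet.ι₁ ⨟ MonoidalClosed.uncurry h := rfl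
      rw [this, ← MonoidalClosed.uncurry_natural_left, h1, MonoidalClosed.uncurry_curry]
  · intro H
    obtain ⟨h, h0, h1⟩ := hRel_iff.1 H
    refine hRel_iff.2 ⟨MonoidalClosed.curry ((α_ _ _ _).inv ⨟ h), ?_, ?_⟩
    · rw [← MonoidalClosed.curry_natural_left, ← h0]
      rfl
    · rw [← MonoidalClosed.curry_natural_left, ← h1]
      rfl

theorem hRel_curry {f g : A ⊗ X ⟶ K} (H : HRel f g) :
    HRel (MonoidalClosed.curry f) (MonoidalClosed.curry g) := hRel_curry_iff.2 H

theorem hRel_uncurry {f g : X ⟶ (ihom A).obj K} (H : HRel f g) :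
    HRel (MonoidalClosed.uncurry f) (MonoidalClosed.uncurry g) := by
  rw [← hRel_curry_iff]
  simpa using H

end Homotopies

/-! ## Lifting in pushout-products -/

section Lifting

variable {A B S T E D : SSet.{u}}

/-- Unfolds lifting against a pushout-product into extending compatible maps on `B ⊗ S` and `A ⊗ T`
to `B ⊗ T`. Together with the converse below it lets later arguments avoid the pushout itself. -/
theorem exists_lift_pushoutProduct {i : A ⟶ B} {j : S ⟶ T} {p : E ⟶ D}
    (h : HasLiftingProperty (i □ j).hom p) (f : B ⊗ S ⟶ E) (g : A ⊗ T ⟶ E) (b : B ⊗ T ⟶ D)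
    (hfg : i ▷ S ⨟ f = A ◁ j ⨟ g) (hf : f ⨟ p = B ◁ j ⨟ b) (hg : g ⨟ p = i ▷ T ⨟ b) :
    ∃ l : B ⊗ T ⟶ E, B ◁ j ⨟ l = f ∧ i ▷ T ⨟ l = g ∧ l ⨟ p = b := by
  let sq := Functor.PushoutObjObj.ofHasPushout (curriedTensor SSet.{u}) i j
  have h' : HasLiftingProperty sq.ι p := h
  have e1 : sq.inl ⨟ sq.ι = B ◁ j := sq.inl_ι
  have e2 : sq.inr ⨟ sq.ι = i ▷ T := sq.inr_ι
  have w : sq.isPushout.desc f g hfg ⨟ p = sq.ι ⨟ b := by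
    apply sq.isPushout.hom_ext
    · rw [IsPushout.inl_desc_assoc, hf, reassoc_of% e1]
    · rw [IsPushout.inr_desc_assoc, hg, reassoc_of% e2]
  have sq' : CommSq (sq.isPushout.desc f g hfg) sq.ι p b := ⟨w⟩
  refine ⟨sq'.lift, ?_, ?_, sq'.fac_right⟩
  · rw [← e1, Category.assoc, sq'.fac_left, IsPushout.inl_desc]
  · rw [← e2, Category.assoc, sq'.fac_left, IsPushout.inr_desc]

theorem hasLiftingProperty_pushoutProduct {i : A ⟶ B} {j : S ⟶ T} {p : E ⟶ D}
    (h : ∀ (f : B ⊗ S ⟶ E) (g : A ⊗ T ⟶ E) (b : B ⊗ T ⟶ D),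
      i ▷ S ⨟ f = A ◁ j ⨟ g → f ⨟ p = B ◁ j ⨟ b → g ⨟ p = i ▷ T ⨟ b →
      ∃ l : B ⊗ T ⟶ E, B ◁ j ⨟ l = f ∧ i ▷ T ⨟ l = g ∧ l ⨟ p = b) :
    HasLiftingProperty (i □ j).hom p := by
  let sq := Functor.PushoutObjObj.ofHasPushout (curriedTensor SSet.{u}) i j
  have e1 : sq.inl ⨟ sq.ι = B ◁ j := sq.inl_ι
  have e2 : sq.inr ⨟ sq.ι = i ▷ T := sq.inr_ι
  change HasLiftingProperty sq.ι p
  refine ⟨fun {t b} w => ⟨?_⟩⟩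
  obtain ⟨l, h1, h2, h3⟩ := h (sq.inl ⨟ t) (sq.inr ⨟ t) b
    (by
      have := sq.isPushout.w
      exact (Category.assoc _ _ _).symm.trans ((congrArg (· ⨟ t) this).trans (Category.assoc _ _ _)))
    (by rw [Category.assoc, w.w, ← e1, Category.assoc])
    (by rw [Category.assoc, w.w, ← e2, Category.assoc])
  exact ⟨⟨l, sq.isPushout.hom_ext (by rw [reassoc_of% e1, h1]) (by rw [reassoc_of% e2, h2]), h3⟩⟩

theorem hasLiftingProperty_of_anodyne {i : A ⟶ B} [Mono i] {j : S ⟶ T}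
    (hj : SSet.anodyneExtensions j) (p : E ⟶ D) [Fibration p] :
    HasLiftingProperty (i □ j).hom p :=
  SSet.anodyneExtensions_pushoutObjObjι (Functor.PushoutObjObj.ofHasPushout _ i j) hj _
    (by rwa [← HomotopicalAlgebra.fibration_iff])

/-- A horn in `Δ[1]` has a single face: the one at vertex `i.rev` consists of the face `i`. Filling
it is therefore lifting along the face inclusion. -/
theorem anodyne_δ (i : Fin 2) : SSet.anodyneExtensions (SSet.stdSimplex.{u}.δ i) := by
  intro E D p hp
  have hp' : Fibration p := by rwa [HomotopicalAlgebra.fibration_iff]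
  refine ⟨fun {t b} w => ⟨?_⟩⟩
  have hf : SSet.horn.IsCompatible (i := i.rev) (fun _ _ => t) := trivial
  obtain ⟨φ, h1, h2⟩ := hf.exists_lift p b (fun j hj => by
    have : j = i := by
      revert hj; revert j; fin_cases i <;> decide
    rw [this]
    exact w.w)
  exact ⟨⟨φ, h1 i (by fin_cases i <;> decide), h2⟩⟩

end Lifting

/-! ### Homotopy lifting, and homotopy as an equivalence relation on maps into Kan complexes. -/

section Lifting

variable {X A B E D K : SSet.{u}}

theorem whiskerLeft_δ_one (X : SSet.{u}) :
    X ◁ SSet.stdSimplex.δ (1 : Fin 2) = fst X Δ[0] ⨟ SSet.ι₀ := by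
  rw [SSet.stdSimplex.δ_one_eq_const]
  rfl

theorem whiskerLeft_δ_zero (X : SSet.{u}) :
    X ◁ SSet.stdSimplex.δ (0 : Fin 2) = fst X Δ[0] ⨟ SSet.ι₁ := by
  rw [SSet.stdSimplex.δ_zero_eq_const]
  rfl

theorem fst_zero_cancel {f g : X ⟶ E} (h : fst X Δ[0] ⨟ f = fst X Δ[0] ⨟ g) : f = g := by
  have e : lift (𝟙 X) (SSet.const (SSet.stdSimplex.obj₀Equiv.{u}.symm (0 : Fin 1))) ⨟
    fst X Δ[0] = 𝟙 X := rfl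
  rw [← Category.id_comp f, ← e, Category.assoc, h, reassoc_of% e]

theorem fst_ι₀_uncurry (e : Δ[1] ⟶ (ihom X).obj E) :
    fst X Δ[0] ⨟ SSet.ι₀ ⨟ MonoidalClosed.uncurry e =
      MonoidalClosed.uncurry (SSet.stdSimplex.δ (1 : Fin 2) ⨟ e) := by
  rw [MonoidalClosed.uncurry_natural_left, whiskerLeft_δ_one, Category.assoc]

theorem fst_ι₁_uncurry (e : Δ[1] ⟶ (ihom X).obj E) :
    fst X Δ[0] ⨟ SSet.ι₁ ⨟ MonoidalClosed.uncurry e =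
      MonoidalClosed.uncurry (SSet.stdSimplex.δ (0 : Fin 2) ⨟ e) := by
  rw [MonoidalClosed.uncurry_natural_left, whiskerLeft_δ_zero, Category.assoc]

/-- The relative homotopy lifting property of Kan fibrations. -/
theorem exists_homotopy_lift (i : A ⟶ B) [Mono i] (p : E ⟶ D) [Fibration p] (f : B ⟶ E)
    (H : A ⊗ Δ[1] ⟶ E) (b : B ⊗ Δ[1] ⟶ D) (h₀ : SSet.ι₀ ⨟ H = i ⨟ f)
    (hf : f ⨟ p = SSet.ι₀ ⨟ b) (hH : H ⨟ p = (i ▷ Δ[1]) ⨟ b) :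
    ∃ G : B ⊗ Δ[1] ⟶ E, SSet.ι₀ ⨟ G = f ∧ (i ▷ Δ[1]) ⨟ G = H ∧ G ⨟ p = b := by
  obtain ⟨G, h1, h2, h3⟩ := exists_lift_pushoutProduct
    (hasLiftingProperty_of_anodyne (i := i) (anodyne_δ (1 : Fin 2)) p) (fst _ _ ⨟ f) H b
    (by
      rw [whiskerLeft_δ_one, Category.assoc, h₀]
      rfl)
    (by rw [Category.assoc, hf, whiskerLeft_δ_one, Category.assoc]) hH
  refine ⟨G, ?_, h2, h3⟩
  rw [whiskerLeft_δ_one, Category.assoc] at h1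
  have e : lift (𝟙 B) (SSet.const (SSet.stdSimplex.obj₀Equiv.{u}.symm (0 : Fin 1))) ⨟
    fst B Δ[0] = 𝟙 B := rfl
  rw [← Category.id_comp f, ← e, Category.assoc, ← h1, reassoc_of% e]

/-- In the function complex from `X` to `E`, the two homotopies are the edges `0 → 1` and `0 → 2` of
a horn `Λ[2, 0]`. It lies over the degenerate triangle on `H₁ ⨟ p` in which the edge `1 → 2` is
collapsed. A filler over this triangle has the required homotopy as its face opposite `0`, which is
constant in `D`. -/
theorem exists_fibrewise_homotopy (p : E ⟶ D) [Fibration p] (H₁ H₂ : X ⊗ Δ[1] ⟶ E)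
    (h₀ : SSet.ι₀ ⨟ H₁ = SSet.ι₀ ⨟ H₂) (hp : H₁ ⨟ p = H₂ ⨟ p) :
    ∃ G : X ⊗ Δ[1] ⟶ E, SSet.ι₀ ⨟ G = SSet.ι₁ ⨟ H₁ ∧ SSet.ι₁ ⨟ G = SSet.ι₁ ⨟ H₂ ∧
      G ⨟ p = fst _ _ ⨟ SSet.ι₁ ⨟ H₁ ⨟ p := by
  let f : ∀ (j : Fin 3) (_ : j ≠ 0), Δ[1] ⟶ (ihom X).obj E := fun j _ =>
    MonoidalClosed.curry (if j = 2 then H₁ else H₂)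
  have hf : SSet.horn.IsCompatible f := by
    rw [SSet.horn.isCompatible_iff]
    intro j k hj hk hjk
    obtain ⟨rfl, rfl⟩ : j = 1 ∧ k = 2 := by
      revert j k
      decide
    change SSet.stdSimplex.δ (1 : Fin 2) ⨟ MonoidalClosed.curry H₂ =
      SSet.stdSimplex.δ (1 : Fin 2) ⨟ MonoidalClosed.curry H₁
    rw [← MonoidalClosed.curry_natural_left, ← MonoidalClosed.curry_natural_left,
      whiskerLeft_δ_one, Category.assoc, Category.assoc, h₀]
  let b : Δ[2] ⟶ (ihom X).obj D := SSet.stdSimplex.σ (1 : Fin 2) ⨟ MonoidalClosed.curry (H₁ ⨟ p)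
  obtain ⟨φ, h1, h2⟩ := hf.exists_lift ((ihom X).map p) b (by
    intro j hj
    have : f j hj ⨟ (ihom X).map p = MonoidalClosed.curry (H₁ ⨟ p) := by
      rw [← MonoidalClosed.curry_natural_right]
      by_cases h : j = 2
      · simp [h]
      · simp [h, hp]
    rw [this]
    have e : SSet.stdSimplex.δ j ⨟ SSet.stdSimplex.σ (1 : Fin 2) = 𝟙 (Δ[1] : SSet.{u}) := by
      fin_cases j
      · exact (hj rfl).elim
      · exact SSet.stdSimplex.δ_comp_σ_self (i := (1 : Fin 2))
      · exact SSet.stdSimplex.δ_comp_σ_succ (i := (1 : Fin 2))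
    rw [reassoc_of% e])
  refine ⟨MonoidalClosed.uncurry (SSet.stdSimplex.δ (0 : Fin 3) ⨟ φ), ?_, ?_, ?_⟩
  · have e : SSet.stdSimplex.δ (1 : Fin 2) ⨟ SSet.stdSimplex.δ (0 : Fin 3) =
      (SSet.stdSimplex.δ (0 : Fin 2) ⨟ SSet.stdSimplex.δ (2 : Fin 3) : (Δ[0] : SSet.{u}) ⟶ _) :=
      (SSet.stdSimplex.δ_comp_δ (i := (0 : Fin 2)) (j := (1 : Fin 2)) (by decide)).symm
    have := h1 2 (by decide)
    have h : SSet.stdSimplex.δ (1 : Fin 2) ⨟ SSet.stdSimplex.δ (0 : Fin 3) ⨟ φ =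
        SSet.stdSimplex.δ (0 : Fin 2) ⨟ MonoidalClosed.curry H₁ := by
      rw [reassoc_of% e, this]
      rfl
    apply fst_zero_cancel
    rw [fst_ι₀_uncurry, h, ← fst_ι₁_uncurry, MonoidalClosed.uncurry_curry]
  · have e : SSet.stdSimplex.δ (0 : Fin 2) ⨟ SSet.stdSimplex.δ (0 : Fin 3) =
      (SSet.stdSimplex.δ (0 : Fin 2) ⨟ SSet.stdSimplex.δ (1 : Fin 3) : (Δ[0] : SSet.{u}) ⟶ _) :=
      (SSet.stdSimplex.δ_comp_δ (i := (0 : Fin 2)) (j := (0 : Fin 2)) (by decide)).symm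
    have := h1 1 (by decide)
    have h : SSet.stdSimplex.δ (0 : Fin 2) ⨟ SSet.stdSimplex.δ (0 : Fin 3) ⨟ φ =
        SSet.stdSimplex.δ (0 : Fin 2) ⨟ MonoidalClosed.curry H₂ := by
      rw [reassoc_of% e, this]
      rfl
    apply fst_zero_cancel
    rw [fst_ι₁_uncurry, h, ← fst_ι₁_uncurry, MonoidalClosed.uncurry_curry]
  · rw [← MonoidalClosed.uncurry_natural_right, Category.assoc, h2]
    have e : SSet.stdSimplex.δ (0 : Fin 3) ⨟ SSet.stdSimplex.σ (1 : Fin 2) =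
      (SSet.const (SSet.stdSimplex.obj₀Equiv.symm 1) : (Δ[1] : SSet.{u}) ⟶ Δ[1]) := by
      have := SSet.stdSimplex.{u}.δ_comp_σ_of_le (i := (0 : Fin 2)) (j := (0 : Fin 1)) (by decide)
      refine Eq.trans this ?_
      rw [SSet.stdSimplex.δ_zero_eq_const]
      rfl
    change MonoidalClosed.uncurry (SSet.stdSimplex.δ (0 : Fin 3) ⨟
      SSet.stdSimplex.σ (1 : Fin 2) ⨟ MonoidalClosed.curry (H₁ ⨟ p)) = _
    rw [reassoc_of% e, MonoidalClosed.uncurry_natural_left, MonoidalClosed.uncurry_curry]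
    rfl

/-- This is the fibrewise statement over a point. With reflexivity it yields symmetry and
transitivity. -/
theorem HRel.euclidean [SSet.KanComplex K] {f g h : X ⟶ K} (h₁ : HRel f g) (h₂ : HRel f h) :
    HRel g h := by
  obtain ⟨H₁, rfl, rfl⟩ := hRel_iff.1 h₁
  obtain ⟨H₂, h0, rfl⟩ := hRel_iff.1 h₂
  have : Fibration (terminal.from K) := (isFibrant_iff K).1 inferInstance
  obtain ⟨G, h1, h2, -⟩ := exists_fibrewise_homotopy (terminal.from K) H₁ H₂ h0.symm
    (Subsingleton.elim _ _)
  exact hRel_iff.2 ⟨G, h1, h2⟩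

theorem HRel.symm [SSet.KanComplex K] {f g : X ⟶ K} (h : HRel f g) : HRel g f :=
  h.euclidean (HRel.refl f)

theorem HRel.trans [SSet.KanComplex K] {f g h : X ⟶ K} (h₁ : HRel f g) (h₂ : HRel g h) :
    HRel f h :=
  h₁.symm.euclidean h₂

end Lifting

/-! ## Weak equivalences -/

namespace IsWeakEquiv

variable {X Y Z A B T K : SSet.{u}}

theorem exists_extension {f : X ⟶ Y} (hf : IsWeakEquiv f) (K : SSet.{u}) [SSet.KanComplex K]
    (g : X ⟶ K) : ∃ h : Y ⟶ K, HRel (f ⨟ h) g :=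
  (hf K inferInstance).1 g

theorem hRel_of_comp {f : X ⟶ Y} (hf : IsWeakEquiv f) {K : SSet.{u}} [SSet.KanComplex K]
    {h h' : Y ⟶ K} (H : HRel (f ⨟ h) (f ⨟ h')) : HRel h h' :=
  (hf K inferInstance).2 h h' H

theorem mk' {f : X ⟶ Y} (h₁ : ∀ (K : SSet.{u}) [SSet.KanComplex K] (g : X ⟶ K),
    ∃ h : Y ⟶ K, HRel (f ⨟ h) g) (h₂ : ∀ (K : SSet.{u}) [SSet.KanComplex K] (h h' : Y ⟶ K),
      HRel (f ⨟ h) (f ⨟ h') → HRel h h') : IsWeakEquiv f :=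
  fun K _ => ⟨fun g => h₁ K g, fun h h' => h₂ K h h'⟩

theorem comp {f : X ⟶ Y} {g : Y ⟶ Z} (hf : IsWeakEquiv f) (hg : IsWeakEquiv g) :
    IsWeakEquiv (f ⨟ g) := by
  refine mk' (fun K _ a => ?_) (fun K _ h h' H => ?_)
  · obtain ⟨b, hb⟩ := hf.exists_extension K a
    obtain ⟨c, hc⟩ := hg.exists_extension K b
    exact ⟨c, by simpa using (hc.precomp f).trans hb⟩
  · exact hg.hRel_of_comp (hf.hRel_of_comp (by simpa using H))

theorem of_comp_left {f : X ⟶ Y} {g : Y ⟶ Z} (hf : IsWeakEquiv f) (hfg : IsWeakEquiv (f ⨟ g)) :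
    IsWeakEquiv g := by
  refine mk' (fun K _ a => ?_) (fun K _ h h' H => ?_)
  · obtain ⟨c, hc⟩ := hfg.exists_extension K (f ⨟ a)
    exact ⟨c, hf.hRel_of_comp (by simpa using hc)⟩
  · exact hfg.hRel_of_comp (by simpa using H.precomp f)

theorem of_comp_right {f : X ⟶ Y} {g : Y ⟶ Z} (hg : IsWeakEquiv g) (hfg : IsWeakEquiv (f ⨟ g)) :
    IsWeakEquiv f := by
  refine mk' (fun K _ a => ?_) (fun K _ h h' H => ?_)
  · obtain ⟨c, hc⟩ := hfg.exists_extension K a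
    exact ⟨g ⨟ c, by simpa using hc⟩
  · obtain ⟨c, hc⟩ := hg.exists_extension K h
    obtain ⟨c', hc'⟩ := hg.exists_extension K h'
    have h1 := ((hc.precomp f).trans H).trans (hc'.precomp f).symm
    have h2 := hfg.hRel_of_comp (h := c) (h' := c') (by simpa using h1)
    exact (hc.symm.trans (h2.precomp g)).trans hc'

theorem congr {f g : X ⟶ Y} (hf : IsWeakEquiv f) (H : HRel f g) : IsWeakEquiv g := by
  refine mk' (fun K _ a => ?_) (fun K _ h h' H' => ?_)
  · obtain ⟨c, hc⟩ := hf.exists_extension K a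
    exact ⟨c, (H.postcomp c).symm.trans hc⟩
  · exact hf.hRel_of_comp (((H.postcomp h).trans H').trans (H.postcomp h').symm)

theorem id (X : SSet.{u}) : IsWeakEquiv (𝟙 X) :=
  mk' (fun _ _ a => ⟨a, by simpa using HRel.refl a⟩) (fun _ _ _ _ H => by simpa using H)

theorem congr' {f g : X ⟶ Y} (hg : IsWeakEquiv g) (H : HRel f g) : IsWeakEquiv f := by
  refine mk' (fun K _ a => ?_) (fun K _ h h' H' => ?_)
  · obtain ⟨c, hc⟩ := hg.exists_extension K a
    exact ⟨c, (H.postcomp c).trans hc⟩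
  · exact hg.hRel_of_comp (((H.postcomp h).symm.trans H').trans (H.postcomp h'))

/-- If `f ⨟ g` and `g ⨟ h` are weak equivalences, then so is `g`. -/
theorem two_of_six {f : X ⟶ Y} {g : Y ⟶ Z} {h : Z ⟶ T} (hfg : IsWeakEquiv (f ⨟ g))
    (hgh : IsWeakEquiv (g ⨟ h)) : IsWeakEquiv g := by
  refine mk' (fun K _ a => ?_) (fun K _ b b' H => ?_)
  · obtain ⟨c, hc⟩ := hgh.exists_extension K a
    exact ⟨h ⨟ c, by simpa using hc⟩
  · exact hfg.hRel_of_comp (by simpa using H.precomp f)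

theorem of_homotopyEquiv {f : X ⟶ Y} {g : Y ⟶ X} (h₁ : IsWeakEquiv (f ⨟ g))
    (h₂ : IsWeakEquiv (g ⨟ f)) : IsWeakEquiv f :=
  two_of_six h₂ h₁

theorem of_isIso (f : X ⟶ Y) [IsIso f] : IsWeakEquiv f :=
  of_homotopyEquiv (g := inv f) (by simpa using id X) (by simpa using id Y)

/-- Maps `T ⊗ X ⟶ K` are maps from `X` to the exponential of `K` by `T`, which is again a Kan
complex, and homotopies correspond under currying. -/
theorem whiskerLeft {f : X ⟶ Y} (hf : IsWeakEquiv f) (T : SSet.{u}) : IsWeakEquiv (T ◁ f) := by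
  refine mk' (fun K _ a => ?_) (fun K _ h h' H => ?_)
  · obtain ⟨c, hc⟩ := hf.exists_extension _ (MonoidalClosed.curry a)
    refine ⟨MonoidalClosed.uncurry c, ?_⟩
    simpa [MonoidalClosed.uncurry_natural_left] using hRel_uncurry hc
  · rw [← hRel_curry_iff]
    refine hf.hRel_of_comp ?_
    rw [← MonoidalClosed.curry_natural_left, ← MonoidalClosed.curry_natural_left]
    exact hRel_curry H

theorem whiskerRight {f : X ⟶ Y} (hf : IsWeakEquiv f) (T : SSet.{u}) : IsWeakEquiv (f ▷ T) := by
  have e : f ▷ T = (β_ X T).hom ⨟ T ◁ f ⨟ (β_ T Y).hom := rfl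
  rw [e]
  exact (of_isIso _).comp ((hf.whiskerLeft T).comp (of_isIso _))

end IsWeakEquiv

/-! ## Acyclic cofibrations -/

section Acyclic

/-- The restriction maps `K ^ T ⟶ K ^ S`, for monomorphisms `S ⟶ T` and Kan complexes `K`. -/
inductive restrictionMaps : MorphismProperty.{u} SSet.{u} where
  | mk (K : SSet.{u}) [SSet.KanComplex K] {S T : SSet.{u}} (j : S ⟶ T) [Mono j] :
    restrictionMaps ((MonoidalClosed.pre j).app K)

/-- Maps with the left lifting property against all restriction maps `K ^ T ⟶ K ^ S`. -/
def acyclic : MorphismProperty SSet.{u} := restrictionMaps.llp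
deriving MorphismProperty.IsMultiplicative, MorphismProperty.RespectsIso,
  MorphismProperty.IsStableUnderCobaseChange

variable {X Y A B K S T : SSet.{u}}

/-- The two-variable adjunction between products and exponentials. It makes acyclicity of `i` a
concrete extension property: maps into `K` extend from `B ⊗ S ∪ A ⊗ T` to `B ⊗ T`. -/
theorem hasLiftingProperty_pre_iff (i : A ⟶ B) (j : S ⟶ T) (K : SSet.{u}) :
    HasLiftingProperty i ((MonoidalClosed.pre j).app K) ↔
      HasLiftingProperty (i □ j).hom (terminal.from K) := by
  have h1 := MonoidalClosed.internalHomAdjunction₂.hasLiftingProperty_iff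
    (Functor.PushoutObjObj.ofHasPushout (curriedTensor SSet.{u}) j i)
    (Functor.PullbackObjObj.ofIsTerminal
      MonoidalClosed.internalHom j (terminal.from K) terminalIsTerminal)
  refine h1.symm.trans ?_
  exact HasLiftingProperty.iff_of_arrow_iso_left
    (Arrow.PushoutProduct.braiding (Arrow.mk j) (Arrow.mk i)) _

theorem acyclic.exists_extension {i : A ⟶ B} (hi : acyclic i) (j : S ⟶ T) [Mono j]
    [SSet.KanComplex K] (f : B ⊗ S ⟶ K) (g : A ⊗ T ⟶ K) (h : (i ▷ S) ⨟ f = (A ◁ j) ⨟ g) :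
    ∃ l : B ⊗ T ⟶ K, (B ◁ j) ⨟ l = f ∧ (i ▷ T) ⨟ l = g := by
  obtain ⟨l, h1, h2, -⟩ := exists_lift_pushoutProduct
    ((hasLiftingProperty_pre_iff i j K).1 (hi _ ⟨K, j⟩)) f g (terminal.from _) h
    (Subsingleton.elim _ _) (Subsingleton.elim _ _)
  exact ⟨l, h1, h2⟩

theorem acyclic_of_exists {i : A ⟶ B} (h : ∀ (K : SSet.{u}) [SSet.KanComplex K]
    (S T : SSet.{u}) (j : S ⟶ T) [Mono j] (f : B ⊗ S ⟶ K) (g : A ⊗ T ⟶ K),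
    (i ▷ S) ⨟ f = (A ◁ j) ⨟ g → ∃ l : B ⊗ T ⟶ K, (B ◁ j) ⨟ l = f ∧ (i ▷ T) ⨟ l = g) :
    acyclic i := by
  rintro _ _ _ ⟨K, j⟩
  rw [hasLiftingProperty_pre_iff]
  refine hasLiftingProperty_pushoutProduct fun f g b hfg _ _ => ?_
  obtain ⟨l, h1, h2⟩ := h K _ _ j f g hfg
  exact ⟨l, h1, h2, Subsingleton.elim _ _⟩

instance mono_whiskerLeft (E : SSet.{u}) {j : S ⟶ T} [Mono j] : Mono (E ◁ j) := by
  refine ⟨fun a b h => CartesianMonoidalCategory.hom_ext _ _ ?_ ?_⟩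
  · exact congrArg (· ⨟ fst E T) h
  · rw [← cancel_mono j]
    exact congrArg (· ⨟ snd E T) h

instance mono_whiskerRight (E : SSet.{u}) {j : S ⟶ T} [Mono j] : Mono (j ▷ E) := by
  refine ⟨fun a b h => CartesianMonoidalCategory.hom_ext _ _ ?_ ?_⟩
  · rw [← cancel_mono j]
    exact congrArg (· ⨟ fst T E) h
  · exact congrArg (· ⨟ snd T E) h

/-- Maps out of `B ⊗ ∂Δ[1]`. -/
theorem exists_map_tensor_boundary (h h' : B ⟶ K) :
    ∃ m : B ⊗ (∂Δ[1] : (Δ[1] : SSet.{u}).Subcomplex).toSSet ⟶ K,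
      (∀ l : B ⊗ Δ[1] ⟶ K, B ◁ (∂Δ[1] : (Δ[1] : SSet.{u}).Subcomplex).ι ⨟ l = m →
        SSet.ι₀ ⨟ l = h ∧ SSet.ι₁ ⨟ l = h') ∧
      ∀ {A K' : SSet.{u}} (i : A ⟶ B) (q : K ⟶ K') (G : A ⊗ Δ[1] ⟶ K'),
        SSet.ι₀ ⨟ G = i ⨟ h ⨟ q → SSet.ι₁ ⨟ G = i ⨟ h' ⨟ q →
        (i ▷ _) ⨟ m ⨟ q = (A ◁ (∂Δ[1] : (Δ[1] : SSet.{u}).Subcomplex).ι) ⨟ G := by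
  -- A simplex of `∂Δ[1]` is a monotone map to `{0, 1}` that is not surjective, hence constant. So
  -- `B ⊗ ∂Δ[1]` is two copies of `B`, and a map out of it may be chosen according to the value at
  -- the first vertex.
  have key : ∀ (n : SimplexCategoryᵒᵖ) (x : Δ[1].obj n),
      x ∈ (∂Δ[1] : (Δ[1] : SSet.{u}).Subcomplex).obj n →
      ∀ i j, SSet.stdSimplex.asOrderHom x i = SSet.stdSimplex.asOrderHom x j := by
    intro n x hx i j
    by_contra hne
    refine hx fun k => ?_
    have hne' : SSet.stdSimplex.asOrderHom x i ≠ SSet.stdSimplex.asOrderHom x j := hne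
    by_cases hk : SSet.stdSimplex.asOrderHom x i = k
    · exact ⟨i, hk⟩
    · exact ⟨j, by omega⟩
  classical
  let m : B ⊗ (∂Δ[1] : (Δ[1] : SSet.{u}).Subcomplex).toSSet ⟶ K :=
    { app n := ↾fun x => if SSet.stdSimplex.asOrderHom x.2.1 0 = 0 then h.app n x.1
        else h'.app n x.1
      naturality := by
        intro n n' α
        ext x
        have e : SSet.stdSimplex.asOrderHom
            ((Δ[1] : SSet.{u}).map α x.2.1) 0 = SSet.stdSimplex.asOrderHom x.2.1 0 :=
          key n _ x.2.2 _ _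
        change (if SSet.stdSimplex.asOrderHom ((Δ[1] : SSet.{u}).map α x.2.1) 0 = 0
          then h.app n' (B.map α x.1) else h'.app n' (B.map α x.1)) =
          K.map α (if SSet.stdSimplex.asOrderHom x.2.1 0 = 0 then h.app n x.1 else h'.app n x.1)
        rw [e]
        split_ifs
        · exact ConcreteCategory.congr_hom (h.naturality α) x.1
        · exact ConcreteCategory.congr_hom (h'.naturality α) x.1 }
  refine ⟨m, fun l h2 => ⟨?_, ?_⟩, fun {A K'} i q G h0 h1 => ?_⟩
  · ext n x
    have hm : SSet.stdSimplex.const 1 0 n ∈ (∂Δ[1] : (Δ[1] : SSet.{u}).Subcomplex).obj n := by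
      intro hs
      obtain ⟨i, hi⟩ := hs 1
      exact absurd hi (by
        change (0 : Fin 2) ≠ 1
        decide)
    have := ConcreteCategory.congr_hom (NatTrans.congr_app h2 n)
      (show (B ⊗ (∂Δ[1] : (Δ[1] : SSet.{u}).Subcomplex).toSSet).obj n from ⟨x, ⟨_, hm⟩⟩)
    refine this.trans ?_
    change (if (0 : Fin 2) = 0 then h.app n x else h'.app n x) = h.app n x
    exact if_pos rfl
  · ext n x
    have hm : SSet.stdSimplex.const 1 1 n ∈ (∂Δ[1] : (Δ[1] : SSet.{u}).Subcomplex).obj n := by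
      intro hs
      obtain ⟨i, hi⟩ := hs 0
      exact absurd hi (by
        change (1 : Fin 2) ≠ 0
        decide)
    have := ConcreteCategory.congr_hom (NatTrans.congr_app h2 n)
      (show (B ⊗ (∂Δ[1] : (Δ[1] : SSet.{u}).Subcomplex).toSSet).obj n from ⟨x, ⟨_, hm⟩⟩)
    refine this.trans ?_
    change (if (1 : Fin 2) = 0 then h.app n x else h'.app n x) = h'.app n x
    exact if_neg (by decide)
  · ext n x
    change q.app n (if SSet.stdSimplex.asOrderHom x.2.1 0 = 0 then h.app n (i.app n x.1)
        else h'.app n (i.app n x.1)) = G.app n (x.1, x.2.1)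
    split_ifs with hx
    · have e : x.2.1 = SSet.stdSimplex.const 1 0 n := by
        refine SSet.stdSimplex.ext _ _ fun j => (key n _ x.2.2 j 0).trans hx
      rw [e]
      exact (ConcreteCategory.congr_hom (NatTrans.congr_app h0 n) x.1).symm
    · have e : x.2.1 = SSet.stdSimplex.const 1 1 n := by
        refine SSet.stdSimplex.ext _ _ fun j => (key n _ x.2.2 j 0).trans ?_
        change _ = (1 : Fin 2)
        exact Fin.eq_one_of_ne_zero _ hx
      rw [e]
      exact (ConcreteCategory.congr_hom (NatTrans.congr_app h1 n) x.1).symm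

/-- Extension relative to `∅ ⟶ Δ[0]` gives surjectivity on homotopy classes, and relative to `∂Δ[1]
⟶ Δ[1]` it gives injectivity. -/
theorem acyclic.isWeakEquiv {i : A ⟶ B} (hi : acyclic i) : IsWeakEquiv i := by
  refine IsWeakEquiv.mk' (fun K _ a => ?_) (fun K _ h h' H => ?_)
  · obtain ⟨l, -, h2⟩ := hi.exists_extension ((⊥ : (Δ[0] : SSet.{u}).Subcomplex).ι)
      (K := K) (by
        refine { app := fun p => ↾fun x => (x.2.2 : False).elim, naturality := ?_ }
        intro p q α
        ext ⟨_, _, hx⟩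
        exact (hx : False).elim) (fst _ _ ⨟ a) (by
        ext p ⟨_, _, hx⟩
        exact (hx : False).elim)
    refine ⟨lift (𝟙 B) (SSet.const (SSet.stdSimplex.obj₀Equiv.{u}.symm (0 : Fin 1))) ⨟ l, ?_⟩
    have e : i ⨟ lift (𝟙 B) (SSet.const (SSet.stdSimplex.obj₀Equiv.{u}.symm (0 : Fin 1))) =
      lift (𝟙 A) (SSet.const (SSet.stdSimplex.obj₀Equiv.{u}.symm (0 : Fin 1))) ⨟ i ▷ Δ[0] := rfl
    rw [reassoc_of% e, h2]
    exact HRel.refl _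
  · obtain ⟨G, h0, h1⟩ := hRel_iff.1 H
    obtain ⟨m, hm, hm'⟩ := exists_map_tensor_boundary h h'
    obtain ⟨l, h2, -⟩ := hi.exists_extension (∂Δ[1] : (Δ[1] : SSet.{u}).Subcomplex).ι m G
      (hm' i (𝟙 _) G h0 h1)
    exact hRel_iff.2 ⟨l, (hm l h2).1, (hm l h2).2⟩

/-- Maps with the right lifting property against all monomorphisms are weak equivalences. -/
theorem isWeakEquiv_of_rlp {E D : SSet.{u}} {p : E ⟶ D}
    (hp : ∀ {A B : SSet.{u}} (i : A ⟶ B) [Mono i], HasLiftingProperty i p) : IsWeakEquiv p := by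
  have := hp (⊥ : D.Subcomplex).ι
  have sq : CommSq ({ app := fun p => ↾fun x => (x.2 : False).elim,
                      naturality := fun _ _ _ => by
                        ext ⟨_, hx⟩
                        exact (hx : False).elim } : (⊥ : D.Subcomplex).toSSet ⟶ E)
      (⊥ : D.Subcomplex).ι p (𝟙 D) := ⟨by
        ext _ ⟨_, hx⟩
        exact (hx : False).elim⟩
  have hs : sq.lift ⨟ p = 𝟙 D := sq.fac_right
  -- Lifting against `∅ ⟶ D` gave a section. Lifting the constant homotopy of `p`, with the two ends
  -- prescribed, now joins `p ⨟ sq.lift` to the identity over `D`.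
  obtain ⟨m, hm, hm'⟩ := exists_map_tensor_boundary (p ⨟ sq.lift) (𝟙 E)
  have := hp (E ◁ (∂Δ[1] : (Δ[1] : SSet.{u}).Subcomplex).ι)
  have sq' : CommSq m (E ◁ (∂Δ[1] : (Δ[1] : SSet.{u}).Subcomplex).ι) p (fst _ _ ⨟ p) := ⟨by
    refine hm' (𝟙 _) p _ ?_ ?_
    · rw [Category.id_comp, Category.assoc, hs, Category.comp_id]
      rfl
    · rfl⟩
  have H : HRel (p ⨟ sq.lift) (𝟙 E) :=
    hRel_iff.2 ⟨sq'.lift, (hm _ sq'.fac_left).1, (hm _ sq'.fac_left).2⟩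
  exact .of_homotopyEquiv (g := sq.lift) ((IsWeakEquiv.id E).congr' H)
    (by
      rw [hs]
      exact IsWeakEquiv.id D)

end Acyclic

/-! ### Monomorphisms that are weak equivalences are acyclic. -/

section

variable {A B K S T E D : SSet.{u}}

/-- Lift the homotopy from `s ⨟ p` to the identity, starting at `s`; the end of the lift is a strict
section. -/
theorem exists_section_of_hRel {p : E ⟶ D} [Fibration p] {s : D ⟶ E} (h : HRel (s ⨟ p) (𝟙 D)) :
    ∃ s' : D ⟶ E, s' ⨟ p = 𝟙 D := by
  obtain ⟨b, h0, h1⟩ := hRel_iff.1 h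
  obtain ⟨G, -, -, hG⟩ := exists_homotopy_lift (⊥ : D.Subcomplex).ι p s
    ({ app := fun p => ↾fun x => (x.1.2 : False).elim
       naturality := fun _ _ _ => by
          ext ⟨⟨_, hx⟩, _⟩
          exact (hx : False).elim } : (⊥ : D.Subcomplex).toSSet ⊗ Δ[1] ⟶ E) b (by
        ext _ ⟨_, hx⟩
        exact (hx : False).elim) h0.symm (by
        ext _ ⟨⟨_, hx⟩, _⟩
        exact (hx : False).elim)
  exact ⟨SSet.ι₁ ⨟ G, by rw [Category.assoc, hG, h1]⟩

/-- A Kan fibration between Kan complexes that is a homotopy equivalence has the right lifting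
property against all monomorphisms. -/
theorem hasLiftingProperty_of_homotopyEquiv {p : E ⟶ D} [Fibration p] [SSet.KanComplex E]
    {s : D ⟶ E} (hs : s ⨟ p = 𝟙 D) (h : HRel (p ⨟ s) (𝟙 E)) (j : S ⟶ T) [Mono j] :
    HasLiftingProperty j p := by
  obtain ⟨H, h0, h1⟩ := hRel_iff.1 h
  -- `H ⨟ p ⨟ s` and `H` have the same start and the same image in `D`. Comparing them replaces the
  -- homotopy from `p ⨟ s` to the identity by one that is constant over `D`.
  obtain ⟨G, g0, g1, gp⟩ := exists_fibrewise_homotopy p (H ⨟ p ⨟ s) H (by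
    rw [reassoc_of% h0, h0, reassoc_of% hs]) (by rw [Category.assoc, Category.assoc, hs,
      Category.comp_id])
  rw [reassoc_of% h1] at g0
  have gp' : G ⨟ p = fst _ _ ⨟ p := by
    rw [gp, Category.assoc, Category.assoc, hs, Category.comp_id, reassoc_of% h1]
  refine ⟨fun {t b} w => ⟨?_⟩⟩
  -- The map `b ⨟ s` lifts `b` but restricts to `t ⨟ p ⨟ s` on `S` instead of `t`. Extending the
  -- fibrewise homotopy `G` from `S` to `T` over `D` corrects this at its end.
  obtain ⟨L, -, l1, l2⟩ := exists_homotopy_lift j p (b ⨟ s) (t ▷ Δ[1] ⨟ G) (fst _ _ ⨟ b) (by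
      have : SSet.ι₀ ⨟ (t ▷ Δ[1]) ⨟ G = t ⨟ SSet.ι₀ ⨟ G := rfl
      rw [this, g0, reassoc_of% w.w])
    (by rw [Category.assoc, hs, Category.comp_id]; rfl)
    (by
      rw [Category.assoc, gp']
      exact congrArg (fst _ _ ⨟ ·) w.w)
  refine ⟨⟨SSet.ι₁ ⨟ L, ?_, ?_⟩⟩
  · have e : j ⨟ SSet.ι₁ ⨟ L = SSet.ι₁ ⨟ j ▷ Δ[1] ⨟ L := rfl
    have e' : SSet.ι₁ ⨟ t ▷ Δ[1] ⨟ G = t ⨟ SSet.ι₁ ⨟ G := rfl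
    rw [e, l1, e', g1, h1, Category.comp_id]
  · rw [Category.assoc, l2]
    rfl

/-- The restriction map between the exponentials of `K` by `B` and by `A` is a Kan fibration,
because `i` is a monomorphism, and a homotopy equivalence, because `i` is a weak equivalence. So it
has the right lifting property against every monomorphism `j`. By adjunction and the braiding, this
lifting property is symmetric in `i` and `j`. -/
theorem IsWeakEquiv.acyclic {i : A ⟶ B} [Mono i] (hi : IsWeakEquiv i) : acyclic i := by
  refine acyclic_of_exists fun K _ S T j _ f g hfg => ?_
  let p := (MonoidalClosed.pre i).app K
  have : Fibration p := inferInstance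
  obtain ⟨h, hh⟩ := (hi.whiskerRight ((ihom A).obj K)).exists_extension K
    (MonoidalClosed.uncurry (𝟙 ((ihom A).obj K)))
  have hs₀ : HRel (MonoidalClosed.curry h ⨟ p) (𝟙 _) := by
    have e : MonoidalClosed.curry h ⨟ p =
        MonoidalClosed.curry (i ▷ ((ihom A).obj K) ⨟ h) := by
      rw [MonoidalClosed.curry_pre_app]
    rw [e]
    simpa using hRel_curry hh
  obtain ⟨s, hs⟩ := exists_section_of_hRel hs₀
  have hp : HRel (p ⨟ s) (𝟙 ((ihom B).obj K)) := by
    rw [← MonoidalClosed.curry_uncurry (p ⨟ s), ← MonoidalClosed.curry_uncurry (𝟙 _),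
      hRel_curry_iff]
    refine (hi.whiskerRight _).hRel_of_comp ?_
    have e : ∀ a : (ihom B).obj K ⟶ (ihom B).obj K,
        i ▷ _ ⨟ MonoidalClosed.uncurry a = MonoidalClosed.uncurry (a ⨟ p) := fun a => by
      rw [← MonoidalClosed.curry_injective.eq_iff, MonoidalClosed.curry_uncurry,
        ← MonoidalClosed.curry_pre_app, MonoidalClosed.curry_uncurry]
    rw [e, e, Category.assoc, hs, Category.comp_id, Category.id_comp]
    exact HRel.refl _
  have hlp := hasLiftingProperty_of_homotopyEquiv hs hp j
  rw [hasLiftingProperty_pre_iff] at hlp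
  obtain ⟨l, l1, l2, -⟩ := exists_lift_pushoutProduct hlp ((β_ _ _).hom ⨟ g) ((β_ _ _).hom ⨟ f)
    (terminal.from _) (congrArg ((β_ S A).hom ⨟ ·) hfg.symm) (Subsingleton.elim _ _)
    (Subsingleton.elim _ _)
  refine ⟨(β_ _ _).hom ⨟ l, ?_, ?_⟩
  · exact congrArg ((β_ B S).hom ⨟ ·) l2
  · exact congrArg ((β_ A T).hom ⨟ ·) l1

theorem acyclic_iff {i : A ⟶ B} [Mono i] : acyclic i ↔ IsWeakEquiv i :=
  ⟨fun h => h.isWeakEquiv, fun h => h.acyclic⟩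

end

/-! ## Simplices of simplicial sets -/

section Simplices

variable {X Y Z : SSet.{u}} {p q : SimplexCategoryᵒᵖ}

/-- A simplex of a product. -/
abbrev pairMk (x : X.obj p) (y : Y.obj p) : (X ⊗ Y).obj p := ⟨x, y⟩

theorem app_congr {f g : X ⟶ Y} (h : f = g) (x : X.obj p) : f.app p x = g.app p x := h ▸ rfl

theorem app_map (f : X ⟶ Y) (θ : p ⟶ q) (x : X.obj p) :
    f.app q (X.map θ x) = Y.map θ (f.app p x) :=
  ConcreteCategory.congr_hom (f.naturality θ) x

end Simplices

/-! ## Mapping cylinders -/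

section Cylinder

open scoped Classical in
/-- The image of a simplex of `Δ[1] ⊗ A` in the mapping cylinder of `f : A ⟶ B`. -/
def cylMk {A B : SSet.{u}} (f : A ⟶ B) {p : SimplexCategoryᵒᵖ} (α : (Δ[1] : SSet.{u}).obj p)
    (a : A.obj p) :
    B.obj p ⊕ {α : (Δ[1] : SSet.{u}).obj p // α ≠ SSet.stdSimplex.const 1 0 p} × A.obj p :=
  if h : α = SSet.stdSimplex.const 1 0 p then .inl (f.app p a) else .inr (⟨α, h⟩, a)

variable {A B X : SSet.{u}} (f : A ⟶ B)

/-- The simplicial operators of the mapping cylinder. -/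
def cylMap {p q : SimplexCategoryᵒᵖ} (θ : p ⟶ q)
    (x : B.obj p ⊕ {α : (Δ[1] : SSet.{u}).obj p // α ≠ SSet.stdSimplex.const 1 0 p} × A.obj p) :
    B.obj q ⊕ {α : (Δ[1] : SSet.{u}).obj q // α ≠ SSet.stdSimplex.const 1 0 q} × A.obj q :=
  x.elim (fun b => .inl (B.map θ b))
    (fun x => cylMk f ((Δ[1] : SSet.{u}).map θ x.1.1) (A.map θ x.2))

theorem cylMk_zero {p : SimplexCategoryᵒᵖ} (a : A.obj p) :
    cylMk f (SSet.stdSimplex.const 1 0 p) a = .inl (f.app p a) := dif_pos rfl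

theorem cylMk_of_ne {p : SimplexCategoryᵒᵖ} {α : (Δ[1] : SSet.{u}).obj p}
    (h : α ≠ SSet.stdSimplex.const 1 0 p) (a : A.obj p) :
    cylMk f α a = .inr (⟨α, h⟩, a) := dif_neg h

theorem const_one_ne (p : SimplexCategoryᵒᵖ) :
    (SSet.stdSimplex.const 1 1 p : (Δ[1] : SSet.{u}).obj p) ≠ SSet.stdSimplex.const 1 0 p := by
  intro h
  have := congrArg (fun α => SSet.stdSimplex.asOrderHom α 0) h
  exact absurd this (by
    change (1 : Fin 2) ≠ 0
    decide)

theorem cylMap_cylMk {p q : SimplexCategoryᵒᵖ} (θ : p ⟶ q) (α : (Δ[1] : SSet.{u}).obj p)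
    (a : A.obj p) :
    cylMap f θ (cylMk f α a) = cylMk f ((Δ[1] : SSet.{u}).map θ α) (A.map θ a) := by
  by_cases h : α = SSet.stdSimplex.const 1 0 p
  · subst h
    have e : (Δ[1] : SSet.{u}).map θ (SSet.stdSimplex.const 1 0 p) =
      SSet.stdSimplex.const 1 0 q := rfl
    rw [e, cylMk_zero, cylMk_zero]
    exact congrArg Sum.inl (ConcreteCategory.congr_hom (f.naturality θ) a).symm
  · rw [cylMk_of_ne f h]
    rfl

/-- The mapping cylinder of `f : A ⟶ B`. -/
def cyl : SSet.{u} where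
  obj p := B.obj p ⊕ {α : (Δ[1] : SSet.{u}).obj p // α ≠ SSet.stdSimplex.const 1 0 p} × A.obj p
  map θ := ↾(cylMap f θ)
  map_id p := ConcreteCategory.hom_ext _ _ fun x => by
    rcases x with b | ⟨⟨α, h⟩, a⟩
    · exact congrArg Sum.inl (ConcreteCategory.congr_hom (B.map_id p) b)
    · change cylMk f ((Δ[1] : SSet.{u}).map (𝟙 p) α) (A.map (𝟙 p) a) = _
      rw [ConcreteCategory.congr_hom ((Δ[1] : SSet.{u}).map_id p) α,
        ConcreteCategory.congr_hom (A.map_id p) a]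
      exact cylMk_of_ne f h a
  map_comp θ η := ConcreteCategory.hom_ext _ _ fun x => by
    rcases x with b | ⟨⟨α, h⟩, a⟩
    · exact congrArg Sum.inl (ConcreteCategory.congr_hom (B.map_comp θ η) b)
    · change cylMk f ((Δ[1] : SSet.{u}).map (θ ⨟ η) α) (A.map (θ ⨟ η) a) =
        cylMap f η (cylMk f _ _)
      rw [cylMap_cylMk, ConcreteCategory.congr_hom ((Δ[1] : SSet.{u}).map_comp θ η) α,
        ConcreteCategory.congr_hom (A.map_comp θ η) a]
      rfl

/-- The map from the cylinder to the mapping cylinder. -/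
def cylProd : Δ[1] ⊗ A ⟶ cyl f where
  app _ := ↾fun x => cylMk f x.1 x.2
  naturality _ _ θ := ConcreteCategory.hom_ext _ _ fun x => (cylMap_cylMk f θ x.1 x.2).symm

/-- The inclusion of the target into the mapping cylinder. -/
def cylBot : B ⟶ cyl f where
  app p := ↾Sum.inl

theorem cyl_cases {p : SimplexCategoryᵒᵖ} {P : (cyl f).obj p → Prop}
    (h₁ : ∀ b, P ((cylBot f).app p b)) (h₂ : ∀ α a, α ≠ SSet.stdSimplex.const 1 0 p →
      P ((cylProd f).app p (pairMk α a))) (x : (cyl f).obj p) : P x := by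
  rcases x with b | ⟨⟨α, h⟩, a⟩
  · exact h₁ b
  · have := h₂ α a h
    change P (cylMk f α a) at this
    rwa [cylMk_of_ne f h] at this

/-- The vertex `a` of the interval. -/
abbrev end₁ (a : Fin 2) (A : SSet.{u}) : A ⟶ Δ[1] ⊗ A :=
  lift (SSet.const (SSet.stdSimplex.obj₀Equiv.{u}.symm a)) (𝟙 A)

/-- The inclusion of the source into the mapping cylinder. -/
def cylTop : A ⟶ cyl f := end₁ 1 A ⨟ cylProd f

theorem end_cylProd : end₁ 0 A ⨟ cylProd f = f ⨟ cylBot f := by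
  ext p a
  exact cylMk_zero f a

variable {f} in
/-- The universal property of the mapping cylinder. -/
theorem exists_cylDesc (b : B ⟶ X) (H : Δ[1] ⊗ A ⟶ X) (h : end₁ 0 A ⨟ H = f ⨟ b) :
    ∃ d : cyl f ⟶ X, cylBot f ⨟ d = b ∧ cylProd f ⨟ d = H := by
  let d₀ : ∀ p, (cyl f).obj p → X.obj p := fun p x =>
    match x with
    | .inl y => b.app p y
    | .inr y => H.app p (y.1.1, y.2)
  have hd₀ : ∀ p α a, d₀ p (cylMk f α a) = H.app p (α, a) := by
    intro p α a
    by_cases h' : α = SSet.stdSimplex.const 1 0 p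
    · subst h'
      rw [cylMk_zero]
      exact (ConcreteCategory.congr_hom (NatTrans.congr_app h p) a).symm
    · rw [cylMk_of_ne f h']
  refine ⟨{ app p := ↾(d₀ p), naturality := ?_ }, rfl, ?_⟩
  · intro p q θ
    ext x
    rcases x with y | ⟨⟨α, h⟩, a⟩
    · exact ConcreteCategory.congr_hom (b.naturality θ) y
    · refine (hd₀ q _ _).trans ?_
      exact app_map H θ (pairMk α a)
  · ext p ⟨α, a⟩
    exact hd₀ p α a

variable {f} in
theorem cyl_hom_ext {g h : cyl f ⟶ X} (h₁ : cylBot f ⨟ g = cylBot f ⨟ h)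
    (h₂ : cylProd f ⨟ g = cylProd f ⨟ h) : g = h := by
  ext p x
  exact cyl_cases f (P := fun x => g.app p x = h.app p x) (fun b => app_congr h₁ b)
    (fun α a _ => app_congr h₂ (pairMk α a)) x

/-- The part of the mapping cylinder of `f : A ⟶ B` lying over subcomplexes `A'` of `A` and
`B'` of `B`. -/
def cylSub (A' : A.Subcomplex) (B' : B.Subcomplex) :
    (cyl f).Subcomplex where
  obj p := {x | (∃ b ∈ B'.obj p, x = (cylBot f).app p b) ∨
    ∃ α, ∃ a ∈ A'.obj p, x = (cylProd f).app p (pairMk α a)}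
  map {p q} θ := by
    rintro x (⟨b, hb, rfl⟩ | ⟨α, a, ha, rfl⟩)
    · exact Or.inl ⟨_, B'.map θ hb, (app_map (cylBot f) θ b).symm⟩
    · exact Or.inr ⟨_, _, A'.map θ ha,
        (app_map (cylProd f) θ (pairMk α a)).symm⟩

/-- The part of the source of the mapping cylinder lying over a subcomplex. -/
def cylTopSub (A' : A.Subcomplex) : (cyl f).Subcomplex := A'.image (cylTop f)

section

variable {f} {A' A'' : A.Subcomplex} {B' B'' : B.Subcomplex} {p : SimplexCategoryᵒᵖ}

theorem cylProd_zero (a : A.obj p) :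
    (cylProd f).app p (pairMk (SSet.stdSimplex.const 1 0 p) a) = (cylBot f).app p (f.app p a) :=
  cylMk_zero f a

theorem cylProd_eq_iff {α β : (Δ[1] : SSet.{u}).obj p} {a b : A.obj p}
    (h : α ≠ SSet.stdSimplex.const 1 0 p) :
    (cylProd f).app p (pairMk α a) = (cylProd f).app p (pairMk β b) ↔ α = β ∧ a = b := by
  refine ⟨fun e => ?_, by rintro ⟨rfl, rfl⟩; rfl⟩
  change cylMk f α a = cylMk f β b at e
  rw [cylMk_of_ne f h] at e
  by_cases h' : β = SSet.stdSimplex.const 1 0 p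
  · subst h'
    rw [cylMk_zero] at e
    cases e
  · rw [cylMk_of_ne f h'] at e
    simpa using e

theorem cylBot_ne_cylProd {α : (Δ[1] : SSet.{u}).obj p} {a : A.obj p} {b : B.obj p}
    (h : α ≠ SSet.stdSimplex.const 1 0 p) :
    (cylProd f).app p (pairMk α a) ≠ (cylBot f).app p b := by
  intro e
  change cylMk f α a = Sum.inl b at e
  rw [cylMk_of_ne f h] at e
  cases e

theorem cylBot_injective : Function.Injective ((cylBot f).app p) := Sum.inl_injective

theorem cylBot_mem_cylSub (h : A' ≤ B'.preimage f) {b : B.obj p} :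
    (cylBot f).app p b ∈ (cylSub f A' B').obj p ↔ b ∈ B'.obj p := by
  refine ⟨?_, fun hb => Or.inl ⟨b, hb, rfl⟩⟩
  rintro (⟨b', hb', e⟩ | ⟨α, a, ha, e⟩)
  · rwa [cylBot_injective e]
  · by_cases hα : α = SSet.stdSimplex.const 1 0 p
    · subst hα
      rw [cylProd_zero] at e
      rw [cylBot_injective e]
      exact h _ ha
    · exact (cylBot_ne_cylProd hα e.symm).elim

theorem cylProd_mem_cylSub {α : (Δ[1] : SSet.{u}).obj p} {a : A.obj p}
    (hα : α ≠ SSet.stdSimplex.const 1 0 p) :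
    (cylProd f).app p (pairMk α a) ∈ (cylSub f A' B').obj p ↔ a ∈ A'.obj p := by
  refine ⟨?_, fun ha => Or.inr ⟨α, a, ha, rfl⟩⟩
  rintro (⟨b', hb', e⟩ | ⟨β, a', ha, e⟩)
  · exact (cylBot_ne_cylProd hα e).elim
  · rwa [((cylProd_eq_iff hα).1 e).2]

theorem cylBot_notMem_cylTopSub {b : B.obj p} :
    (cylBot f).app p b ∉ (cylTopSub f A').obj p := by
  rintro ⟨a, -, e⟩
  exact cylBot_ne_cylProd (const_one_ne p) e

theorem cylProd_mem_cylTopSub {α : (Δ[1] : SSet.{u}).obj p} {a : A.obj p}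
    (hα : α ≠ SSet.stdSimplex.const 1 0 p) :
    (cylProd f).app p (pairMk α a) ∈ (cylTopSub f A').obj p ↔
      α = SSet.stdSimplex.const 1 1 p ∧ a ∈ A'.obj p := by
  constructor
  · rintro ⟨a', ha', e⟩
    obtain ⟨rfl, rfl⟩ := (cylProd_eq_iff hα).1 e.symm
    exact ⟨rfl, ha'⟩
  · rintro ⟨rfl, ha⟩
    exact ⟨a, ha, rfl⟩

theorem cyl_subcomplex_le {U V : (cyl f).Subcomplex}
    (h₁ : ∀ p b, (cylBot f).app p b ∈ U.obj p → (cylBot f).app p b ∈ V.obj p)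
    (h₂ : ∀ p α a, α ≠ SSet.stdSimplex.const 1 0 p →
      (cylProd f).app p (pairMk α a) ∈ U.obj p → (cylProd f).app p (pairMk α a) ∈ V.obj p) :
    U ≤ V := fun p x =>
  cyl_cases f (P := fun x => x ∈ U.obj p → x ∈ V.obj p) (h₁ p) (h₂ p) x

theorem cylTopSub_le_cylSub (h : A' ≤ A'') : cylTopSub f A' ≤ cylSub f A'' B' := by
  rintro p _ ⟨a, ha, rfl⟩
  exact Or.inr ⟨_, a, h _ ha, rfl⟩

theorem cylTopSub_mono (h : A' ≤ A'') : cylTopSub f A' ≤ cylTopSub f A'' := by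
  rintro p _ ⟨a, ha, rfl⟩
  exact ⟨a, h _ ha, rfl⟩

theorem cylSub_mono (h : A' ≤ A'') (h' : B' ≤ B'') : cylSub f A' B' ≤ cylSub f A'' B'' := by
  rintro p _ (⟨b, hb, rfl⟩ | ⟨α, a, ha, rfl⟩)
  · exact Or.inl ⟨b, h' _ hb, rfl⟩
  · exact Or.inr ⟨_, a, h _ ha, rfl⟩

theorem cylSub_top : cylSub f ⊤ ⊤ = ⊤ := by
  refine top_le_iff.1 (cyl_subcomplex_le (fun p b _ => ?_) (fun p α a _ _ => ?_))
  · exact Or.inl ⟨b, trivial, rfl⟩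
  · exact Or.inr ⟨_, a, trivial, rfl⟩

theorem cylTopSub_inf_cylSub_le : cylTopSub f A'' ⊓ cylSub f A' B' ≤ cylTopSub f A' := by
  refine cyl_subcomplex_le (fun p b h => ?_) (fun p α a hα h => ?_)
  · exact (cylBot_notMem_cylTopSub h.1).elim
  · exact (cylProd_mem_cylTopSub hα).2
      ⟨((cylProd_mem_cylTopSub hα).1 h.1).1, (cylProd_mem_cylSub hα).1 h.2⟩

theorem cylSub_inf_cylSub_le (h' : A' ≤ B'.preimage f) (h'' : A'' ≤ B''.preimage f) :
    cylSub f A' B' ⊓ cylSub f A'' B'' ≤ cylSub f (A' ⊓ A'') (B' ⊓ B'') := by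
  refine cyl_subcomplex_le (fun p b h => ?_) (fun p α a hα h => ?_)
  · exact Or.inl ⟨b, ⟨(cylBot_mem_cylSub h').1 h.1, (cylBot_mem_cylSub h'').1 h.2⟩, rfl⟩
  · exact Or.inr ⟨α, a, ⟨(cylProd_mem_cylSub hα).1 h.1, (cylProd_mem_cylSub hα).1 h.2⟩, rfl⟩

instance : Mono (cylTop f) := by
  rw [NatTrans.mono_iff_mono_app]
  intro p
  rw [mono_iff_injective]
  intro a b e
  exact ((cylProd_eq_iff (const_one_ne p)).1 e).2

/-- The minimum of two simplices of the interval. -/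
def intervalMin : Δ[1] ⊗ Δ[1] ⟶ (Δ[1] : SSet.{u}) where
  app p := ↾fun x => SSet.stdSimplex.objEquiv.symm
    (SimplexCategory.Hom.mk (SSet.stdSimplex.asOrderHom x.1 ⊓ SSet.stdSimplex.asOrderHom x.2))

theorem intervalMin_zero_right (α : (Δ[1] : SSet.{u}).obj p) :
    intervalMin.app p (pairMk α (SSet.stdSimplex.const 1 0 p)) = SSet.stdSimplex.const 1 0 p := by
  refine SSet.stdSimplex.ext _ _ fun i => ?_
  change min (SSet.stdSimplex.asOrderHom α i) (0 : Fin 2) = 0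
  exact min_eq_right (Fin.zero_le _)

theorem intervalMin_zero_left (α : (Δ[1] : SSet.{u}).obj p) :
    intervalMin.app p (pairMk (SSet.stdSimplex.const 1 0 p) α) = SSet.stdSimplex.const 1 0 p := by
  refine SSet.stdSimplex.ext _ _ fun i => ?_
  change min (0 : Fin 2) (SSet.stdSimplex.asOrderHom α i) = 0
  exact min_eq_left (Fin.zero_le _)

theorem intervalMin_one_right (α : (Δ[1] : SSet.{u}).obj p) :
    intervalMin.app p (pairMk α (SSet.stdSimplex.const 1 1 p)) = α := by
  refine SSet.stdSimplex.ext _ _ fun i => ?_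
  change min (SSet.stdSimplex.asOrderHom α i) (1 : Fin 2) = SSet.stdSimplex.asOrderHom α i
  exact min_eq_left (Fin.le_last _)

end

end Cylinder

/-! ### Acyclic inclusions between parts of a mapping cylinder. -/

section CylinderEquivalences

variable {A B X : SSet.{u}} {f : A ⟶ B} {A' A'' : A.Subcomplex} {B' B'' : B.Subcomplex}
  {p : SimplexCategoryᵒᵖ}

variable (f) in
/-- The deformation retraction of the mapping cylinder onto its target. -/
theorem exists_cylDeformation : ∃ H : cyl f ⊗ Δ[1] ⟶ cyl f,
    (∀ p b β, H.app p (pairMk ((cylBot f).app p b) β) = (cylBot f).app p b) ∧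
    ∀ p α a β, H.app p (pairMk ((cylProd f).app p (pairMk α a)) β) =
      (cylProd f).app p (pairMk (intervalMin.app p (pairMk α β)) a) := by
  let h : ∀ p, (cyl f).obj p → (Δ[1] : SSet.{u}).obj p → (cyl f).obj p := fun p x β =>
    Sum.elim Sum.inl (fun y => cylMk f (intervalMin.app p (pairMk y.1.1 β)) y.2) x
  have h₂ : ∀ p α a β, h p (cylMk f α a) β = cylMk f (intervalMin.app p (pairMk α β)) a := by
    intro p α a β
    by_cases hα : α = SSet.stdSimplex.const 1 0 p
    · subst hα
      rw [intervalMin_zero_left, cylMk_zero]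
      rfl
    · rw [cylMk_of_ne f hα]
      rfl
  refine ⟨{ app p := ↾fun x => h p x.1 x.2, naturality p q θ := ?_ }, fun _ _ _ => rfl, h₂⟩
  ext ⟨x, β⟩
  refine cyl_cases f (P := fun x => h q ((cyl f).map θ x) (Δ[1].map θ β) =
    (cyl f).map θ (h p x β)) (fun b => rfl) (fun α a _ => ?_) x
  rw [← app_map]
  refine (h₂ q _ _ _).trans ?_
  exact (app_map (cylProd f) θ (pairMk (intervalMin.app p (pairMk α β)) a)).trans
    (congrArg _ (h₂ p _ _ _).symm)

/-- The restriction of `f : A ⟶ B` to subcomplexes. -/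
abbrev restrict (f : A ⟶ B) (h : A' ≤ B'.preimage f) : A'.toSSet ⟶ B'.toSSet :=
  SSet.Subcomplex.lift (A'.ι ⨟ f) (by
    rintro p _ ⟨a, rfl⟩
    exact h _ a.2)

/-- The deformation by minima preserves the part of the cylinder over `A'` and `B'` and retracts it
onto `B'`. Following the top copy of `A'` by this retraction is the restriction of `f`, so
two-out-of-three applies. -/
theorem isWeakEquiv_cylTopSub (h : A' ≤ B'.preimage f) (hf : IsWeakEquiv (restrict f h)) :
    IsWeakEquiv (SSet.Subcomplex.homOfLE
      (cylTopSub_le_cylSub (f := f) (B' := B') (le_refl A'))) := by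
  obtain ⟨d, hd₁, hd₂⟩ := exists_cylDesc (f := f) (𝟙 B) (snd _ _ ⨟ f) rfl
  have hd₁' : ∀ p b, d.app p ((cylBot f).app p b) = b := fun p b => app_congr hd₁ b
  have hd₂' : ∀ p α a, d.app p ((cylProd f).app p (pairMk α a)) = f.app p a :=
    fun p α a => app_congr hd₂ (pairMk α a)
  let v : (cylSub f A' B').toSSet ⟶ B'.toSSet :=
    SSet.Subcomplex.lift ((cylSub f A' B').ι ⨟ d) (by
      rintro p _ ⟨⟨_, ⟨b, hb, rfl⟩ | ⟨α, a, ha, rfl⟩⟩, rfl⟩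
      · change d.app p ((cylBot f).app p b) ∈ B'.obj p
        rwa [hd₁']
      · change d.app p ((cylProd f).app p (pairMk α a)) ∈ B'.obj p
        rw [hd₂']
        exact h _ ha)
  let s : B'.toSSet ⟶ (cylSub f A' B').toSSet :=
    SSet.Subcomplex.lift (B'.ι ⨟ cylBot f) (by
      rintro p _ ⟨b, rfl⟩
      exact Or.inl ⟨b.1, b.2, rfl⟩)
  obtain ⟨H, hH₁, hH₂⟩ := exists_cylDeformation f
  let H' : (cylSub f A' B').toSSet ⊗ Δ[1] ⟶ (cylSub f A' B').toSSet :=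
    SSet.Subcomplex.lift ((cylSub f A' B').ι ▷ _ ⨟ H) (by
      rintro p _ ⟨⟨⟨_, ⟨b, hb, rfl⟩ | ⟨α, a, ha, rfl⟩⟩, β⟩, rfl⟩
      · exact Or.inl ⟨b, hb, hH₁ _ _ _⟩
      · exact Or.inr ⟨_, a, ha, hH₂ _ _ _ _⟩)
  have hs : s ⨟ v = 𝟙 _ := by
    ext p b
    exact Subtype.ext (hd₁' p b.1)
  have hv : HRel (v ⨟ s) (𝟙 _) := by
    refine hRel_iff.2 ⟨H', ?_, ?_⟩
    · ext p ⟨_, ⟨b, hb, rfl⟩ | ⟨α, a, ha, rfl⟩⟩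
      · refine Subtype.ext ((hH₁ _ _ _).trans ?_)
        exact congrArg ((cylBot f).app p) (hd₁' p b).symm
      · refine Subtype.ext ((hH₂ _ _ _ _).trans ?_)
        refine Eq.trans ?_ (congrArg ((cylBot f).app p) (hd₂' p α a).symm)
        refine Eq.trans ?_ (cylProd_zero a)
        exact congrArg (fun γ => (cylProd f).app p (pairMk γ a)) (intervalMin_zero_right α)
    · ext p ⟨_, ⟨b, hb, rfl⟩ | ⟨α, a, ha, rfl⟩⟩
      · exact Subtype.ext (hH₁ _ _ _)
      · refine Subtype.ext ((hH₂ _ _ _ _).trans ?_)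
        exact congrArg (fun γ => (cylProd f).app p (pairMk γ a)) (intervalMin_one_right α)
  have hv' : IsWeakEquiv v := .of_homotopyEquiv ((IsWeakEquiv.id _).congr' hv) (by
    rw [hs]
    exact .id _)
  let t : A'.toSSet ⟶ (cylTopSub f A').toSSet := A'.toImage (cylTop f)
  have : Mono t := by
    have : Mono (t ⨟ (cylTopSub f A').ι) := by
      change Mono (A'.ι ⨟ cylTop f)
      infer_instance
    exact mono_of_mono t (cylTopSub f A').ι
  have : Epi t := inferInstanceAs (Epi (A'.toImage (cylTop f)))
  have ht : IsIso t := isIso_of_mono_of_epi t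
  refine IsWeakEquiv.of_comp_left (.of_isIso t) (.of_comp_right hv' ?_)
  have e : t ⨟ SSet.Subcomplex.homOfLE (cylTopSub_le_cylSub (f := f) (B' := B') (le_refl A')) ⨟
      v = restrict f h := by
    ext p a
    exact Subtype.ext (hd₂' p _ _)
  rwa [Category.assoc, e]

theorem acyclic_homOfLE_of_bicartSq {U₁ U₂ U₃ U₄ : X.Subcomplex} (h₁₂ : U₁ ≤ U₂)
    (h₃₄ : U₃ ≤ U₄) (h₁ : U₂ ⊓ U₃ = U₁) (h₂ : U₂ ⊔ U₃ = U₄)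
    (h : acyclic (SSet.Subcomplex.homOfLE h₁₂)) : acyclic (SSet.Subcomplex.homOfLE h₃₄) := by
  have sq : SSet.Subcomplex.BicartSq U₁ U₂ U₃ U₄ := ⟨h₂, h₁⟩
  exact MorphismProperty.of_isPushout sq.isPushout.flip h

/-- Adjoining the part over `A'` and `B'` to the top copy of `A''` is a cobase change of the
inclusion of the top copy of `A'`, hence acyclic. The top copy of `A''` is equivalent to its whole
cylinder, and two-out-of-three gives the rest. -/
theorem acyclic_cylTopSub_sup (hA : A' ≤ A'') (hB : B' ≤ B'') (h' : A' ≤ B'.preimage f)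
    (h'' : A'' ≤ B''.preimage f) (hf' : IsWeakEquiv (restrict f h'))
    (hf'' : IsWeakEquiv (restrict f h'')) :
    acyclic (SSet.Subcomplex.homOfLE (sup_le (cylTopSub_le_cylSub (f := f) (B' := B'')
      (le_refl A'')) (cylSub_mono hA hB))) := by
  have h₁ := (isWeakEquiv_cylTopSub h' hf').acyclic
  have h₂ := acyclic_homOfLE_of_bicartSq (X := cyl f) (U₃ := cylTopSub f A'')
    (U₄ := cylTopSub f A'' ⊔ cylSub f A' B') (U₂ := cylSub f A' B')
    (cylTopSub_le_cylSub (le_refl A')) le_sup_left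
    (le_antisymm (by
      rw [inf_comm]
      exact cylTopSub_inf_cylSub_le)
      (le_inf (cylTopSub_le_cylSub (le_refl A')) (cylTopSub_mono hA)))
    (sup_comm _ _) h₁
  refine (IsWeakEquiv.of_comp_left h₂.isWeakEquiv ?_).acyclic
  exact isWeakEquiv_cylTopSub h'' hf''

/-- Enlarging the subcomplex of the target along which the source of the mapping cylinder has been
glued. -/
theorem acyclic_cylTopSub_sup_preimage {C D : B.Subcomplex}
    (h : IsWeakEquiv (restrict f (le_refl ((C ⊓ D).preimage f))))
    (h' : IsWeakEquiv (restrict f (le_refl (D.preimage f)))) :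
    acyclic (SSet.Subcomplex.homOfLE (show cylTopSub f ⊤ ⊔ cylSub f (C.preimage f) C ≤
      cylTopSub f ⊤ ⊔ cylSub f ((C ⊔ D).preimage f) (C ⊔ D) from
        sup_le_sup_left (cylSub_mono (SSet.Subcomplex.preimage_max C D f ▸ le_sup_left)
          le_sup_left) _)) := by
  have := acyclic_cylTopSub_sup (f := f)
    (show (C ⊓ D).preimage f ≤ D.preimage f from fun p x hx => hx.2)
    (inf_le_right : C ⊓ D ≤ D) le_rfl le_rfl h h'
  -- The enlargement from `C` to `C ⊔ D` is a cobase change of the relative cylinder over `D` modulo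
  -- `C ⊓ D`; the intersection and the union have to be identified.
  refine acyclic_homOfLE_of_bicartSq _ _ (le_antisymm ?_ ?_) ?_ this
  · rintro p x ⟨h₁, h₂ | h₂⟩
    · exact Or.inl (cylTopSub_inf_cylSub_le (B' := D) _ ⟨h₂, h₁⟩)
    · refine Or.inr (cylSub_mono (show D.preimage f ⊓ C.preimage f ≤ _ from ?_)
        (inf_comm _ _).le _ (cylSub_inf_cylSub_le le_rfl le_rfl _ ⟨h₁, h₂⟩))
      exact fun p x hx => ⟨hx.2, hx.1⟩
  · refine sup_le (le_inf (cylTopSub_le_cylSub le_rfl) ?_) (le_inf ?_ ?_)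
    · exact (cylTopSub_mono le_top).trans le_sup_left
    · exact cylSub_mono (show (C ⊓ D).preimage f ≤ D.preimage f from fun p x hx => hx.2)
        inf_le_right
    · exact (cylSub_mono (show (C ⊓ D).preimage f ≤ C.preimage f from fun p x hx => hx.1)
        inf_le_left).trans le_sup_right
  · rw [sup_comm, sup_assoc]
    congr 1
    refine le_antisymm (sup_le (cylSub_mono ?_ le_sup_left) (cylSub_mono ?_ le_sup_right)) ?_
    · exact fun p x hx => Or.inl hx
    · exact fun p x hx => Or.inr hx
    · rintro p _ (⟨b, hb | hb, rfl⟩ | ⟨α, a, ha | ha, rfl⟩)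
      · exact Or.inl (Or.inl ⟨b, hb, rfl⟩)
      · exact Or.inr (Or.inl ⟨b, hb, rfl⟩)
      · exact Or.inl (Or.inr ⟨α, a, ha, rfl⟩)
      · exact Or.inr (Or.inr ⟨α, a, ha, rfl⟩)

end CylinderEquivalences

/-! ## Filtrations by subcomplexes -/

section Filtration

variable {A B X : SSet.{u}}

/-- A filtration of a simplicial set by subcomplexes, indexed by a complete lattice and compatible
with suprema of chains, such that every proper stage has an acyclic enlargement. -/
theorem acyclic_of_chain {I : Type v} [CompleteLattice I] (Θ : I → X.Subcomplex)
    (hΘ : Monotone Θ)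
    (hsup : ∀ c : Set I, c.Nonempty → IsChain (· ≤ ·) c →
      ∀ (p : SimplexCategoryᵒᵖ) (x : X.obj p), x ∈ (Θ (sSup c)).obj p → ∃ a ∈ c, x ∈ (Θ a).obj p)
    (hstep : ∀ C, C ≠ ⊤ → ∃ C', ∃ h : C < C', acyclic (SSet.Subcomplex.homOfLE (hΘ h.le))) :
    acyclic (SSet.Subcomplex.homOfLE (hΘ (bot_le : ⊥ ≤ (⊤ : I)))) := by
  intro E D π hπ
  refine ⟨fun {t b} sq => ?_⟩
  -- Zorn's lemma is applied to the partial lifts, defined on a stage `Θ C` and ordered by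
  -- extension.
  let P := {y : Σ C : I, ((Θ C).toSSet ⟶ E) //
    SSet.Subcomplex.homOfLE (hΘ (bot_le : ⊥ ≤ y.1)) ⨟ y.2 = t ∧
      y.2 ⨟ π = SSet.Subcomplex.homOfLE (hΘ (le_top : y.1 ≤ ⊤)) ⨟ b}
  let r : P → P → Prop := fun y z => ∃ h : y.1.1 ≤ z.1.1,
    SSet.Subcomplex.homOfLE (hΘ h) ⨟ z.1.2 = y.1.2
  have hr : ∀ {y z w}, r y z → r z w → r y w := fun ⟨h, e⟩ ⟨h', e'⟩ =>
    ⟨h.trans h', by rw [← e, ← e']; rfl⟩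
  have y₀ : P := ⟨⟨⊥, t⟩, rfl, sq.w⟩
  have hub : ∀ c : Set P, IsChain r c → ∃ ub, ∀ a ∈ c, r a ub := by
    intro c hc
    rcases c.eq_empty_or_nonempty with rfl | hne
    · exact ⟨y₀, fun a ha => ha.elim⟩
    let s := sSup ((fun y : P => y.1.1) '' c)
    -- By `hsup`, a simplex of the stage at the supremum already lies in a stage of the chain; hence
    -- the lifts in the chain glue.
    have hs : ∀ (p : SimplexCategoryᵒᵖ) (x : (Θ s).toSSet.obj p),
        ∃ y : P, y ∈ c ∧ x.1 ∈ (Θ y.1.1).obj p := by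
      intro p x
      obtain ⟨_, ⟨y, hy, rfl⟩, hx⟩ := hsup _ (hne.image _) (by
        rintro _ ⟨y, hy, rfl⟩ _ ⟨z, hz, rfl⟩ hyz
        rcases hc hy hz (fun e => hyz (e ▸ rfl)) with h | h
        · exact Or.inl h.1
        · exact Or.inr h.1) p x.1 x.2
      exact ⟨y, hy, hx⟩
    have huniq : ∀ (p : SimplexCategoryᵒᵖ) (x : X.obj p) (y z : P) (_ : y ∈ c) (_ : z ∈ c)
        (h₁ : x ∈ (Θ y.1.1).obj p) (h₂ : x ∈ (Θ z.1.1).obj p),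
        y.1.2.app p ⟨x, h₁⟩ = z.1.2.app p ⟨x, h₂⟩ := by
      intro p x y z hy hz h₁ h₂
      rcases eq_or_ne y z with rfl | hne
      · rfl
      rcases hc hy hz hne with ⟨h, e⟩ | ⟨h, e⟩
      · exact (app_congr e ⟨x, h₁⟩).symm
      · exact app_congr e ⟨x, h₂⟩
    choose y hy hy' using hs
    let l : (Θ s).toSSet ⟶ E :=
      { app p := ↾fun x => (y p x).1.2.app p ⟨x.1, hy' p x⟩
        naturality p q θ := by
          ext x
          refine (huniq _ _ _ (y p x) (hy _ _) (hy _ _) _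
            ((Θ (y p x).1.1).map θ (hy' p x))).trans ?_
          exact app_map (y p x).1.2 θ ⟨x.1, hy' p x⟩ }
    have hl : ∀ z ∈ c, ∀ h : z.1.1 ≤ s, SSet.Subcomplex.homOfLE (hΘ h) ⨟ l = z.1.2 := by
      intro z hz h
      ext p x
      exact huniq _ _ _ _ (hy _ _) hz _ _
    have hle : ∀ z ∈ c, z.1.1 ≤ s := fun z hz => le_sSup ⟨z, hz, rfl⟩
    obtain ⟨z, hz⟩ := hne
    refine ⟨⟨⟨s, l⟩, ?_, ?_⟩, fun a ha => ⟨hle a ha, hl a ha (hle a ha)⟩⟩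
    · rw [← z.2.1, ← hl z hz (hle z hz)]
      rfl
    · ext p x
      exact app_congr (y p x).2.2 ⟨x.1, hy' p x⟩
  obtain ⟨y, hy⟩ := exists_maximal_of_chains_bounded hub hr
  obtain ⟨⟨C, l⟩, h₁, h₂⟩ := y
  by_cases hC : C = ⊤
  · subst hC
    exact ⟨⟨⟨l, h₁, h₂⟩⟩⟩
  -- A maximal partial lift on a proper stage would extend along the acyclic enlargement, a
  -- contradiction.
  · obtain ⟨C', h, hacyc⟩ := hstep C hC
    have := hacyc π hπ
    have sq' : CommSq l (SSet.Subcomplex.homOfLE (hΘ h.le)) π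
      (SSet.Subcomplex.homOfLE (hΘ (le_top : C' ≤ ⊤)) ⨟ b) := ⟨h₂⟩
    have := hy ⟨⟨C', sq'.lift⟩, by
      refine Eq.trans ?_ h₁
      exact congrArg (SSet.Subcomplex.homOfLE (hΘ (bot_le : ⊥ ≤ C)) ⨟ ·) sq'.fac_left, sq'.fac_right⟩ ⟨h.le, sq'.fac_left⟩
    exact (h.not_ge this.1).elim

/-- Reduces statements about `f` to the monomorphism `cylTop f`, to which filtration arguments
apply. -/
theorem exists_cylProj (f : A ⟶ B) :
    ∃ d : cyl f ⟶ B, IsWeakEquiv d ∧ cylTop f ⨟ d = f := by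
  obtain ⟨d, hd₁, hd₂⟩ := exists_cylDesc (f := f) (𝟙 B) (snd _ _ ⨟ f) rfl
  obtain ⟨H, hH₁, hH₂⟩ := exists_cylDeformation f
  refine ⟨d, .of_homotopyEquiv (g := cylBot f) ((IsWeakEquiv.id _).congr' (hRel_iff.2 ⟨H, ?_, ?_⟩))
    (by
      rw [hd₁]
      exact .id _), by
      rw [cylTop, Category.assoc, hd₂]
      rfl⟩
  · refine cyl_hom_ext ?_ ?_
    · rw [reassoc_of% hd₁]
      ext p b
      exact hH₁ _ _ _
    · rw [reassoc_of% hd₂]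
      ext p ⟨α, a⟩
      refine (hH₂ _ _ _ _).trans ?_
      refine Eq.trans ?_ (cylProd_zero a)
      exact congrArg (fun γ => (cylProd f).app p (pairMk γ a)) (intervalMin_zero_right α)
  · refine cyl_hom_ext ?_ ?_
    · ext p b
      exact hH₁ _ _ _
    · ext p ⟨α, a⟩
      refine (hH₂ _ _ _ _).trans ?_
      exact congrArg (fun γ => (cylProd f).app p (pairMk γ a)) (intervalMin_one_right α)

/-- A map is a weak equivalence if it is one over all subcomplexes of the members of a cover of the
target. -/
theorem isWeakEquiv_of_cover (f : A ⟶ B) {ι : Type v} (U : ι → B.Subcomplex)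
    (hU : ∀ (p : SimplexCategoryᵒᵖ) (x : B.obj p), ∃ i, x ∈ (U i).obj p)
    (h : ∀ i (C : B.Subcomplex), C ≤ U i → IsWeakEquiv (restrict f (le_refl (C.preimage f)))) :
    IsWeakEquiv f := by
  -- The mapping cylinder is filtered by gluing in the cylinder over more and more of `B`, starting
  -- with just the source.
  let Θ : B.Subcomplex → (cyl f).Subcomplex := fun C => cylTopSub f ⊤ ⊔ cylSub f (C.preimage f) C
  have hΘ : Monotone Θ := fun C D hCD => sup_le_sup_left
    (cylSub_mono (show C.preimage f ≤ D.preimage f from fun p x hx => hCD _ hx) hCD) _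
  have key := acyclic_of_chain Θ hΘ (by
      rintro c ⟨C₀, hC₀⟩ hc p x (hx | ⟨b, hb, rfl⟩ | ⟨α, a, ha, rfl⟩)
      · exact ⟨C₀, hC₀, Or.inl hx⟩
      · have hb' : b ∈ (sSup c).obj p := hb
        rw [Subfunctor.sSup_obj] at hb'
        obtain ⟨_, ⟨C, hC, rfl⟩, hb'⟩ := hb'
        exact ⟨C, hC, Or.inr (Or.inl ⟨b, hb', rfl⟩)⟩
      · have ha' : f.app p a ∈ (sSup c).obj p := ha
        rw [Subfunctor.sSup_obj] at ha'
        obtain ⟨_, ⟨C, hC, rfl⟩, ha'⟩ := ha'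
        exact ⟨C, hC, Or.inr (Or.inr ⟨α, a, ha', rfl⟩)⟩) (by
      intro C hC
      have : ∃ i, ¬ U i ≤ C := by
        by_contra! hall
        refine hC (top_le_iff.1 fun p x _ => ?_)
        obtain ⟨i, hi⟩ := hU p x
        exact hall i _ hi
      obtain ⟨i, hi⟩ := this
      -- Gluing in `U i` requires an equivalence over `U i` and over `C ⊓ U i`. The latter is an
      -- arbitrary small piece, which is why the hypothesis concerns all subcomplexes of the
      -- members.
      exact ⟨C ⊔ U i, left_lt_sup.2 hi,
        acyclic_cylTopSub_sup_preimage (h i _ inf_le_right) (h i _ le_rfl)⟩)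
  -- The bottom stage is a copy of `A`, since nothing of `B` has been glued in yet.
  let u : A ⟶ (Θ ⊥).toSSet := SSet.Subcomplex.lift (cylTop f) (by
    rintro p _ ⟨a, rfl⟩
    exact Or.inl ⟨a, trivial, rfl⟩)
  have : Mono u := by
    have : Mono (u ⨟ (Θ ⊥).ι) := inferInstanceAs (Mono (cylTop f))
    exact mono_of_mono u (Θ ⊥).ι
  have : Epi u := by
    rw [NatTrans.epi_iff_epi_app]
    intro p
    rw [epi_iff_surjective]
    rintro ⟨x, ⟨a, -, rfl⟩ | ⟨b, hb, rfl⟩ | ⟨α, a, ha, rfl⟩⟩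
    · exact ⟨a, rfl⟩
    · exact (hb : False).elim
    · exact (ha : False).elim
  have hu : IsIso u := isIso_of_mono_of_epi u
  have : Epi (Θ ⊤).ι := by
    rw [NatTrans.epi_iff_epi_app]
    intro p
    rw [epi_iff_surjective]
    intro x
    exact ⟨⟨x, Or.inr ((cylSub_top (f := f)).ge _ trivial)⟩, rfl⟩
  have hι : IsIso (Θ ⊤).ι := isIso_of_mono_of_epi _
  obtain ⟨d, hd, hd'⟩ := exists_cylProj f
  rw [← hd']
  exact IsWeakEquiv.comp ((IsWeakEquiv.of_isIso u).comp
    (key.isWeakEquiv.comp (.of_isIso (Θ ⊤).ι))) hd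

end Filtration

/-! ## Edgewise subdivision -/

section EdgewiseSubdivision

/-- The join `[p] * [p]`. -/
abbrev dbl (p : SimplexCategory) : SimplexCategory := SimplexCategory.mk (p.len + 1 + p.len)

/-- The inclusion of the front face. -/
def front {p : SimplexCategory} (i : Fin (p.len + 1)) : Fin ((dbl p).len + 1) :=
  Fin.castAdd (p.len + 1) i

/-- The inclusion of the back face. -/
def back {p : SimplexCategory} (i : Fin (p.len + 1)) : Fin ((dbl p).len + 1) :=
  Fin.natAdd (p.len + 1) i

@[elab_as_elim]
theorem dbl_cases {p : SimplexCategory} {P : Fin ((dbl p).len + 1) → Prop}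
    (h₁ : ∀ i, P (front i)) (h₂ : ∀ i, P (back i)) (i : Fin ((dbl p).len + 1)) : P i :=
  Fin.addCases (m := p.len + 1) (n := p.len + 1) h₁ h₂ i

/-- Functions on the join. -/
def dblElim {p : SimplexCategory} {α : Type v} (f g : Fin (p.len + 1) → α) :
    Fin ((dbl p).len + 1) → α :=
  Fin.addCases (m := p.len + 1) (n := p.len + 1) f g

@[simp]
theorem dblElim_front {p : SimplexCategory} {α : Type v} (f g : Fin (p.len + 1) → α)
    (i : Fin (p.len + 1)) : dblElim f g (front i) = f i := Fin.addCases_left i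

@[simp]
theorem dblElim_back {p : SimplexCategory} {α : Type v} (f g : Fin (p.len + 1) → α)
    (i : Fin (p.len + 1)) : dblElim f g (back i) = g i := Fin.addCases_right i

theorem front_le_front {p : SimplexCategory} {i j : Fin (p.len + 1)} :
    front i ≤ front j ↔ i ≤ j := Iff.rfl

theorem back_le_back {p : SimplexCategory} {i j : Fin (p.len + 1)} :
    back i ≤ back j ↔ i ≤ j := by
  change p.len + 1 + i.1 ≤ p.len + 1 + j.1 ↔ i.1 ≤ j.1
  omega

theorem front_le_back {p : SimplexCategory} (i j : Fin (p.len + 1)) : front i ≤ back j := by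
  change i.1 ≤ p.len + 1 + j.1
  omega

theorem not_back_le_front {p : SimplexCategory} (i j : Fin (p.len + 1)) :
    ¬ back i ≤ front j := by
  change ¬ (p.len + 1 + i.1 ≤ j.1)
  omega

/-- Monotone functions on the join. -/
theorem dblElim_monotone {p : SimplexCategory} {α : Type v} [Preorder α]
    {f g : Fin (p.len + 1) → α} (hf : Monotone f) (hg : Monotone g) (h : ∀ i j, f i ≤ g j) :
    Monotone (dblElim f g) := by
  intro i j
  induction i using dbl_cases with
  | h₁ i =>
    induction j using dbl_cases with
    | h₁ j => simpa using fun hij => hf (front_le_front.1 hij)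
    | h₂ j => simpa using fun _ => h i j
  | h₂ i =>
    induction j using dbl_cases with
    | h₁ j => exact fun hij => (not_back_le_front _ _ hij).elim
    | h₂ j => simpa using fun hij => hg (back_le_back.1 hij)

/-- The map of joins induced by a monotone map. -/
def dblHom {p q : SimplexCategory} (θ : Fin (p.len + 1) →o Fin (q.len + 1)) :
    Fin ((dbl p).len + 1) →o Fin ((dbl q).len + 1) :=
  ⟨dblElim (fun i => front (θ i)) (fun i => back (θ i)), dblElim_monotone
      (fun _ _ h => front_le_front.2 (θ.monotone h))
      (fun _ _ h => back_le_back.2 (θ.monotone h)) fun _ _ => front_le_back _ _⟩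

@[simp]
theorem dblHom_front {p q : SimplexCategory} (θ : Fin (p.len + 1) →o Fin (q.len + 1))
    (i : Fin (p.len + 1)) : dblHom θ (front i) = front (θ i) :=
  dblElim_front (fun i => front (θ i)) (fun i => back (θ i)) i

@[simp]
theorem dblHom_back {p q : SimplexCategory} (θ : Fin (p.len + 1) →o Fin (q.len + 1))
    (i : Fin (p.len + 1)) : dblHom θ (back i) = back (θ i) :=
  dblElim_back (fun i => front (θ i)) (fun i => back (θ i)) i

/-- The functor `[p] ↦ [p] * [p]`. -/
def dblFunctor : SimplexCategory ⥤ SimplexCategory where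
  obj := dbl
  map {p q} θ := SimplexCategory.Hom.mk (dblHom (p := p) (q := q) θ.toOrderHom)
  map_id p := by
    apply SimplexCategory.Hom.ext
    apply OrderHom.ext
    funext i
    induction i using dbl_cases with
    | h₁ i => exact dblHom_front _ i
    | h₂ i => exact dblHom_back _ i
  map_comp {p q r} θ η := by
    apply SimplexCategory.Hom.ext
    apply OrderHom.ext
    funext i
    change dblHom (p := p) (q := r) (θ ⨟ η).toOrderHom i =
      dblHom (p := q) (q := r) η.toOrderHom (dblHom (p := p) (q := q) θ.toOrderHom i)
    induction i using dbl_cases with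
    | h₁ i => rw [dblHom_front, dblHom_front, dblHom_front]; rfl
    | h₂ i => rw [dblHom_back, dblHom_back, dblHom_back]; rfl

/-- The front face, as a natural transformation. -/
def dblFront : 𝟭 SimplexCategory ⟶ dblFunctor where
  app p := SimplexCategory.Hom.mk ⟨front, fun _ _ h => front_le_front.2 h⟩
  naturality p q θ := by
    apply SimplexCategory.Hom.ext
    apply OrderHom.ext
    funext i
    exact (dblHom_front (p := p) (q := q) θ.toOrderHom i).symm

/-- Edgewise subdivision. -/
def edgewise : SSet.{u} ⥤ SSet.{u} :=
  (Functor.whiskeringLeft _ _ (Type u)).obj dblFunctor.op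

/-- The front face, as a natural transformation from the edgewise subdivision to the identity. -/
def edgewiseFront : edgewise.{u} ⟶ 𝟭 SSet.{u} :=
  (Functor.whiskeringLeft _ _ (Type u)).map (NatTrans.op dblFront)

/-- The right adjoint of the edgewise subdivision. -/
def edgewiseRight : SSet.{u} ⥤ SSet.{u} := dblFunctor.op.ran

/-- Edgewise subdivision has a right adjoint. -/
def edgewiseAdjunction : edgewise.{u} ⊣ edgewiseRight.{u} := dblFunctor.op.ranAdjunction (Type u)

variable {S S' X Y : SSet.{u}}

/-- The extension property for maps of mapping cylinders of the front face. -/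
def edgewiseExtension (p : X ⟶ Y) : MorphismProperty SSet.{u} := fun S' S j =>
  ∀ (g : edgewise.obj S ⟶ X) (f' : S' ⟶ X) (H' : Δ[1] ⊗ edgewise.obj S' ⟶ X) (f : S ⟶ Y)
    (H : Δ[1] ⊗ edgewise.obj S ⟶ Y), end₁ 0 _ ⨟ H' = edgewiseFront.app S' ⨟ f' →
    end₁ 1 _ ⨟ H' = edgewise.map j ⨟ g → end₁ 0 _ ⨟ H = edgewiseFront.app S ⨟ f →
    end₁ 1 _ ⨟ H = g ⨟ p → f' ⨟ p = j ⨟ f → H' ⨟ p = (_ ◁ edgewise.map j) ⨟ H →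
    ∃ (F : S ⟶ X) (G : Δ[1] ⊗ edgewise.obj S ⟶ X), j ⨟ F = f' ∧ F ⨟ p = f ∧
      (_ ◁ edgewise.map j) ⨟ G = H' ∧ G ⨟ p = H ∧ end₁ 0 _ ⨟ G = edgewiseFront.app S ⨟ F ∧
      end₁ 1 _ ⨟ G = g

/-- Maps out of cylinders on the edgewise subdivision. -/
def edgewiseTranspose : (Δ[1] ⊗ edgewise.obj S ⟶ X) ≃ (S ⟶ edgewiseRight.obj ((ihom Δ[1]).obj X)) :=
  ((ihom.adjunction Δ[1]).homEquiv _ _).trans (edgewiseAdjunction.homEquiv _ _)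

theorem edgewiseTranspose_left (j : S' ⟶ S) (H : Δ[1] ⊗ edgewise.obj S ⟶ X) :
    edgewiseTranspose (_ ◁ edgewise.map j ⨟ H) = j ⨟ edgewiseTranspose H := by
  have e : (ihom.adjunction (Δ[1] : SSet.{u})).homEquiv _ _ (_ ◁ edgewise.map j ⨟ H) =
      edgewise.map j ⨟ (ihom.adjunction (Δ[1] : SSet.{u})).homEquiv _ _ H :=
    (ihom.adjunction (Δ[1] : SSet.{u})).homEquiv_naturality_left _ _
  change edgewiseAdjunction.homEquiv _ _ _ = _
  rw [e, edgewiseAdjunction.homEquiv_naturality_left]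
  rfl

theorem edgewiseTranspose_right (p : X ⟶ Y) (H : Δ[1] ⊗ edgewise.obj S ⟶ X) :
    edgewiseTranspose (H ⨟ p) = edgewiseTranspose H ⨟ edgewiseRight.map ((ihom Δ[1]).map p) := by
  have e : (ihom.adjunction (Δ[1] : SSet.{u})).homEquiv _ _ (H ⨟ p) =
      (ihom.adjunction (Δ[1] : SSet.{u})).homEquiv _ _ H ⨟ (ihom _).map p :=
    (ihom.adjunction (Δ[1] : SSet.{u})).homEquiv_naturality_right _ _
  change edgewiseAdjunction.homEquiv _ _ _ = _
  rw [e, edgewiseAdjunction.homEquiv_naturality_right]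
  rfl

/-- Evaluation at a vertex of the interval. -/
def evalEnd (a : Fin 2) (X : SSet.{u}) : (ihom Δ[1]).obj X ⟶ X :=
  end₁ a _ ⨟ MonoidalClosed.uncurry (𝟙 _)

theorem evalEnd_naturality (a : Fin 2) (p : X ⟶ Y) :
    evalEnd a X ⨟ p = (ihom Δ[1]).map p ⨟ evalEnd a Y := by
  have e : (ihom Δ[1]).map p ⨟ end₁ a _ = end₁ a _ ⨟ Δ[1] ◁ (ihom Δ[1]).map p := rfl
  rw [evalEnd, evalEnd, reassoc_of% e, ← MonoidalClosed.uncurry_natural_left, Category.assoc,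
    ← MonoidalClosed.uncurry_natural_right, Category.comp_id, Category.id_comp]

theorem edgewiseTranspose_evalEnd (a : Fin 2) (H : Δ[1] ⊗ edgewise.obj S ⟶ X) :
    edgewiseTranspose H ⨟ edgewiseRight.map (evalEnd a X) =
      edgewiseAdjunction.homEquiv _ _ (end₁ a _ ⨟ H) := by
  have e : end₁ a _ ⨟ H = MonoidalClosed.curry H ⨟ evalEnd a X := by
    have e' : MonoidalClosed.curry H ⨟ end₁ a _ = end₁ a _ ⨟ Δ[1] ◁ MonoidalClosed.curry H := rfl
    rw [evalEnd, reassoc_of% e', ← MonoidalClosed.uncurry_natural_left, Category.comp_id,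
      MonoidalClosed.uncurry_curry]
  rw [e, edgewiseAdjunction.homEquiv_naturality_right]
  rfl

/-- The transpose of the front face. -/
def edgewiseUnit (X : SSet.{u}) : X ⟶ edgewiseRight.obj X :=
  edgewiseAdjunction.homEquiv _ _ (edgewiseFront.app X)

theorem comp_edgewiseUnit (f : S ⟶ X) :
    f ⨟ edgewiseUnit X = edgewiseAdjunction.homEquiv _ _ (edgewiseFront.app S ⨟ f) := by
  have : edgewiseFront.app S ⨟ f = edgewise.map f ⨟ edgewiseFront.app X :=
    (edgewiseFront.naturality f).symm
  rw [this, edgewiseAdjunction.homEquiv_naturality_left]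
  rfl

theorem edgewiseUnit_naturality (p : X ⟶ Y) :
    edgewiseUnit X ⨟ edgewiseRight.map p = p ⨟ edgewiseUnit Y := by
  rw [comp_edgewiseUnit, edgewiseUnit, edgewiseAdjunction.homEquiv_naturality_right]
  rfl

/-- Pairs of a map `S ⟶ X` and a homotopy on the edgewise subdivision of `S` starting at its
restriction. -/
abbrev edgewisePath (X : SSet.{u}) : SSet.{u} :=
  pullback (edgewiseUnit X) (edgewiseRight.map (evalEnd 0 X))

/-- The endpoint of the homotopy. -/
abbrev edgewisePathEnd (X : SSet.{u}) : edgewisePath X ⟶ edgewiseRight.obj X :=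
  pullback.snd _ _ ⨟ edgewiseRight.map (evalEnd 1 X)

/-- The functoriality of `edgewisePath`. -/
abbrev edgewisePathMap (p : X ⟶ Y) : edgewisePath X ⟶ edgewisePath Y :=
  pullback.lift (pullback.fst _ _ ⨟ p)
    (pullback.snd _ _ ⨟ edgewiseRight.map ((ihom Δ[1]).map p)) (by
      rw [Category.assoc, Category.assoc, ← edgewiseUnit_naturality, ← Functor.map_comp,
        ← evalEnd_naturality, Functor.map_comp, pullback.condition_assoc])

/-- The map whose lifting properties encode `edgewiseExtension`. -/
abbrev edgewiseGap (p : X ⟶ Y) : edgewisePath X ⟶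
    pullback (edgewisePathEnd Y) (edgewiseRight.map p) :=
  pullback.lift (edgewisePathMap p) (edgewisePathEnd X) (by
    rw [pullback.lift_snd_assoc, Category.assoc, Category.assoc, ← Functor.map_comp,
      ← Functor.map_comp, evalEnd_naturality])

theorem edgewisePath_condition (t : S ⟶ edgewisePath X) :
    end₁ 0 _ ⨟ edgewiseTranspose.symm (t ⨟ pullback.snd _ _) =
      edgewiseFront.app S ⨟ t ⨟ pullback.fst _ _ := by
  apply (edgewiseAdjunction.homEquiv _ _).injective
  refine (edgewiseTranspose_evalEnd 0 _).symm.trans ?_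
  refine Eq.trans ?_ (comp_edgewiseUnit (t ⨟ pullback.fst _ _))
  rw [Equiv.apply_symm_apply, Category.assoc, Category.assoc, pullback.condition]

theorem edgewisePathEnd_eq (t : S ⟶ edgewisePath X) : t ⨟ edgewisePathEnd X =
    edgewiseAdjunction.homEquiv _ _ (end₁ 1 _ ⨟ edgewiseTranspose.symm (t ⨟ pullback.snd _ _)) := by
  rw [← edgewiseTranspose_evalEnd, Equiv.apply_symm_apply, Category.assoc]

/-- Transposing along the adjunctions turns the extension data into a commutative square over
`edgewiseGap p`. So the extension property is a left lifting property against a fixed map, and it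
can be checked on cells; the right adjoint of edgewise subdivision is needed only for this. -/
theorem edgewiseExtension_iff (p : X ⟶ Y) (j : S' ⟶ S) :
    edgewiseExtension p j ↔ HasLiftingProperty j (edgewiseGap p) := by
  constructor
  · intro h
    refine ⟨fun {t b} sq => ⟨?_⟩⟩
    have w₁ : t ⨟ edgewisePathMap p = j ⨟ b ⨟ pullback.fst _ _ := by
      have := congrArg (· ⨟ pullback.fst _ _) sq.w
      simpa only [Category.assoc, pullback.lift_fst] using this
    have w₂ : t ⨟ edgewisePathEnd X = j ⨟ b ⨟ pullback.snd _ _ := by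
      have := congrArg (· ⨟ pullback.snd _ _) sq.w
      simpa only [Category.assoc, pullback.lift_snd] using this
    obtain ⟨F, G, e₁, e₂, e₃, e₄, e₅, e₆⟩ := h
      ((edgewiseAdjunction.homEquiv _ _).symm (b ⨟ pullback.snd _ _))
      (t ⨟ pullback.fst _ _) (edgewiseTranspose.symm (t ⨟ pullback.snd _ _))
      ((b ⨟ pullback.fst _ _) ⨟ pullback.fst _ _)
      (edgewiseTranspose.symm ((b ⨟ pullback.fst _ _) ⨟ pullback.snd _ _))
      (edgewisePath_condition t) (by
        apply (edgewiseAdjunction.homEquiv _ _).injective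
        rw [← edgewisePathEnd_eq, edgewiseAdjunction.homEquiv_naturality_left, w₂,
          Equiv.apply_symm_apply])
      (edgewisePath_condition _) (by
        apply (edgewiseAdjunction.homEquiv _ _).injective
        rw [← edgewisePathEnd_eq, edgewiseAdjunction.homEquiv_naturality_right,
          Equiv.apply_symm_apply, Category.assoc, Category.assoc, pullback.condition])
      (by
        have := congrArg (· ⨟ pullback.fst _ _) w₁
        simpa only [Category.assoc, pullback.lift_fst] using this)
      (by
        apply edgewiseTranspose.injective
        have := congrArg (· ⨟ pullback.snd _ _) w₁
        rw [edgewiseTranspose_left, edgewiseTranspose_right, Equiv.apply_symm_apply,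
          Equiv.apply_symm_apply]
        simpa only [Category.assoc, pullback.lift_snd] using this)
    have c : F ⨟ edgewiseUnit X = edgewiseTranspose G ⨟ edgewiseRight.map (evalEnd 0 X) := by
      rw [edgewiseTranspose_evalEnd, e₅, comp_edgewiseUnit]
    refine ⟨⟨pullback.lift F (edgewiseTranspose G) c, ?_, ?_⟩⟩
    · apply pullback.hom_ext
      · rw [Category.assoc, pullback.lift_fst, e₁]
      · rw [Category.assoc, pullback.lift_snd, ← edgewiseTranspose_left, e₃,
          Equiv.apply_symm_apply]
    · apply pullback.hom_ext
      · rw [Category.assoc, pullback.lift_fst]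
        apply pullback.hom_ext
        · rw [Category.assoc, pullback.lift_fst, pullback.lift_fst_assoc, e₂]
        · rw [Category.assoc, pullback.lift_snd, pullback.lift_snd_assoc,
            ← edgewiseTranspose_right, e₄, Equiv.apply_symm_apply]
      · rw [Category.assoc, pullback.lift_snd, pullback.lift_snd_assoc, edgewiseTranspose_evalEnd,
          e₆, Equiv.apply_symm_apply]
  · intro h g f' H' f H h₁ h₂ h₃ h₄ h₅ h₆
    let t : S' ⟶ edgewisePath X := pullback.lift f' (edgewiseTranspose H') (by
      rw [edgewiseTranspose_evalEnd, h₁, comp_edgewiseUnit])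
    let b : S ⟶ pullback (edgewisePathEnd Y) (edgewiseRight.map p) := pullback.lift
      (pullback.lift f (edgewiseTranspose H) (by
        rw [edgewiseTranspose_evalEnd, h₃, comp_edgewiseUnit]))
      (edgewiseAdjunction.homEquiv _ _ g) (by
        rw [pullback.lift_snd_assoc, edgewiseTranspose_evalEnd, h₄,
          edgewiseAdjunction.homEquiv_naturality_right])
    have sq : CommSq t j (edgewiseGap p) b := ⟨by
      apply pullback.hom_ext
      · rw [Category.assoc, Category.assoc, pullback.lift_fst, pullback.lift_fst]
        apply pullback.hom_ext
        · rw [Category.assoc, Category.assoc, pullback.lift_fst, pullback.lift_fst,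
            pullback.lift_fst_assoc, h₅]
        · rw [Category.assoc, Category.assoc, pullback.lift_snd, pullback.lift_snd,
            pullback.lift_snd_assoc, ← edgewiseTranspose_right, ← edgewiseTranspose_left, h₆]
      · rw [Category.assoc, Category.assoc, pullback.lift_snd, pullback.lift_snd,
          pullback.lift_snd_assoc, edgewiseTranspose_evalEnd, h₂,
          edgewiseAdjunction.homEquiv_naturality_left]⟩
    have r := sq.fac_right
    have r₁ := congrArg (· ⨟ pullback.fst _ _ ⨟ pullback.fst _ _) r
    have r₂ := congrArg (· ⨟ pullback.fst _ _ ⨟ pullback.snd _ _) r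
    have r₃ := congrArg (· ⨟ pullback.snd _ _) r
    have l₁ := congrArg (· ⨟ pullback.fst _ _) sq.fac_left
    have l₂ := congrArg (· ⨟ pullback.snd _ _) sq.fac_left
    simp only [Category.assoc, pullback.lift_fst, pullback.lift_snd, pullback.lift_fst_assoc,
      b, t] at r₁ r₂ r₃ l₁ l₂
    refine ⟨sq.lift ⨟ pullback.fst _ _, edgewiseTranspose.symm (sq.lift ⨟ pullback.snd _ _),
      l₁, ?_, ?_, ?_, edgewisePath_condition _, ?_⟩
    · rw [Category.assoc, r₁]
    · apply edgewiseTranspose.injective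
      rw [edgewiseTranspose_left, Equiv.apply_symm_apply, l₂]
    · apply edgewiseTranspose.injective
      rw [edgewiseTranspose_right, Equiv.apply_symm_apply, Category.assoc, r₂]
    · apply (edgewiseAdjunction.homEquiv _ _).injective
      rw [← edgewisePathEnd_eq, r₃]

end EdgewiseSubdivision

/-! ### The front face of the edgewise subdivision is a weak equivalence. -/

section EdgewiseSubdivision

variable {A B S X Y : SSet.{u}}

/-- A monomorphism is built by attaching cells along boundaries of nondegenerate simplices of `Y`.
Recording that only dimensions occurring in `Y` matter makes the induction over dimension possible.
-/
theorem llp_of_cells (T : MorphismProperty.{u} SSet.{u}) {i : X ⟶ Y} [Mono i]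
    (h : ∀ d, (Y.nonDegenerate d).Nonempty → T.llp (∂Δ[d] : (Δ[d] : SSet.{u}).Subcomplex).ι) :
    T.llp i := by
  have h₁ := ((SSet.relativeCellComplexOfMono i).transfiniteCompositionOfShape'
    (I := T.llp) (fun s => h _ ⟨_, s.k.nonDegenerate⟩)).mem
  have h₂ := MorphismProperty.transfiniteCompositionsOfShape_pushouts_coproducts_le_llp_rlp
    T.llp ℕ _ h₁
  rwa [MorphismProperty.llp_rlp_llp] at h₂

/-- Maps out of the union of the source and a part of the mapping cylinder. -/
theorem exists_cylSubDesc {f : A ⟶ B} {A' : A.Subcomplex} {B' : B.Subcomplex}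
    (h : A' ≤ B'.preimage f) (g : A ⟶ X) (b : B'.toSSet ⟶ X) (H : Δ[1] ⊗ A'.toSSet ⟶ X)
    (h₀ : end₁ 0 _ ⨟ H = restrict f h ⨟ b) (h₁ : end₁ 1 _ ⨟ H = A'.ι ⨟ g) :
    ∃ t : (cylTopSub f ⊤ ⊔ cylSub f A' B').toSSet ⟶ X,
      (∀ p a ha, t.app p ⟨(cylTop f).app p a, ha⟩ = g.app p a) ∧
      (∀ p y hy, t.app p ⟨(cylBot f).app p y.1, hy⟩ = b.app p y) ∧
      ∀ p α a ha, t.app p ⟨(cylProd f).app p (pairMk α a.1), ha⟩ = H.app p (pairMk α a) := by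
  classical
  let U := cylTopSub f ⊤ ⊔ cylSub f A' B'
  have hb : ∀ {p y}, (cylBot f).app p y ∈ U.obj p → y ∈ B'.obj p := fun hx =>
    hx.elim (fun hx => (cylBot_notMem_cylTopSub hx).elim) (cylBot_mem_cylSub h).1
  -- Away from `A'`, the union contains only the end `1` of the cylinder, so there the map must be
  -- `g`.
  have hα : ∀ {p} {α} {a : A.obj p}, α ≠ SSet.stdSimplex.const 1 0 p → a ∉ A'.obj p →
      (cylProd f).app p (pairMk α a) ∈ U.obj p → α = SSet.stdSimplex.const 1 1 p :=
    fun hα ha hx => hx.elim (fun hx => ((cylProd_mem_cylTopSub hα).1 hx).1)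
      fun hx => (ha ((cylProd_mem_cylSub hα).1 hx)).elim
  let t : ∀ p (x : (cyl f).obj p), x ∈ U.obj p → X.obj p := fun p x =>
    Sum.rec (motive := fun x => x ∈ U.obj p → X.obj p) (fun y hy => b.app p ⟨y, hb hy⟩)
      (fun y _ => if ha : y.2 ∈ A'.obj p then H.app p (pairMk y.1.1 ⟨y.2, ha⟩) else g.app p y.2) x
  have t₁ : ∀ p y hy, t p ((cylBot f).app p y) hy = b.app p ⟨y, hb hy⟩ := fun _ _ _ => rfl
  have t₂ : ∀ p α (a : A.obj p) (hx : (cylProd f).app p (pairMk α a) ∈ U.obj p)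
      (ha : a ∈ A'.obj p), t p _ hx = H.app p (pairMk α ⟨a, ha⟩) := by
    intro p α a hx ha
    by_cases hα : α = SSet.stdSimplex.const 1 0 p
    · subst hα
      have e := cylProd_zero (f := f) a
      have : ∀ x, x = (cylBot f).app p (f.app p a) → ∀ hx, t p x hx = b.app p ⟨f.app p a, h _ ha⟩ := by
        rintro _ rfl hx
        rfl
      rw [this _ e]
      exact (app_congr h₀ ⟨a, ha⟩).symm
    · have e : (cylProd f).app p (pairMk α a) = .inr (⟨α, hα⟩, a) := cylMk_of_ne f hα a
      have : ∀ x, x = .inr (⟨α, hα⟩, a) → ∀ hx, t p x hx = H.app p (pairMk α ⟨a, ha⟩) := by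
        rintro _ rfl hx
        exact dif_pos ha
      exact this _ e _
  have t₃ : ∀ p (a : A.obj p) hx, t p ((cylTop f).app p a) hx = g.app p a := by
    intro p a hx
    by_cases ha : a ∈ A'.obj p
    · exact (t₂ p _ a hx ha).trans (app_congr h₁ ⟨a, ha⟩)
    · have e : (cylTop f).app p a = .inr (⟨_, const_one_ne p⟩, a) := cylMk_of_ne f _ a
      have : ∀ x, x = .inr (⟨_, const_one_ne p⟩, a) → ∀ hx, t p x hx = g.app p a := by
        rintro _ rfl hx
        exact dif_neg ha
      exact this _ e _
  refine ⟨{ app p := ↾fun x => t p x.1 x.2, naturality p q θ := ?_ }, fun p a ha => t₃ p a ha,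
    fun p y hy => t₁ p _ hy, fun p α a ha => t₂ p α _ ha a.2⟩
  ext ⟨x, hx⟩
  refine cyl_cases f (P := fun x => ∀ hx : x ∈ U.obj p,
    t q ((cyl f).map θ x) (U.map θ hx) = X.map θ (t p x hx)) (fun y hy => ?_)
    (fun α a hα' hx => ?_) x hx
  · exact app_map b θ ⟨y, hb hy⟩
  · by_cases ha : a ∈ A'.obj p
    · have e := (app_map (cylProd f) θ (pairMk α a)).symm
      have : ∀ x (e : x = (cylProd f).app q (pairMk (Δ[1].map θ α) (A.map θ a))) (hx),
        t q x hx = H.app q (pairMk (Δ[1].map θ α) ⟨A.map θ a, A'.map θ ha⟩) := by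
        rintro _ rfl hx
        exact t₂ q _ _ _ _
      exact (this _ e _).trans ((app_map H θ (pairMk α ⟨a, ha⟩)).trans
        (congrArg _ (t₂ p α a hx ha).symm))
    · obtain rfl := hα hα' ha hx
      have e := (app_map (cylTop f) θ a).symm
      have : ∀ x (e : x = (cylTop f).app q (A.map θ a)) (hx), t q x hx = g.app q (A.map θ a) := by
        rintro _ rfl hx
        exact t₃ q _ _
      exact (this _ e _).trans ((app_map g θ a).trans (congrArg _ (t₃ p a hx).symm))

/-- The edgewise subdivision of a subcomplex. -/
def edgewiseSub (S' : S.Subcomplex) : (edgewise.obj S).Subcomplex where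
  obj p := S'.obj (op (dbl p.unop))
  map _ _ hx := S'.map _ hx

theorem edgewiseSub_le (S' : S.Subcomplex) :
    edgewiseSub S' ≤ S'.preimage (edgewiseFront.app S) := fun _ _ hx => S'.map _ hx

/-- The data form a lifting problem for the inclusion of the cylinder over `S'`, together with the
top copy of the subdivision of `S`, into the full cylinder over `S`. This inclusion is acyclic when
the front faces of `S'` and of `S` are weak equivalences. -/
theorem edgewiseExtension_of_isWeakEquiv (S' : S.Subcomplex)
    (h : IsWeakEquiv (edgewiseFront.app S'.toSSet)) (h' : IsWeakEquiv (edgewiseFront.app S))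
    {p : X ⟶ Y} (hp : restrictionMaps p) : edgewiseExtension p S'.ι := by
  intro g f' H' f H h₁ h₂ h₃ h₄ h₅ h₆
  let i : (cylTopSub (edgewiseFront.app S) ⊤ ⊔
      cylSub (edgewiseFront.app S) (edgewiseSub S') S').toSSet ⟶
      (cylSub (edgewiseFront.app S) ⊤ ⊤).toSSet :=
    SSet.Subcomplex.homOfLE (sup_le (cylTopSub_le_cylSub le_rfl) (cylSub_mono le_top le_top))
  -- On `edgewiseSub S'` the front face of `S` is by definition the front face of `S'`, so `h` is
  -- the equivalence needed there.
  have hacyc : acyclic i := acyclic_cylTopSub_sup (f := edgewiseFront.app S) (A'' := ⊤) (B'' := ⊤)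
    le_top le_top (edgewiseSub_le S') le_rfl h
    ((IsWeakEquiv.of_comp_left (.of_isIso (SSet.Subcomplex.topIso _).inv)
      (IsWeakEquiv.of_comp_right (.of_isIso (SSet.Subcomplex.topIso S).hom) h')))
  obtain ⟨t, t₁, t₂, t₃⟩ := exists_cylSubDesc (edgewiseSub_le S') g f' H' h₁ h₂
  obtain ⟨d, d₁, d₂⟩ := exists_cylDesc f H h₃
  have := hacyc _ hp
  have sq : CommSq t i p ((cylSub (edgewiseFront.app S) ⊤ ⊤).ι ⨟ d) := ⟨by
    ext q ⟨_, ⟨a, -, rfl⟩ | ⟨b, hb, rfl⟩ | ⟨α, a, ha, rfl⟩⟩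
    · refine (congrArg (p.app q) (t₁ q a _)).trans ?_
      exact (app_congr h₄ a).symm.trans (app_congr d₂ (pairMk (SSet.stdSimplex.const 1 1 q) a)).symm
    · refine (congrArg (p.app q) (t₂ q ⟨b, hb⟩ _)).trans ?_
      exact (app_congr h₅ _).trans (app_congr d₁ b).symm
    · refine (congrArg (p.app q) (t₃ q α ⟨a, ha⟩ _)).trans ?_
      exact (app_congr h₆ (pairMk α ⟨a, ha⟩)).trans (app_congr d₂ (pairMk α a)).symm⟩
  let c : cyl (edgewiseFront.app S) ⟶ X := SSet.Subcomplex.lift (𝟙 _)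
    (le_top.trans cylSub_top.ge) ⨟ sq.lift
  have hc : c ⨟ p = d := congrArg (SSet.Subcomplex.lift (𝟙 _)
    (le_top.trans cylSub_top.ge) ⨟ ·) sq.fac_right
  have hl : ∀ q x, c.app q x.1 = t.app q x := fun q x => app_congr sq.fac_left x
  refine ⟨cylBot _ ⨟ c, cylProd _ ⨟ c, ?_, ?_, ?_, ?_, ?_, ?_⟩
  · ext q y
    exact (hl q ⟨_, Or.inr (Or.inl ⟨y.1, y.2, rfl⟩)⟩).trans (t₂ q y _)
  · rw [Category.assoc, hc, d₁]
  · ext q ⟨α, a⟩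
    exact (hl q ⟨_, Or.inr (Or.inr ⟨α, a.1, a.2, rfl⟩)⟩).trans (t₃ q α a _)
  · rw [Category.assoc, hc, d₂]
  · rw [← Category.assoc, end_cylProd, Category.assoc]
  · ext q a
    exact (hl q ⟨_, Or.inl ⟨a, trivial, rfl⟩⟩).trans (t₁ q a _)

/-- Relative to the empty subcomplex, the extension property says that the top inclusion into the
mapping cylinder of the front face is acyclic. The cylinder projects to `S` by an equivalence. -/
theorem isWeakEquiv_edgewiseFront_of_extension
    (h : ∀ {X Y : SSet.{u}} (p : X ⟶ Y), restrictionMaps p →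
      edgewiseExtension p (⊥ : S.Subcomplex).ι) : IsWeakEquiv (edgewiseFront.app S) := by
  have hac : acyclic (cylTop (edgewiseFront.app S)) := by
    intro X Y p hp
    refine ⟨fun {g b} sq => ⟨?_⟩⟩
    obtain ⟨F, G, -, h₁, -, h₂, h₃, h₄⟩ := h p hp g
      ({ app := fun p => ↾fun x => (x.2 : False).elim
         naturality := fun _ _ _ => by
            ext ⟨_, hx⟩
            exact (hx : False).elim } : (⊥ : S.Subcomplex).toSSet ⟶ X)
      ({ app := fun p => ↾fun x => (x.2.2 : False).elim
         naturality := fun _ _ _ => by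
            ext ⟨_, _, hx⟩
            exact (hx : False).elim } :
        Δ[1] ⊗ edgewise.obj (⊥ : S.Subcomplex).toSSet ⟶ X)
      (cylBot _ ⨟ b) (cylProd _ ⨟ b)
      (by
        ext _ ⟨_, hx⟩
        exact (hx : False).elim)
      (by
        ext _ ⟨_, hx⟩
        exact (hx : False).elim)
      (by rw [← Category.assoc, end_cylProd, Category.assoc])
      sq.w.symm
      (by
        ext _ ⟨_, hx⟩
        exact (hx : False).elim)
      (by
        ext _ ⟨_, _, hx⟩
        exact (hx : False).elim)
    obtain ⟨d, d₁, d₂⟩ := exists_cylDesc F G h₃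
    refine ⟨⟨d, ?_, cyl_hom_ext ?_ ?_⟩⟩
    · rw [cylTop, Category.assoc, d₂, h₄]
    · rw [← Category.assoc, d₁, h₁]
    · rw [← Category.assoc, d₂, h₂]
  obtain ⟨d, hd, hd'⟩ := exists_cylProj (edgewiseFront.app S)
  rw [← hd']
  exact hac.isWeakEquiv.comp hd

/-- Simplices of `Δ[n]` given by monotone maps. -/
abbrev simplexMk {n : ℕ} {p : SimplexCategory} (f : Fin (p.len + 1) →o Fin (n + 1)) :
    (Δ[n] : SSet.{u}).obj (op p) :=
  SSet.stdSimplex.objEquiv.symm (SimplexCategory.Hom.mk f)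

theorem simplex_ext {n : ℕ} {p : SimplexCategory} {x y : (Δ[n] : SSet.{u}).obj (op p)}
    (h : ∀ i, SSet.stdSimplex.asOrderHom x i = SSet.stdSimplex.asOrderHom y i) : x = y :=
  SSet.stdSimplex.ext (d := p.len) x y h

/-- Pushing the back half of a simplex to the last vertex. -/
def pushBack {n : ℕ} {p : SimplexCategory} (z : Fin ((dbl p).len + 1) →o Fin (n + 1))
    (α : Fin (p.len + 1) →o Fin 2) : Fin ((dbl p).len + 1) →o Fin (n + 1) :=
  ⟨dblElim (fun i => z (front i)) (fun i => if α i = 0 then z (back i) else Fin.last n),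
    dblElim_monotone (fun _ _ h => z.monotone (front_le_front.2 h)) (fun i j h => by
      have := α.monotone h
      dsimp only
      split_ifs with h₁ h₂ h₂
      · exact z.monotone (back_le_back.2 h)
      · exact Fin.le_last _
      · rw [h₂] at this
        exact (h₁ (Fin.le_zero_iff.1 this)).elim
      · exact le_rfl) (fun i j => by
      split_ifs
      · exact z.monotone (front_le_back _ _)
      · exact Fin.le_last _)⟩

theorem pushBack_front {n : ℕ} {p : SimplexCategory} (z : Fin ((dbl p).len + 1) →o Fin (n + 1))
    (α : Fin (p.len + 1) →o Fin 2) (i : Fin (p.len + 1)) :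
    pushBack z α (front i) = z (front i) :=
  dblElim_front (fun i => z (front i)) (fun i => if α i = 0 then z (back i) else Fin.last n) i

theorem pushBack_back {n : ℕ} {p : SimplexCategory} (z : Fin ((dbl p).len + 1) →o Fin (n + 1))
    (α : Fin (p.len + 1) →o Fin 2) (i : Fin (p.len + 1)) :
    pushBack z α (back i) = if α i = 0 then z (back i) else Fin.last n :=
  dblElim_back (fun i => z (front i)) (fun i => if α i = 0 then z (back i) else Fin.last n) i

/-- Extending a simplex by the last vertex. -/
def lastBack {n : ℕ} {p : SimplexCategory} (x : Fin (p.len + 1) →o Fin (n + 1)) :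
    Fin ((dbl p).len + 1) →o Fin (n + 1) :=
  ⟨dblElim x (fun _ => Fin.last n), dblElim_monotone x.monotone (fun _ _ _ => le_rfl)
    fun _ _ => Fin.le_last _⟩

theorem lastBack_front {n : ℕ} {p : SimplexCategory} (x : Fin (p.len + 1) →o Fin (n + 1))
    (i : Fin (p.len + 1)) : lastBack x (front i) = x i :=
  dblElim_front x (fun _ => Fin.last n) i

theorem lastBack_back {n : ℕ} {p : SimplexCategory} (x : Fin (p.len + 1) →o Fin (n + 1))
    (i : Fin (p.len + 1)) : lastBack x (back i) = Fin.last n :=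
  dblElim_back x (fun _ => Fin.last n) i

/-- A homotopy inverse fills the back half of a simplex with the last vertex. The homotopy pushes
back vertices to the last vertex, which keeps all maps monotone. -/
theorem isWeakEquiv_edgewiseFront_stdSimplex (n : ℕ) :
    IsWeakEquiv (edgewiseFront.app (Δ[n] : SSet.{u})) := by
  let s : (Δ[n] : SSet.{u}) ⟶ edgewise.obj Δ[n] :=
    { app p := ↾fun x => simplexMk (n := n) (p := dbl p.unop)
        (lastBack (SSet.stdSimplex.asOrderHom x))
      naturality p q θ := by
        ext x
        refine simplex_ext (p := dbl q.unop) fun i => ?_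
        change lastBack (p := q.unop) (SSet.stdSimplex.asOrderHom (Δ[n].map θ x)) i =
          lastBack (p := p.unop) (SSet.stdSimplex.asOrderHom x)
            (dblHom (p := q.unop) (q := p.unop) θ.unop.toOrderHom i)
        induction i using dbl_cases with
        | h₁ i => rw [lastBack_front, dblHom_front, lastBack_front]; rfl
        | h₂ i => rw [lastBack_back, dblHom_back, lastBack_back] }
  have hs : s ⨟ edgewiseFront.app _ = 𝟙 _ := by
    ext p x
    refine simplex_ext (p := p.unop) fun i => ?_
    exact lastBack_front (p := p.unop) (SSet.stdSimplex.asOrderHom x) i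
  let h : edgewise.obj (Δ[n] : SSet.{u}) ⊗ Δ[1] ⟶ edgewise.obj Δ[n] :=
    { app p := ↾fun x => simplexMk (n := n) (p := dbl p.unop)
        (pushBack (SSet.stdSimplex.asOrderHom x.1) (SSet.stdSimplex.asOrderHom x.2))
      naturality p q θ := by
        ext ⟨x, α⟩
        refine simplex_ext (p := dbl q.unop) fun i => ?_
        let x' : Fin ((dbl q.unop).len + 1) →o Fin (n + 1) :=
          SSet.stdSimplex.asOrderHom (Δ[n].map (dblFunctor.op.map θ) x)
        change pushBack (p := q.unop) x'
            (SSet.stdSimplex.asOrderHom (Δ[1].map θ α)) i =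
          pushBack (p := p.unop) (SSet.stdSimplex.asOrderHom x) (SSet.stdSimplex.asOrderHom α)
            (dblHom (p := q.unop) (q := p.unop) θ.unop.toOrderHom i)
        have hx : ∀ i, x' i =
          SSet.stdSimplex.asOrderHom x
            (dblHom (p := q.unop) (q := p.unop) θ.unop.toOrderHom i) := fun _ => rfl
        have hα : ∀ i, SSet.stdSimplex.asOrderHom (Δ[1].map θ α) i =
          SSet.stdSimplex.asOrderHom α (θ.unop.toOrderHom i) := fun _ => rfl
        induction i using dbl_cases with
        | h₁ i => rw [pushBack_front, hx, dblHom_front, pushBack_front]; rfl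
        | h₂ i => rw [pushBack_back, hx, dblHom_back, pushBack_back, hα]; rfl }
  have H : HRel (𝟙 _) (edgewiseFront.app _ ⨟ s) := by
    refine hRel_iff.2 ⟨h, ?_, ?_⟩
    · ext p x
      refine simplex_ext (p := dbl p.unop) fun i => ?_
      change pushBack (p := p.unop) (SSet.stdSimplex.asOrderHom x)
        (SSet.stdSimplex.asOrderHom.{u} (SSet.stdSimplex.const 1 0 p)) i =
          SSet.stdSimplex.asOrderHom x i
      induction i using dbl_cases with
      | h₁ i => rw [pushBack_front]; rfl
      | h₂ i => rw [pushBack_back]; exact if_pos rfl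
    · ext p x
      refine simplex_ext (p := dbl p.unop) fun i => ?_
      change pushBack (p := p.unop) (SSet.stdSimplex.asOrderHom x)
        (SSet.stdSimplex.asOrderHom.{u} (SSet.stdSimplex.const 1 1 p)) i =
          lastBack (p := p.unop) (SSet.stdSimplex.asOrderHom
            ((edgewiseFront.app (Δ[n] : SSet.{u})).app p x)) i
      induction i using dbl_cases with
      | h₁ i => rw [pushBack_front, lastBack_front]; rfl
      | h₂ i => rw [pushBack_back, lastBack_back]; exact if_neg (by
          change (1 : Fin 2) ≠ 0
          decide)
  exact .of_homotopyEquiv (g := s) ((IsWeakEquiv.id _).congr H) (by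
    rw [hs]
    exact .id _)

/-- The maps whose lifting properties encode the extension property. -/
inductive edgewiseGaps : MorphismProperty.{u} SSet.{u} where
  | mk {X Y : SSet.{u}} (p : X ⟶ Y) (hp : restrictionMaps p) : edgewiseGaps (edgewiseGap p)

theorem edgewiseGaps_llp_iff {i : A ⟶ B} : edgewiseGaps.llp i ↔
    ∀ {X Y : SSet.{u}} (p : X ⟶ Y), restrictionMaps p → edgewiseExtension p i := by
  constructor
  · intro h X Y p hp
    exact (edgewiseExtension_iff p i).2 (h _ ⟨p, hp⟩)
  · rintro h _ _ _ ⟨p, hp⟩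
    exact (edgewiseExtension_iff p i).1 (h p hp)

/-- Induction on `n`. The nondegenerate simplices of `∂Δ[n]` have dimension below `n`, so the
induction hypothesis shows that the front face of `∂Δ[n]` is a weak equivalence. For `Δ[n]` this is
explicit, and the two together give the extension property of the inclusion. -/
theorem edgewiseGaps_llp_boundary (n : ℕ) :
    edgewiseGaps.llp (∂Δ[n] : (Δ[n] : SSet.{u}).Subcomplex).ι := by
  induction n using Nat.strong_induction_on with
  | _ n ih =>
    rw [edgewiseGaps_llp_iff]
    intro X Y p hp
    refine edgewiseExtension_of_isWeakEquiv _ (isWeakEquiv_edgewiseFront_of_extension ?_)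
      (isWeakEquiv_edgewiseFront_stdSimplex n) hp
    rw [← edgewiseGaps_llp_iff]
    refine llp_of_cells _ fun d ⟨x, hx⟩ => ih d ?_
    have := SSet.stdSimplex.subcomplex_hasDimensionLT_of_neq_top _ (SSet.boundary_lt_top.{u} n).ne
    exact SSet.dim_lt_of_nonDegenerate _ ⟨x, hx⟩ n

/-- The front face is a weak equivalence from the edgewise subdivision. -/
theorem isWeakEquiv_edgewiseFront (S : SSet.{u}) : IsWeakEquiv (edgewiseFront.app S) := by
  refine isWeakEquiv_edgewiseFront_of_extension ?_
  rw [← edgewiseGaps_llp_iff]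
  exact llp_of_cells _ fun d _ => edgewiseGaps_llp_boundary d

end EdgewiseSubdivision

/-! ## Topological simplices -/

section TopSimplex

variable {p q : SimplexCategory}

/-- The value of an affine function on the topological simplex. -/
def affineVal (f : Fin (p.len + 1) → ℝ) (z : topSimplex p) : ℝ := ∑ i, f i * z i

theorem continuous_affineVal (f : Fin (p.len + 1) → ℝ) : Continuous (affineVal f) :=
  continuous_finsetSum _ fun i _ =>
    continuous_const.mul ((continuous_apply i).comp continuous_subtype_val)

theorem affineVal_sub (f g : Fin (p.len + 1) → ℝ) (z : topSimplex p) :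
    affineVal (fun i => f i - g i) z = affineVal f z - affineVal g z := by
  simp [affineVal, sub_mul]

theorem affineVal_add (f g : Fin (p.len + 1) → ℝ) (z : topSimplex p) :
    affineVal (fun i => f i + g i) z = affineVal f z + affineVal g z := by
  simp [affineVal, add_mul, Finset.sum_add_distrib]

theorem affineVal_mul (c : ℝ) (f : Fin (p.len + 1) → ℝ) (z : topSimplex p) :
    affineVal (fun i => c * f i) z = c * affineVal f z := by
  simp [affineVal, Finset.mul_sum, mul_assoc]

theorem affineVal_const (c : ℝ) (z : topSimplex p) : affineVal (fun _ => c) z = c := by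
  simp [affineVal, ← Finset.mul_sum]

theorem affineVal_single (i : Fin (p.len + 1)) (z : topSimplex p) :
    affineVal (fun j => if j = i then 1 else 0) z = z i := by
  simp [affineVal]

theorem affineVal_mono {f g : Fin (p.len + 1) → ℝ} (h : ∀ i, f i ≤ g i) (z : topSimplex p) :
    affineVal f z ≤ affineVal g z :=
  Finset.sum_le_sum fun i _ => mul_le_mul_of_nonneg_right (h i) (stdSimplex.zero_le z i)

theorem topSimplex_ext {z w : topSimplex p} (h : ∀ f, affineVal f z = affineVal f w) : z = w := by
  apply stdSimplex.ext
  funext i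
  rw [← affineVal_single i z, ← affineVal_single i w, h]

theorem affineVal_topSimplexMap (θ : q ⟶ p) (f : Fin (p.len + 1) → ℝ) (z : topSimplex q) :
    affineVal f (topSimplexMap θ z) = affineVal (fun i => f (θ.toOrderHom i)) z := by
  classical
  have e : ∀ j, topSimplexMap θ z j = ∑ i with θ.toOrderHom i = j, z i := fun j =>
    FunOnFinite.linearMap_apply_apply ℝ ℝ θ.toOrderHom z j
  simp only [affineVal, e, Finset.mul_sum]
  rw [← Finset.sum_fiberwise Finset.univ θ.toOrderHom]
  refine Finset.sum_congr rfl fun j _ => Finset.sum_congr rfl fun i hi => ?_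
  rw [(Finset.mem_filter.1 hi).2]

/-- Monotone functions on the vertices with values in the unit interval. -/
def IsThreshold (f : Fin (p.len + 1) → ℝ) : Prop := Monotone f ∧ ∀ i, 0 ≤ f i ∧ f i ≤ 1

/-- Sets on which the thresholds vary by at most `ε`. -/
def IsSmall (ε : ℝ) (B : Set (topSimplex p)) : Prop :=
  ∀ f, IsThreshold f → ∀ z ∈ B, ∀ w ∈ B, affineVal f z - affineVal f w ≤ ε

theorem IsSmall.mono {ε ε' : ℝ} (h : ε ≤ ε') {B : Set (topSimplex p)} (hB : IsSmall ε B) :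
    IsSmall ε' B := fun f hf z hz w hw => (hB f hf z hz w hw).trans h

theorem isSmall_one (B : Set (topSimplex p)) : IsSmall 1 B := by
  intro f hf z _ w _
  have h₁ := affineVal_mono (fun i => (hf.2 i).2) z
  have h₂ := affineVal_mono (fun i => (hf.2 i).1) w
  rw [affineVal_const] at h₁ h₂
  linarith

theorem IsSmall.image_map {ε : ℝ} {B : Set (topSimplex q)} (hB : IsSmall ε B) (θ : q ⟶ p) :
    IsSmall ε (topSimplexMap θ '' B) := by
  rintro f hf _ ⟨z, hz, rfl⟩ _ ⟨w, hw, rfl⟩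
  rw [affineVal_topSimplexMap, affineVal_topSimplexMap]
  exact hB _ ⟨hf.1.comp θ.toOrderHom.monotone, fun i => hf.2 _⟩ z hz w hw

/-- The coordinate `i` is the difference of the thresholds `i ≤ j` and `i < j`, each of which varies
by at most `ε`. -/
theorem IsSmall.dist_le {ε : ℝ} {B : Set (topSimplex p)} (hB : IsSmall ε B) {z w : topSimplex p}
    (hz : z ∈ B) (hw : w ∈ B) : dist z w ≤ 2 * ε := by
  -- The zero threshold yields `0 ≤ ε`, needed for the bound on the sup distance.
  have h₀ := hB (fun _ => 0) ⟨monotone_const, fun _ => ⟨le_rfl, zero_le_one⟩⟩ z hz w hw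
  rw [affineVal_const, affineVal_const, sub_zero] at h₀
  have key : ∀ z ∈ B, ∀ w ∈ B, ∀ i, z i - w i ≤ 2 * ε := by
    intro z hz w hw i
    have h₁ := hB (fun j => if i ≤ j then 1 else 0) ⟨fun a b hab => by
      dsimp only
      split_ifs with h₁ h₂ <;> norm_num
      exact h₂ (h₁.trans hab), fun j => by dsimp only; split_ifs <;> norm_num⟩ z hz w hw
    have h₂ := hB (fun j => if i < j then 1 else 0) ⟨fun a b hab => by
      dsimp only
      split_ifs with h₁ h₂ <;> norm_num
      exact h₂ (h₁.trans_le hab), fun j => by dsimp only; split_ifs <;> norm_num⟩ w hw z hz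
    have e : (fun j => if j = i then (1 : ℝ) else 0) =
        fun j => (if i ≤ j then 1 else 0) - (if i < j then 1 else 0) := by
      funext j
      rcases lt_trichotomy i j with h | h | h
      · simp [h, h.le, h.ne']
      · simp [h]
      · simp [h.not_ge, h.ne, h.not_gt]
    rw [← affineVal_single i z, ← affineVal_single i w, e, affineVal_sub, affineVal_sub]
    linarith
  rw [Subtype.dist_eq]
  refine (dist_pi_le_iff (by linarith)).2 fun i => ?_
  rw [Real.dist_eq, abs_le]
  have h₁ := key z hz w hw i
  have h₂ := key w hw z hz i
  exact ⟨by linarith!, by linarith!⟩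

/-- The weight of the back copy of a vertex. -/
def backWeight (α : Fin (p.len + 1) →o Fin 2) (i : Fin (p.len + 1)) : ℝ :=
  if α i = 0 then 0 else 1 / 2

theorem backWeight_mono (α : Fin (p.len + 1) →o Fin 2) : Monotone (backWeight α) := by
  intro i j h
  have := α.monotone h
  unfold backWeight
  by_cases h₂ : α j = 0
  · rw [h₂] at this
    rw [if_pos h₂, if_pos (Fin.le_zero_iff.1 this)]
  · rw [if_neg h₂]
    split_ifs <;> norm_num

theorem backWeight_mem (α : Fin (p.len + 1) →o Fin 2) (i : Fin (p.len + 1)) :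
    0 ≤ backWeight α i ∧ backWeight α i ≤ 1 / 2 := by
  unfold backWeight
  split_ifs <;> norm_num

theorem dbl_sum (f : Fin ((dbl p).len + 1) → ℝ) :
    ∑ i, f i = ∑ i, f (front i) + ∑ i, f (back i) :=
  Fin.sum_univ_add (a := p.len + 1) (b := p.len + 1) f

/-- The affine map of topological simplices underlying edgewise subdivision. -/
def subdivide (α : Fin (p.len + 1) →o Fin 2) (z : topSimplex p) : topSimplex (dbl p) :=
  ⟨dblElim (fun i => z i * (1 - backWeight α i)) (fun i => z i * backWeight α i), fun i => by
    have h := fun j => backWeight_mem α j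
    induction i using dbl_cases with
    | h₁ i =>
      rw [dblElim_front]
      exact mul_nonneg (stdSimplex.zero_le z i) (by linarith [(h i).2])
    | h₂ i =>
      rw [dblElim_back]
      exact mul_nonneg (stdSimplex.zero_le z i) (h i).1, by
    rw [dbl_sum]
    simp only [dblElim_front, dblElim_back]
    rw [← Finset.sum_add_distrib]
    refine Eq.trans (Finset.sum_congr rfl fun i _ => ?_) (stdSimplex.sum_eq_one z)
    ring⟩

theorem subdivide_front (α : Fin (p.len + 1) →o Fin 2) (z : topSimplex p) (i : Fin (p.len + 1)) :
    subdivide α z (front i) = z i * (1 - backWeight α i) :=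
  dblElim_front (fun i => z i * (1 - backWeight α i)) (fun i => z i * backWeight α i) i

theorem subdivide_back (α : Fin (p.len + 1) →o Fin 2) (z : topSimplex p) (i : Fin (p.len + 1)) :
    subdivide α z (back i) = z i * backWeight α i :=
  dblElim_back (fun i => z i * (1 - backWeight α i)) (fun i => z i * backWeight α i) i

theorem continuous_subdivide (α : Fin (p.len + 1) →o Fin 2) : Continuous (subdivide α) := by
  refine Continuous.subtype_mk (continuous_pi fun i => ?_) _
  have h : ∀ i, Continuous fun z : topSimplex p => z i := fun i =>
    (continuous_apply i).comp continuous_subtype_val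
  induction i using dbl_cases with
  | h₁ i =>
    simp only [dblElim_front]
    exact (h i).mul continuous_const
  | h₂ i =>
    simp only [dblElim_back]
    exact (h i).mul continuous_const

theorem affineVal_subdivide (α : Fin (p.len + 1) →o Fin 2) (f : Fin ((dbl p).len + 1) → ℝ)
    (z : topSimplex p) : affineVal f (subdivide α z) =
      affineVal (fun i => f (front i) * (1 - backWeight α i) + f (back i) * backWeight α i) z := by
  unfold affineVal
  rw [dbl_sum, ← Finset.sum_add_distrib]
  refine Finset.sum_congr rfl fun i _ => ?_
  rw [subdivide_front, subdivide_back]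
  ring

theorem subdivide_map (α : Fin (p.len + 1) →o Fin 2) (θ : q ⟶ p) (z : topSimplex q) :
    topSimplexMap (dblFunctor.map θ) (subdivide (α.comp θ.toOrderHom) z) =
      subdivide α (topSimplexMap θ z) := by
  refine topSimplex_ext fun f => ?_
  refine (affineVal_topSimplexMap (p := dbl p) (q := dbl q) (dblFunctor.map θ) f _).trans ?_
  refine (affineVal_subdivide _ _ z).trans (Eq.trans ?_ (affineVal_subdivide α f _).symm)
  rw [affineVal_topSimplexMap]
  congr 1
  funext i
  have h₁ : (dblFunctor.map θ).toOrderHom (front i) = front (θ.toOrderHom i) :=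
    dblHom_front (p := q) (q := p) θ.toOrderHom i
  have h₂ : (dblFunctor.map θ).toOrderHom (back i) = back (θ.toOrderHom i) :=
    dblHom_back (p := q) (q := p) θ.toOrderHom i
  exact congrArg₂ (· + ·) (congrArg (· * _) (congrArg f h₁)) (congrArg (· * _) (congrArg f h₂))

theorem subdivide_zero (α : Fin (p.len + 1) →o Fin 2) (hα : ∀ i, α i = 0) (z : topSimplex p) :
    subdivide α z = topSimplexMap (dblFront.app p) z := by
  refine topSimplex_ext fun f => ?_
  refine Eq.trans ?_ (affineVal_topSimplexMap (p := dbl p) (dblFront.app p) f z).symm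
  rw [affineVal_subdivide]
  congr 1
  funext i
  rw [backWeight, if_pos (hα i)]
  change f (front i) * (1 - 0) + f (back i) * 0 = f (front i)
  ring

/-- Pulling back a threshold gives a threshold: each vertex receives a mean of its front value and
its larger back value, and the weight of the latter increases with the vertex. -/
theorem IsSmall.image_subdivide {ε : ℝ} {B : Set (topSimplex p)} (hB : IsSmall ε B)
    (α : Fin (p.len + 1) →o Fin 2) : IsSmall ε (subdivide α '' B) := by
  rintro f hf _ ⟨z, hz, rfl⟩ _ ⟨w, hw, rfl⟩
  rw [affineVal_subdivide, affineVal_subdivide]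
  have hα := backWeight_mem α
  refine hB _ ⟨fun i j h => ?_, fun i => ⟨?_, ?_⟩⟩ z hz w hw
  · have h₁ := hf.1 (front_le_front.2 h)
    have h₂ := hf.1 (back_le_back.2 h)
    have h₃ := hf.1 (front_le_back j j)
    have h₄ := backWeight_mono α h
    nlinarith [hα i, hα j, mul_nonneg (sub_nonneg.2 h₁) (by linarith [hα i] : 0 ≤ 1 - backWeight α i),
      mul_nonneg (sub_nonneg.2 h₂) (hα i).1, mul_nonneg (sub_nonneg.2 h₃) (sub_nonneg.2 h₄)]
  · exact add_nonneg (mul_nonneg (hf.2 _).1 (by linarith [hα i])) (mul_nonneg (hf.2 _).1 (hα i).1)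
  · nlinarith [hα i, hf.2 (front i), hf.2 (back i)]

/-- The pullback of `f` is the mean of its front and back halves. With `c` the last front value, the
front values are at most `c` and the back values at least `c`, so the sum of the two halves minus
`c` is again a threshold. Hence variation is halved. This uses monotonicity of `f`, which is why
smallness is tested on monotone functions only. -/
theorem IsSmall.image_midpoint {ε : ℝ} {B : Set (topSimplex p)} (hB : IsSmall ε B)
    (α : Fin (p.len + 1) →o Fin 2) (hα : ∀ i, α i ≠ 0) : IsSmall (ε / 2) (subdivide α '' B) := by
  rintro f hf _ ⟨z, hz, rfl⟩ _ ⟨w, hw, rfl⟩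
  rw [affineVal_subdivide, affineVal_subdivide]
  let c := f (front (Fin.last _))
  have e : (fun i => f (front i) * (1 - backWeight α i) + f (back i) * backWeight α i) =
      fun i => 1 / 2 * (f (front i) + (f (back i) - c)) + 1 / 2 * c := by
    funext i
    rw [backWeight, if_neg (hα i)]
    ring
  rw [e, affineVal_add, affineVal_add, affineVal_const, affineVal_const, affineVal_mul,
    affineVal_mul]
  have := hB (fun i => f (front i) + (f (back i) - c)) ⟨fun i j h => ?_, fun i => ⟨?_, ?_⟩⟩
    z hz w hw
  · linarith
  · have h₁ := hf.1 (front_le_front.2 h)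
    have h₂ := hf.1 (back_le_back.2 h)
    dsimp only
    linarith
  · have h₁ : c ≤ f (back i) := hf.1 (front_le_back _ _)
    linarith [(hf.2 (front i)).1]
  · have h₁ : f (front i) ≤ c := hf.1 (front_le_front.2 (Fin.le_last _))
    linarith [(hf.2 (back i)).2]

end TopSimplex

/-! ## Small simplices -/

section SmallSimplices

open scoped NNReal

/-- A family of simplicial spaces with compatible actions of the additive monoid of nonnegative
real numbers. -/
structure ShrinkSystem where
  Idx : Type u
  space : Idx → SimplexCategory → Type u
  [top : ∀ l p, TopologicalSpace (space l p)]
  map : ∀ {l p q}, (q ⟶ p) → space l p → space l q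
  continuous_map : ∀ {l p q} (α : q ⟶ p), Continuous (map α : space l p → space l q)
  map_id : ∀ {l p} (x : space l p), map (𝟙 p) x = x
  map_comp : ∀ {l p q r} (α : q ⟶ p) (β : r ⟶ q) (x : space l p),
    map (β ⨟ α) x = map β (map α x)
  shrink : ∀ {l p}, ℝ≥0 → space l p → space l p
  continuous_shrink : ∀ {l p}, Continuous fun x : ℝ≥0 × space l p => shrink x.1 x.2
  shrink_zero : ∀ {l p} (x : space l p), shrink 0 x = x
  shrink_add : ∀ {l p} (s t : ℝ≥0) (x : space l p), shrink (s + t) x = shrink s (shrink t x)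
  map_shrink : ∀ {l p q} (α : q ⟶ p) (s : ℝ≥0) (x : space l p),
    map α (shrink s x) = shrink s (map α x)

namespace ShrinkSystem

attribute [instance] ShrinkSystem.top

variable (G : ShrinkSystem.{u})

/-- The simplices of the diagonal of the singular simplicial sets of the spaces in the system. -/
abbrev Simplex (p : SimplexCategory) : Type u := Σ l : G.Idx, C(topSimplex p, G.space l p)

variable {G} in
/-- The simplicial operators. -/
def mapSimplex {p q : SimplexCategory} (α : q ⟶ p) (x : G.Simplex p) : G.Simplex q :=
  ⟨x.1, ⟨fun z => G.map α (x.2 (topSimplexMap α z)), (G.continuous_map α).comp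
    (x.2.continuous.comp (topSimplexMap α).continuous)⟩⟩

variable {G} in
theorem mapSimplex_id {p : SimplexCategory} (x : G.Simplex p) : mapSimplex (𝟙 p) x = x :=
  Sigma.ext rfl (heq_of_eq (ContinuousMap.ext fun z =>
    (G.map_id _).trans (congrArg x.2 (topSimplexMap_id z))))

variable {G} in
theorem mapSimplex_comp {p q r : SimplexCategory} (α : q ⟶ p) (β : r ⟶ q) (x : G.Simplex p) :
    mapSimplex (β ⨟ α) x = mapSimplex β (mapSimplex α x) :=
  Sigma.ext rfl (heq_of_eq (ContinuousMap.ext fun z => (G.map_comp _ _ _).trans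
    (congrArg (fun y => G.map β (G.map α (x.2 y))) (topSimplexMap_comp α β z))))

/-- The diagonal of the singular simplicial sets of the spaces in the system. -/
def sing : SSet.{u} where
  obj p := G.Simplex p.unop
  map α := ↾(mapSimplex α.unop)
  map_id _ := ConcreteCategory.hom_ext _ _ fun x => mapSimplex_id x
  map_comp α β := ConcreteCategory.hom_ext _ _ fun x => mapSimplex_comp α.unop β.unop x

/-- A family of subspaces that are stable under the simplicial operators and under shrinking, such
that locally shrinking leads into one of the subspaces. -/
structure Cover (ι : Type v) where
  carrier : ι → ∀ l p, Set (G.space l p)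
  map_mem : ∀ {i l p q} (α : q ⟶ p) {x : G.space l p}, x ∈ carrier i l p →
    G.map α x ∈ carrier i l q
  shrink_mem : ∀ {i l p} (s : ℝ≥0) {x : G.space l p}, x ∈ carrier i l p →
    G.shrink s x ∈ carrier i l p
  eventually_mem : ∀ {l p} (x : G.space l p), ∃ i s, ∀ᶠ y in nhds x, G.shrink s y ∈ carrier i l p

variable {G} {ι : Type v} (W : G.Cover ι)

/-- The restrictions to sets of diameter at most `2⁻ᴺ` lie in a member of the cover after shrinking
by `N`. -/
def Small (N : ℕ) {p : SimplexCategory} (x : G.Simplex p) : Prop :=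
  ∀ B : Set (topSimplex p), IsSmall ((1 / 2) ^ N) B →
    ∃ i, ∀ z ∈ B, G.shrink N (x.2 z) ∈ W.carrier i x.1 p

variable {W} in
theorem Small.map {N : ℕ} {p q : SimplexCategory} {x : G.Simplex p} (hx : Small W N x)
    (θ : q ⟶ p) : Small W N (mapSimplex θ x) := by
  intro B hB
  obtain ⟨i, hi⟩ := hx _ (hB.image_map θ)
  refine ⟨i, fun z hz => ?_⟩
  have := W.map_mem θ (hi _ (Set.mem_image_of_mem _ hz))
  rw [G.map_shrink] at this
  exact this

variable {W} in
theorem Small.succ {N : ℕ} {p : SimplexCategory} {x : G.Simplex p} (hx : Small W N x) :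
    Small W (N + 1) x := by
  intro B hB
  obtain ⟨i, hi⟩ := hx B (hB.mono (pow_le_pow_of_le_one (by norm_num) (by norm_num) N.le_succ))
  refine ⟨i, fun z hz => ?_⟩
  have := W.shrink_mem 1 (hi z hz)
  rw [← G.shrink_add] at this
  rwa [Nat.cast_succ, add_comm (N : ℝ≥0)]

/-- The subcomplex of small simplices. -/
def small (N : ℕ) : G.sing.Subcomplex where
  obj _ := {x | Small W N x}
  map θ _ hx := hx.map θ.unop

theorem small_le_succ (N : ℕ) : small W N ≤ small W (N + 1) := fun _ _ hx => Small.succ hx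

/-- The amount by which the subdivided simplices are shrunk. -/
def weight {p : SimplexCategory} (α : Fin (p.len + 1) →o Fin 2) (z : topSimplex p) : ℝ≥0 :=
  (affineVal (fun i => if α i = 0 then 0 else 1) z).toNNReal

theorem continuous_weight {p : SimplexCategory} (α : Fin (p.len + 1) →o Fin 2) :
    Continuous (weight α) := continuous_real_toNNReal.comp (continuous_affineVal _)

theorem weight_map {p q : SimplexCategory} (α : Fin (p.len + 1) →o Fin 2) (θ : q ⟶ p)
    (z : topSimplex q) : weight (α.comp θ.toOrderHom) z = weight α (topSimplexMap θ z) := by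
  rw [weight, weight, affineVal_topSimplexMap]
  rfl

theorem weight_zero {p : SimplexCategory} (α : Fin (p.len + 1) →o Fin 2) (hα : ∀ i, α i = 0)
    (z : topSimplex p) : weight α z = 0 := by
  have : (fun i => if α i = 0 then (0 : ℝ) else 1) = fun _ => 0 := funext fun i => if_pos (hα i)
  rw [weight, this, affineVal_const, Real.toNNReal_zero]

theorem weight_one {p : SimplexCategory} (α : Fin (p.len + 1) →o Fin 2) (hα : ∀ i, α i ≠ 0)
    (z : topSimplex p) : weight α z = 1 := by
  have : (fun i => if α i = 0 then (0 : ℝ) else 1) = fun _ => 1 := funext fun i => if_neg (hα i)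
  rw [weight, this, affineVal_const, Real.toNNReal_one]

/-- The inclusion of the front face. -/
def frontHom (p : SimplexCategory) : p ⟶ dbl p := dblFront.app p

/-- The functoriality of the join. -/
def dblMap {p q : SimplexCategory} (θ : q ⟶ p) : dbl q ⟶ dbl p := dblFunctor.map θ

theorem frontHom_dblMap {p q : SimplexCategory} (θ : q ⟶ p) :
    frontHom q ⨟ dblMap θ = θ ⨟ frontHom p := (dblFront.naturality θ).symm

/-- A stage of the deformation of the subdivided simplices. -/
def deform {p : SimplexCategory} (α : Fin (p.len + 1) →o Fin 2) (x : G.Simplex (dbl p)) :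
    G.Simplex p :=
  ⟨x.1, ⟨fun z => G.shrink (weight α z) (G.map (frontHom p) (x.2 (subdivide α z))),
    G.continuous_shrink.comp ((continuous_weight α).prodMk ((G.continuous_map _).comp
      (x.2.continuous.comp (continuous_subdivide α))))⟩⟩

theorem deform_map {p q : SimplexCategory} (α : Fin (p.len + 1) →o Fin 2) (θ : q ⟶ p)
    (x : G.Simplex (dbl p)) :
    deform (α.comp θ.toOrderHom) (mapSimplex (dblMap θ) x) = mapSimplex θ (deform α x) := by
  refine Sigma.ext rfl (heq_of_eq (ContinuousMap.ext fun z => ?_))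
  change G.shrink (weight (α.comp θ.toOrderHom) z) (G.map (frontHom q)
    (G.map (dblMap θ) (x.2 (topSimplexMap (dblMap θ) (subdivide (α.comp θ.toOrderHom) z))))) =
    G.map θ (G.shrink (weight α (topSimplexMap θ z)) (G.map (frontHom p)
      (x.2 (subdivide α (topSimplexMap θ z)))))
  have e : topSimplexMap (dblMap θ) (subdivide (α.comp θ.toOrderHom) z) =
    subdivide α (topSimplexMap θ z) := subdivide_map α θ z
  rw [weight_map, G.map_shrink, e, ← G.map_comp, ← G.map_comp, frontHom_dblMap]

theorem deform_zero {p : SimplexCategory} (α : Fin (p.len + 1) →o Fin 2) (hα : ∀ i, α i = 0)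
    (x : G.Simplex (dbl p)) : deform α x = mapSimplex (frontHom p) x := by
  refine Sigma.ext rfl (heq_of_eq (ContinuousMap.ext fun z => ?_))
  change G.shrink (weight α z) (G.map (frontHom p) (x.2 (subdivide α z))) =
    G.map (frontHom p) (x.2 (topSimplexMap (frontHom p) z))
  rw [weight_zero α hα, G.shrink_zero, subdivide_zero α hα]
  rfl

variable {W} in
-- Every stage of the deformation respects smallness: subdividing does not increase the size of
-- sets, and the additional shrinking preserves each member of the cover.
theorem Small.deform {p : SimplexCategory} (α : Fin (p.len + 1) →o Fin 2) {N : ℕ}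
    {x : G.Simplex (dbl p)} (hx : Small W N x) : Small W N (deform α x) := by
  intro B hB
  obtain ⟨i, hi⟩ := hx _ (hB.image_subdivide α)
  refine ⟨i, fun z hz => ?_⟩
  have := W.shrink_mem (weight α z) (W.map_mem (frontHom p) (hi _ (Set.mem_image_of_mem _ hz)))
  rw [G.map_shrink, ← G.shrink_add, add_comm (weight α z), G.shrink_add] at this
  exact this

variable {W} in
-- At the end of the deformation sets have been halved and one unit of shrinking has been performed,
-- so a unit of `N` is used up.
theorem Small.deform_one {p : SimplexCategory} (α : Fin (p.len + 1) →o Fin 2) (hα : ∀ i, α i ≠ 0)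
    {N : ℕ} {x : G.Simplex (dbl p)} (hx : Small W (N + 1) x) : Small W N (ShrinkSystem.deform α x) := by
  intro B hB
  obtain ⟨i, hi⟩ := hx (subdivide α '' B) (by
    have := hB.image_midpoint α hα
    rwa [pow_succ, mul_one_div])
  refine ⟨i, fun z hz => ?_⟩
  have := W.map_mem (frontHom p) (hi _ (Set.mem_image_of_mem _ hz))
  rw [G.map_shrink, Nat.cast_succ, G.shrink_add] at this
  change G.shrink N (G.shrink (weight α z) _) ∈ _
  rw [weight_one α hα]
  exact this

/-- The deformation, on the small simplices. -/
def smallHomotopy (N : ℕ) : edgewise.obj (small W N).toSSet ⊗ Δ[1] ⟶ (small W N).toSSet where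
  app p := ↾(fun x : (edgewise.obj (small W N).toSSet ⊗ Δ[1]).obj p =>
    ⟨deform (p := p.unop) (SSet.stdSimplex.asOrderHom.{u} x.2) x.1.1, x.1.2.deform _⟩)
  naturality p _ θ := ConcreteCategory.hom_ext _ _ fun x => Subtype.ext
    (deform_map (p := p.unop) (SSet.stdSimplex.asOrderHom.{u} x.2) θ.unop x.1.1)

/-- The end of the deformation. -/
def smallRetraction (N : ℕ) : edgewise.obj (small W (N + 1)).toSSet ⟶ (small W N).toSSet where
  app p := ↾(fun x : (edgewise.obj (small W (N + 1)).toSSet).obj p =>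
    ⟨deform (p := p.unop) (SSet.stdSimplex.asOrderHom.{u} (SSet.stdSimplex.const 1 1 p)) x.1,
      Small.deform_one (SSet.stdSimplex.asOrderHom.{u} (SSet.stdSimplex.const 1 1 p)) (fun i => by
        change (1 : Fin 2) ≠ 0
        decide) x.2⟩)
  naturality p q θ := ConcreteCategory.hom_ext _ _ fun x => Subtype.ext
    (deform_map (p := p.unop) (SSet.stdSimplex.asOrderHom.{u} (SSet.stdSimplex.const 1 1 p))
      θ.unop x.1)

/-- The deformation starts at the front face, which is a weak equivalence, so its end is one too. -/
theorem isWeakEquiv_smallHomotopy_one (N : ℕ) :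
    IsWeakEquiv (SSet.ι₁ ⨟ smallHomotopy W N) := by
  have h : edgewiseFront.app (small W N).toSSet = SSet.ι₀ ⨟ smallHomotopy W N := by
    ext p x
    exact Subtype.ext (deform_zero (p := p.unop) (SSet.stdSimplex.asOrderHom.{u}
      (SSet.stdSimplex.const 1 0 p)) (fun _ => rfl) x.1).symm
  refine (isWeakEquiv_edgewiseFront _).congr ?_
  rw [h]
  exact hRel_iff.2 ⟨_, rfl, rfl⟩

/-- The end of the deformation on `small (N + 1)` factors through `small N`. Composing this
factorization with the inclusion on either side gives the ends of the deformations for `N` and `N +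
1`. Two-out-of-six makes the factorization an equivalence, and then the inclusion is one. -/
theorem acyclic_small_succ (N : ℕ) :
    acyclic (SSet.Subcomplex.homOfLE (small_le_succ W N)) := by
  refine acyclic_iff.2 ?_
  have h₁ : edgewise.map (SSet.Subcomplex.homOfLE (small_le_succ W N)) ⨟ smallRetraction W N =
    SSet.ι₁ ⨟ smallHomotopy W N := rfl
  have h₂ : smallRetraction W N ⨟ SSet.Subcomplex.homOfLE (small_le_succ W N) =
    SSet.ι₁ ⨟ smallHomotopy W (N + 1) := rfl
  have h₃ := isWeakEquiv_smallHomotopy_one W N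
  have h₄ := isWeakEquiv_smallHomotopy_one W (N + 1)
  rw [← h₁] at h₃
  rw [← h₂] at h₄
  exact .of_comp_left (.two_of_six h₃ h₄) h₄

theorem small_mono {N N' : ℕ} (h : N ≤ N') : small W N ≤ small W N' :=
  monotone_nat_of_le_succ (small_le_succ W) h

/-- Finitely many open sets, on each of which a fixed amount of shrinking leads into one member,
cover the compact simplex. A Lebesgue number bounds the required fineness, and the maximum of the
amounts bounds the required shrinking; shrinking more does no harm. -/
theorem exists_mem_small {p : SimplexCategoryᵒᵖ} (x : G.sing.obj p) :
    ∃ N, x ∈ (small W N).obj p := by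
  obtain ⟨l, τ⟩ := x
  choose i s h using fun z => W.eventually_mem (τ z)
  have h' : ∀ z, ∀ᶠ w in nhds z, G.shrink (s z) (τ w) ∈ W.carrier (i z) l p.unop :=
    fun z => τ.continuous.continuousAt.eventually (h z)
  choose V hV hVo hzV using fun z => eventually_nhds_iff.1 (h' z)
  obtain ⟨t, ht⟩ := isCompact_univ.elim_finite_subcover V hVo fun z _ =>
    Set.mem_iUnion.2 ⟨z, hzV z⟩
  obtain ⟨δ, hδ, hball⟩ := lebesgue_number_lemma_of_metric isCompact_univ
    (c := fun z : t => V z) (fun z => hVo z) (by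
      intro z hz
      obtain ⟨y, hy, hzy⟩ := Set.mem_iUnion₂.1 (ht hz)
      exact Set.mem_iUnion.2 ⟨⟨y, hy⟩, hzy⟩)
  obtain ⟨N₁, hN₁⟩ := exists_pow_lt_of_lt_one (half_pos hδ) (by norm_num : (1 / 2 : ℝ) < 1)
  obtain ⟨N₂, hN₂⟩ := exists_nat_ge (t.sup s)
  refine ⟨max N₁ N₂, fun B hB => ?_⟩
  rcases B.eq_empty_or_nonempty with rfl | ⟨w, hw⟩
  -- The empty set still needs some index, obtained from any point of the simplex.
  · obtain ⟨i, _⟩ := W.eventually_mem (τ (stdSimplex.vertex 0))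
    exact ⟨i, fun z hz => hz.elim⟩
  obtain ⟨⟨y, hy⟩, hby⟩ := hball w trivial
  refine ⟨i y, fun z hz => ?_⟩
  have hz' : z ∈ V y := hby (by
    have h₁ := hB.dist_le hz hw
    have h₂ : ((1 : ℝ) / 2) ^ max N₁ N₂ ≤ (1 / 2) ^ N₁ :=
      pow_le_pow_of_le_one (by norm_num) (by norm_num) (le_max_left _ _)
    rw [Metric.mem_ball]
    linarith)
  have hs : s y ≤ (max N₁ N₂ : ℕ) := (Finset.le_sup hy).trans (hN₂.trans (by
    exact_mod_cast le_max_right N₁ N₂))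
  have := W.shrink_mem ((max N₁ N₂ : ℕ) - s y) (hV y z hz')
  rw [← G.shrink_add, tsub_add_cancel_of_le hs] at this
  exact this

theorem isWeakEquiv_small_zero_ι : IsWeakEquiv (small W 0).ι := by
  -- The filtration is indexed by `ℕ∞` to have a complete lattice; the stage at `⊤` is the union of
  -- all `small N`.
  let Θ : ℕ∞ → G.sing.Subcomplex := fun a =>
    { obj p := {x | ∃ N : ℕ, (N : ℕ∞) ≤ a ∧ x ∈ (small W N).obj p}
      map θ _ := fun ⟨N, h, hx⟩ => ⟨N, h, (small W N).map θ hx⟩ }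
  have hΘ : Monotone Θ := fun a b h p x ⟨N, hN, hx⟩ => ⟨N, hN.trans h, hx⟩
  have hnat : ∀ N : ℕ, Θ N = small W N := fun N => le_antisymm
    (fun p x ⟨N', hN', hx⟩ => small_mono W (by exact_mod_cast hN') _ hx)
    (fun p x hx => ⟨N, le_rfl, hx⟩)
  have htop : Θ ⊤ = ⊤ := by
    refine top_le_iff.1 fun p x _ => ?_
    obtain ⟨N, hN⟩ := exists_mem_small W x
    exact ⟨N, le_top, hN⟩
  have key := acyclic_of_chain Θ hΘ (fun c hc hc' p x ⟨N, hN, hx⟩ => by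
      rcases N with - | N
      · exact ⟨_, hc.some_mem, 0, by simp, hx⟩
      -- Some member of the chain exceeds `N`, hence is at least `N + 1`: the stage is reached
      -- before the supremum.
      · obtain ⟨a, ha, hNa⟩ := lt_sSup_iff.1 (lt_of_lt_of_le
          (by exact_mod_cast N.lt_succ_self : (N : ℕ∞) < (N + 1 : ℕ)) hN)
        exact ⟨a, ha, N + 1, by
          have := Order.add_one_le_of_lt hNa
          exact_mod_cast this, hx⟩) (fun C hC => by
    lift C to ℕ using hC
    refine ⟨(C + 1 : ℕ), by exact_mod_cast C.lt_succ_self, ?_⟩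
    have : ∀ (U V : G.sing.Subcomplex) (hUV : U ≤ V), U = small W C → V = small W (C + 1) →
        acyclic (SSet.Subcomplex.homOfLE hUV) := by
      rintro _ _ _ rfl rfl
      exact acyclic_small_succ W C
    exact this _ _ _ (hnat C) (hnat (C + 1)))
  have : ∀ (U V : G.sing.Subcomplex) (hUV : U ≤ V), U = small W 0 → V = ⊤ →
      acyclic (SSet.Subcomplex.homOfLE hUV) → IsWeakEquiv (small W 0).ι := by
    rintro _ _ _ rfl rfl h
    exact (h.isWeakEquiv.comp (.of_isIso (SSet.Subcomplex.topIso G.sing).hom) :)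
  exact this _ _ _ (hnat 0) htop key

end ShrinkSystem

end SmallSimplices

/-! ## Iterated tangent bundles -/

section IteratedTangent

open ModelledMfd

/-- The differentials in the direction of `X` again form a smooth family: they are the differential
of the total map on vectors with zero component along `ℝ`. Iterating gives joint continuity of all
iterated differentials, hence continuity of a smooth family in the weak `C^∞` topology. -/
theorem continuous_iterTangentSmooth_of_family (j : ℕ) :
    ∀ {X : ModelledMfd.{u}} {Y : ModelledMfd.{v}} (F : ℝ → X.Smooth Y),
      ContMDiff (𝓘(ℝ, ℝ).prod X.I) Y.I ∞ (fun x : ℝ × X.carrier => F x.1 x.2) →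
      Continuous fun x : ℝ × (iterTangent j X).carrier => iterTangentSmooth j (F x.1) x.2 := by
  induction j with
  | zero => exact fun F hF => hF.continuous
  | succ j ih =>
    intro X Y F hF
    refine ih (X := X.tangent) (Y := Y.tangent) (fun t => tangentSmooth (F t)) ?_
    have h₁ : ContMDiff (𝓘(ℝ, ℝ).prod X.I).tangent Y.I.tangent ∞
        (tangentMap (𝓘(ℝ, ℝ).prod X.I) Y.I (fun x : ℝ × X.carrier => F x.1 x.2)) :=
      hF.contMDiff_tangentMap (by simp)
    have h₂ : ContMDiff 𝓘(ℝ, ℝ) 𝓘(ℝ, ℝ).tangent ∞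
        (fun t : ℝ => (⟨t, 0⟩ : TangentBundle 𝓘(ℝ, ℝ) ℝ)) :=
      Bundle.contMDiff_zeroSection ℝ (TangentSpace 𝓘(ℝ, ℝ) : ℝ → Type _)
    have h₃ : ContMDiff (𝓘(ℝ, ℝ).prod X.I.tangent) (𝓘(ℝ, ℝ).tangent.prod X.I.tangent) ∞
        (fun x : ℝ × TangentBundle X.I X.carrier =>
          ((⟨x.1, 0⟩ : TangentBundle 𝓘(ℝ, ℝ) ℝ), x.2)) :=
      (h₂.comp contMDiff_fst).prodMk contMDiff_snd
    have h₄ := h₁.comp (contMDiff_equivTangentBundleProd_symm.comp h₃)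
    refine h₄.congr fun x => ?_
    have h₅ := tangentMap_comp_at (I := X.I) (I' := 𝓘(ℝ, ℝ).prod X.I) (I'' := Y.I)
      (f := fun y : X.carrier => (x.1, y)) (g := fun x : ℝ × X.carrier => F x.1 x.2) x.2
      (hF.mdifferentiable (by simp) _) (mdifferentiableAt_const.prodMk mdifferentiableAt_id)
    rw [tangentMap_prod_right] at h₅
    exact h₅

/-- The manifolds modelled on locally compact spaces. -/
def LocallyCompactModel (X : ModelledMfd.{u}) : Prop :=
  LocallyCompactSpace X.E ∧ LocallyCompactSpace X.H

theorem LocallyCompactModel.tangent {X : ModelledMfd.{u}} (h : LocallyCompactModel X) :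
    LocallyCompactModel X.tangent := by
  obtain ⟨h₁, h₂⟩ := h
  exact ⟨inferInstanceAs (LocallyCompactSpace (X.E × X.E)),
    inferInstanceAs (LocallyCompactSpace (X.H × X.E))⟩

theorem LocallyCompactModel.iterTangent (j : ℕ) : ∀ {X : ModelledMfd.{u}},
    LocallyCompactModel X → LocallyCompactSpace (iterTangent j X).carrier := by
  induction j with
  | zero =>
    intro X h
    have := h.2
    exact ChartedSpace.locallyCompactSpace X.H X.carrier
  | succ j ih => exact fun h => ih h.tangent

theorem tangentMap_congr_of_isOpen {X : ModelledMfd.{u}} {Y : ModelledMfd.{v}}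
    {f g : X.carrier → Y.carrier} {s : Set X.carrier} (hs : IsOpen s) (h : Set.EqOn f g s)
    {p : TangentBundle X.I X.carrier} (hp : p.1 ∈ s) (hf : MDifferentiableAt X.I Y.I f p.1) :
    tangentMap X.I Y.I f p = tangentMap X.I Y.I g p := by
  have hg : MDifferentiableAt X.I Y.I g p.1 :=
    hf.congr_of_eventuallyEq (Filter.eventually_of_mem (hs.mem_nhds hp) fun x hx => (h hx).symm)
  rw [← tangentMapWithin_eq_tangentMap (hs.uniqueMDiffWithinAt hp) hf,
    ← tangentMapWithin_eq_tangentMap (hs.uniqueMDiffWithinAt hp) hg]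
  exact tangentMapWithin_congr h p hp

theorem contMDiffOn_tangentMap {X : ModelledMfd.{u}} {Y : ModelledMfd.{v}}
    {f : X.carrier → Y.carrier} {s : Set X.carrier} (hs : IsOpen s)
    (hf : ContMDiffOn X.I Y.I ∞ f s) :
    ContMDiffOn X.I.tangent Y.I.tangent ∞ (tangentMap X.I Y.I f)
      (Bundle.TotalSpace.proj ⁻¹' s : Set (TangentBundle X.I X.carrier)) := by
  refine (hf.contMDiffOn_tangentMapWithin (m := ∞) (by simp) hs.uniqueMDiffOn).congr
    fun p hp => ?_
  exact (tangentMapWithin_eq_tangentMap (hs.uniqueMDiffWithinAt hp)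
    ((hf.contMDiffAt (hs.mem_nhds hp)).mdifferentiableAt (by simp))).symm

theorem tangentMap_leftInverse {X : ModelledMfd.{u}} {Y : ModelledMfd.{v}}
    {f : X.carrier → Y.carrier} {g : Y.carrier → X.carrier} {s : Set X.carrier} (hs : IsOpen s)
    (h : ∀ x ∈ s, g (f x) = x) {p : TangentBundle X.I X.carrier} (hp : p.1 ∈ s)
    (hf : MDifferentiableAt X.I Y.I f p.1) (hg : MDifferentiableAt Y.I X.I g (f p.1)) :
    tangentMap Y.I X.I g (tangentMap X.I Y.I f p) = p := by
  rw [← tangentMap_comp_at p hg hf,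
    tangentMap_congr_of_isOpen (X := X) (Y := X) (f := g ∘ f) hs (g := id) h hp
      (hg.comp p.1 hf), tangentMap_id]
  rfl

/-- By the chain rule, the differential of a local inverse is a local inverse of the differential.
-/
theorem isLocalDiffeomorph_tangentMap {X : ModelledMfd.{u}} {Y : ModelledMfd.{v}}
    {f : X.carrier → Y.carrier} (hf : IsLocalDiffeomorph X.I Y.I ∞ f) :
    IsLocalDiffeomorph X.I.tangent Y.I.tangent ∞ (tangentMap X.I Y.I f) := by
  intro v
  obtain ⟨Φ, hv, hΦ⟩ := hf v.1
  have h₁ : ∀ x ∈ Φ.source, MDifferentiableAt X.I Y.I Φ x := fun x hx =>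
    Φ.mdifferentiableAt (by simp) hx
  have h₂ : ∀ x ∈ Φ.target, MDifferentiableAt Y.I X.I Φ.symm x := fun x hx =>
    Φ.symm.mdifferentiableAt (by simp) hx
  have h₃ : ∀ x ∈ Φ.source, Φ.symm (Φ x) = x := fun x hx => Φ.left_inv' hx
  have h₄ : ∀ x ∈ Φ.target, Φ (Φ.symm x) = x := fun x hx => Φ.right_inv' hx
  exact ⟨{  toFun := tangentMap X.I Y.I Φ
            invFun := tangentMap Y.I X.I Φ.symm
            source := Bundle.TotalSpace.proj ⁻¹' Φ.source
            target := Bundle.TotalSpace.proj ⁻¹' Φ.target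
            map_source' := fun w hw => Φ.map_source' hw
            map_target' := fun w hw => Φ.map_target' hw
            left_inv' := fun w hw => tangentMap_leftInverse Φ.open_source h₃ hw (h₁ _ hw)
              (h₂ _ (Φ.map_source' hw))
            right_inv' := fun w hw => tangentMap_leftInverse (X := Y) (Y := X) Φ.open_target h₄ hw
              (h₂ _ hw) (h₁ _ (Φ.map_target' hw))
            open_source := Φ.open_source.preimage (FiberBundle.continuous_proj _ _)
            open_target := Φ.open_target.preimage (FiberBundle.continuous_proj _ _)
            contMDiffOn_toFun := contMDiffOn_tangentMap Φ.open_source Φ.contMDiffOn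
            contMDiffOn_invFun := contMDiffOn_tangentMap (X := Y) (Y := X) Φ.open_target
              Φ.symm.contMDiffOn }, hv,
    fun w hw => tangentMap_congr_of_isOpen Φ.open_source hΦ hw
      ((hf w.1).mdifferentiableAt (by simp))⟩

theorem tangentMap_injective {X : ModelledMfd.{u}} {Y : ModelledMfd.{v}}
    {f : X.carrier → Y.carrier} (hf : IsLocalDiffeomorph X.I Y.I ∞ f)
    (hinj : Function.Injective f) : Function.Injective (tangentMap X.I Y.I f) := by
  intro v w h
  have hvw : v.1 = w.1 := hinj (congrArg (fun z : TangentBundle Y.I Y.carrier => z.1) h)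
  obtain ⟨x, v⟩ := v
  obtain ⟨y, w⟩ := w
  obtain rfl : x = y := hvw
  have h' : mfderiv X.I Y.I f x v = mfderiv X.I Y.I f x w :=
    Bundle.TotalSpace.mk_inj.1 h
  have e := (hf x).mfderivToContinuousLinearEquiv_coe (by simp)
  rw [← e] at h'
  exact congrArg _ (((hf x).mfderivToContinuousLinearEquiv (by simp)).injective h')

/-- Taking differentials preserves injective local diffeomorphisms, and these are open embeddings.
Hence postcomposition will be inducing for the compact-open topology at every order. -/
theorem isOpenEmbedding_iterTangentCont (j : ℕ) :
    ∀ {X : ModelledMfd.{u}} {Y : ModelledMfd.{v}} (f : X.Smooth Y),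
      IsLocalDiffeomorph X.I Y.I ∞ f → Function.Injective f →
      Topology.IsOpenEmbedding (iterTangentCont j f) := by
  induction j with
  | zero =>
    intro X Y f hf hinj
    have h : Topology.IsOpenEmbedding f :=
      .of_continuous_injective_isOpenMap f.contMDiff.continuous hinj (hf.isOpenMap)
    exact h
  | succ j ih =>
    intro X Y f hf hinj
    exact ih (tangentSmooth f) (isLocalDiffeomorph_tangentMap hf) (tangentMap_injective hf hinj)

end IteratedTangent

/-! ## Spaces of embeddings -/

section Embeddings

open ModelledMfd

variable {m : ℕ}

namespace Man.Emb

theorem continuous_iterTangentCont {M : Man.{u} m} {N : Man.{v} m} (j : ℕ) :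
    Continuous fun f : Emb M N => iterTangentCont j f.toSmooth :=
  continuous_iInf_dom (i := j) continuous_induced_dom

theorem iterTangentCont_comp {M : Man.{u} m} {N : Man.{v} m} {P : Man.{w} m} (j : ℕ)
    (g : Emb N P) (f : Emb M N) : iterTangentCont j (g.comp f).toSmooth =
      (iterTangentCont j g.toSmooth).comp (iterTangentCont j f.toSmooth) :=
  ContinuousMap.ext fun x => congrArg (fun s => s x) (iterTangentSmooth_comp j g.toSmooth f.toSmooth)

/-- Composition of embeddings is jointly continuous. -/
theorem continuous_comp {M : Man.{u} m} {N : Man.{v} m} {P : Man.{w} m} :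
    Continuous fun x : Emb M N × Emb N P => x.2.comp x.1 := by
  refine continuous_iInf_rng.2 fun j => continuous_induced_rng.2 ?_
  -- Composition is jointly continuous in the compact-open topology when the middle space is locally
  -- compact.
  have : LocallyCompactSpace (iterTangent j N.toModelled).carrier :=
    LocallyCompactModel.iterTangent j ⟨inferInstanceAs (LocallyCompactSpace (EuclideanSpace ℝ _)),
      inferInstanceAs (LocallyCompactSpace (EuclideanSpace ℝ _))⟩
  refine (ContinuousMap.continuous_comp'.comp
    (((continuous_iterTangentCont j).comp continuous_fst).prodMk
      ((continuous_iterTangentCont j).comp continuous_snd))).congr fun x => ?_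
  exact (iterTangentCont_comp j x.2 x.1).symm

/-- Postcomposition with a fixed embedding is an inducing map. -/
theorem isInducing_comp_left {M : Man.{u} m} {N : Man.{v} m} {P : Man.{w} m} (g : Emb N P) :
    Topology.IsInducing fun f : Emb M N => g.comp f := by
  refine ⟨?_⟩
  change (⨅ j, _) = TopologicalSpace.induced _ (⨅ j, _)
  rw [induced_iInf]
  refine iInf_congr fun j => ?_
  rw [induced_compose]
  have h := (ContinuousMap.isInducing_postcomp (X := (iterTangent j M.toModelled).carrier)
    (iterTangentCont j g.toSmooth)
    (isOpenEmbedding_iterTangentCont j g.toSmooth g.isLocalDiffeomorph g.injective).isInducing).1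
  rw [h, induced_compose]
  congr 1
  funext f
  exact (iterTangentCont_comp j g f).symm

theorem continuous_apply {M : Man.{u} m} {N : Man.{v} m} (f : Emb M N) : Continuous f.toFun :=
  f.isLocalDiffeomorph.contMDiff.continuous

theorem isOpen_mapsTo {M : Man.{u} m} {N : Man.{v} m} {K : Set M.carrier} (hK : IsCompact K)
    {V : Set N.carrier} (hV : IsOpen V) : IsOpen (Set.ofPred fun f : Emb M N => Set.MapsTo f.toFun K V) :=
  (ContinuousMap.isOpen_setOfPred_mapsTo hK hV).preimage (continuous_iterTangentCont 0)

/-- Near a point, `h` is a local inverse of `g` applied to `g ∘ h`; continuity of `h` allows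
restricting to where it lands in the domain of that inverse's chart. -/
theorem isLocalDiffeomorph_of_comp {M : Man.{u} m} {N : Man.{v} m} {P : Man.{w} m} (g : Emb N P)
    {h : M.carrier → N.carrier} (hc : Continuous h)
    (hf : IsLocalDiffeomorph (𝓡 m) (𝓡 m) ∞ (g.toFun ∘ h)) :
    IsLocalDiffeomorph (𝓡 m) (𝓡 m) ∞ h := by
  intro x
  obtain ⟨Φ, hx, hΦ⟩ := g.isLocalDiffeomorph (h x)
  have h₁ : IsLocalDiffeomorphAt (𝓡 m) (𝓡 m) ∞ (Φ.symm ∘ (g.toFun ∘ h)) x := by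
    have hx' : g.toFun (h x) ∈ Φ.target := by
      rw [hΦ hx]
      exact Φ.map_source' hx
    exact IsLocalDiffeomorphAt.comp (hf := hf x)
      (hg := PartialDiffeomorph.isLocalDiffeomorphAt _ _ _ Φ.symm hx')
  obtain ⟨Ψ, hx', hΨ⟩ := h₁
  have ho : IsOpen (Ψ.source ∩ h ⁻¹' Φ.source) := Ψ.open_source.inter (Φ.open_source.preimage hc)
  let Ψ' := Ψ.toOpenPartialHomeomorph.restrOpen _ (Φ.open_source.preimage hc)
  refine ⟨{ toPartialEquiv := Ψ'.toPartialEquiv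
            open_source := Ψ'.open_source
            open_target := Ψ'.open_target
            contMDiffOn_toFun := Ψ.contMDiffOn.mono Set.inter_subset_left
            contMDiffOn_invFun := Ψ.symm.contMDiffOn.mono Set.inter_subset_left }, ⟨hx', hx⟩, ?_⟩
  rintro y ⟨hy, hy'⟩
  refine Eq.trans ?_ (hΨ hy)
  change h y = Φ.symm (g.toFun (h y))
  rw [hΦ hy']
  exact (Φ.left_inv' hy').symm

/-- The factorization of an embedding through another one. -/
theorem exists_comp_eq {M : Man.{u} m} {N : Man.{v} m} {P : Man.{w} m} (g : Emb N P)
    (f : Emb M P) (h : Set.range f.toFun ⊆ Set.range g.toFun) : ∃ f' : Emb M N, g.comp f' = f := by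
  choose f' hf' using fun x => h (Set.mem_range_self x)
  have hg : Topology.IsEmbedding g.toFun :=
    (Topology.IsOpenEmbedding.of_continuous_injective_isOpenMap g.continuous_apply g.injective
      g.isLocalDiffeomorph.isOpenMap).isEmbedding
  have e : g.toFun ∘ f' = f.toFun := funext hf'
  have hinj : Function.Injective (g.toFun ∘ f') := e ▸ f.injective
  refine ⟨⟨f', hinj.of_comp, isLocalDiffeomorph_of_comp g ?_ ?_⟩, Emb.ext e⟩
  · rw [hg.continuous_iff, e]
    exact f.continuous_apply
  · rw [e]
    exact f.isLocalDiffeomorph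

end Man.Emb

end Embeddings

/-! ## Shrinking patches -/

section Shrinking

open scoped NNReal

variable {m : ℕ}

/-- The radial contraction of Euclidean space onto a ball. -/
def radial (s : ℝ) (z : EuclideanSpace ℝ (Fin m)) : EuclideanSpace ℝ (Fin m) :=
  (√(1 + s * ‖z‖ ^ 2))⁻¹ • z

theorem radial_zero (z : EuclideanSpace ℝ (Fin m)) : radial 0 z = z := by
  simp [radial]

theorem norm_radial_sq {s : ℝ} {z : EuclideanSpace ℝ (Fin m)} (h : 0 < 1 + s * ‖z‖ ^ 2) :
    ‖radial s z‖ ^ 2 = ‖z‖ ^ 2 / (1 + s * ‖z‖ ^ 2) := by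
  rw [radial, norm_smul, mul_pow, norm_inv, Real.norm_of_nonneg (Real.sqrt_nonneg _), inv_pow,
    Real.sq_sqrt h.le, div_eq_inv_mul]

/-- Away from the origin, the contraction adds `s` to `‖z‖⁻²` and keeps the direction, whence the
additive law. Negative parameters are included, where defined, to provide the inverse. -/
theorem radial_radial {s t : ℝ} {z : EuclideanSpace ℝ (Fin m)} (h : 0 < 1 + t * ‖z‖ ^ 2) :
    radial s (radial t z) = radial (s + t) z := by
  have e : 1 + s * ‖radial t z‖ ^ 2 = (1 + (s + t) * ‖z‖ ^ 2) / (1 + t * ‖z‖ ^ 2) := by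
    rw [norm_radial_sq h, eq_div_iff h.ne', add_mul, mul_assoc, div_mul_cancel₀ _ h.ne']
    ring
  have h' : √(1 + t * ‖z‖ ^ 2) ≠ 0 := (Real.sqrt_pos.2 h).ne'
  rw [radial, e, Real.sqrt_div' _ h.le, radial, radial, smul_smul]
  congr 1
  field_simp

theorem contDiffOn_radial : ContDiffOn ℝ ∞
    (fun x : ℝ × EuclideanSpace ℝ (Fin m) => radial x.1 x.2) {x | 0 < 1 + x.1 * ‖x.2‖ ^ 2} := by
  intro x hx
  have h₁ : ContDiff ℝ ∞ fun x : ℝ × EuclideanSpace ℝ (Fin m) => 1 + x.1 * ‖x.2‖ ^ 2 :=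
    contDiff_const.add (contDiff_fst.mul (contDiff_snd.norm_sq ℝ))
  have h₂ : 0 < 1 + x.1 * ‖x.2‖ ^ 2 := hx
  exact (((h₁.contDiffAt.sqrt h₂.ne').inv (Real.sqrt_pos.2 h₂).ne').smul
    contDiff_snd.contDiffAt).contDiffWithinAt

theorem contDiffOn_radial_const (s : ℝ) : ContDiffOn ℝ ∞ (radial (m := m) s)
    {z | 0 < 1 + s * ‖z‖ ^ 2} :=
  contDiffOn_radial.comp (contDiff_const.prodMk contDiff_id).contDiffOn fun _ hz => hz

theorem one_add_pos {s : ℝ} (hs : 0 ≤ s) (z : EuclideanSpace ℝ (Fin m)) :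
    0 < 1 + s * ‖z‖ ^ 2 := by positivity

theorem one_sub_pos {s : ℝ} (hs : 0 ≤ s) (z : EuclideanSpace ℝ (Fin m)) :
    0 < 1 + -s * ‖radial s z‖ ^ 2 := by
  have h := one_add_pos hs z
  rw [norm_radial_sq h]
  have : 1 + -s * (‖z‖ ^ 2 / (1 + s * ‖z‖ ^ 2)) = 1 / (1 + s * ‖z‖ ^ 2) := by
    field_simp
    ring
  rw [this]
  positivity

/-- The radial contraction as an embedding. -/
def radialEmb (s : ℝ≥0) : Man.Emb (Man.euclid m) (Man.euclid m) where
  toFun := radial (s : ℝ)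
  injective := by
    intro (z : EuclideanSpace ℝ (Fin m)) (w : EuclideanSpace ℝ (Fin m)) h
    have h' := congrArg (radial (-(s : ℝ))) h
    rwa [radial_radial (one_add_pos s.coe_nonneg z), radial_radial (one_add_pos s.coe_nonneg w), neg_add_cancel,
      radial_zero, radial_zero] at h'
  isLocalDiffeomorph := by
    intro x
    have hopen : ∀ t : ℝ, IsOpen (Set.ofPred fun z : EuclideanSpace ℝ (Fin m) => 0 < 1 + t * ‖z‖ ^ 2) :=
      fun t => isOpen_lt continuous_const (by fun_prop)
    have h₂ : ∀ z : EuclideanSpace ℝ (Fin m), 0 < 1 + -(s : ℝ) * ‖z‖ ^ 2 →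
        radial (s : ℝ) (radial (-(s : ℝ)) z) = z := fun z hz => by
      rw [radial_radial hz, add_neg_cancel, radial_zero]
    exact ⟨{ toFun := radial (s : ℝ)
             -- The inverse has the opposite parameter and is defined where the expression under the
             -- root is positive.
             invFun := radial (-(s : ℝ))
             source := Set.univ
             target := Set.ofPred fun z : EuclideanSpace ℝ (Fin m) => 0 < 1 + -(s : ℝ) * ‖z‖ ^ 2
             map_source' := fun z _ => one_sub_pos s.coe_nonneg (m := m) z
             map_target' := fun _ _ => trivial
             left_inv' := fun (z : EuclideanSpace ℝ (Fin m)) _ => by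
               rw [radial_radial (one_add_pos s.coe_nonneg z), neg_add_cancel, radial_zero]
             right_inv' := fun z hz => h₂ z hz
             open_source := isOpen_univ
             open_target := hopen _
             contMDiffOn_toFun := ((contDiffOn_radial_const (s : ℝ)).mono
               fun z _ => one_add_pos s.coe_nonneg z).contMDiffOn
             contMDiffOn_invFun := (contDiffOn_radial_const (-(s : ℝ))).contMDiffOn },
      trivial, fun _ _ => rfl⟩

theorem radialEmb_apply (s : ℝ≥0) (z : EuclideanSpace ℝ (Fin m)) :
    (radialEmb s).toFun z = radial (s : ℝ) z := rfl

theorem radialEmb_radialEmb (s t : ℝ≥0) (z : (Man.euclid m).carrier) :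
    (radialEmb s).toFun ((radialEmb t).toFun z) = (radialEmb (s + t)).toFun z :=
  radial_radial (one_add_pos t.coe_nonneg z)

theorem radialEmb_zero (z : EuclideanSpace ℝ (Fin m)) : (radialEmb 0).toFun z = z :=
  radial_zero z

/-- The squared norm of the image is at most `1 / s`, whatever `z` is. -/
theorem norm_radial_le {s : ℝ≥0} {δ : ℝ} (hδ : 0 < δ) (hs : δ⁻¹ ^ 2 ≤ s)
    (z : EuclideanSpace ℝ (Fin m)) : ‖radial (s : ℝ) z‖ ≤ δ := by
  have h := one_add_pos s.coe_nonneg z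
  refine le_of_sq_le_sq ?_ hδ.le
  rw [norm_radial_sq h, div_le_iff₀ h]
  have : δ ^ 2 * δ⁻¹ ^ 2 = 1 := by
    field_simp
  have h' : (1 : ℝ) ≤ δ ^ 2 * s := this ▸ mul_le_mul_of_nonneg_left hs (sq_nonneg δ)
  nlinarith [sq_nonneg ‖z‖, sq_nonneg δ]

theorem norm_rotate (A : Matrix.orthogonalGroup (Fin m) ℝ) (z : EuclideanSpace ℝ (Fin m)) :
    ‖rotate A z‖ = ‖z‖ := by
  have h : (A : Matrix (Fin m) (Fin m) ℝ).transpose * A = 1 :=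
    (Matrix.mem_orthogonalGroup_iff' _ _).1 A.2
  have e : ∀ w : EuclideanSpace ℝ (Fin m), ‖w‖ ^ 2 = w.ofLp ⬝ᵥ w.ofLp := fun w => by
    rw [EuclideanSpace.real_norm_sq_eq, dotProduct]
    exact Finset.sum_congr rfl fun i _ => sq _
  refine (sq_eq_sq₀ (norm_nonneg _) (norm_nonneg _)).1 ?_
  rw [e, e]
  change (Matrix.mulVec A.1 z.ofLp) ⬝ᵥ (Matrix.mulVec A.1 z.ofLp) = _
  rw [Matrix.dotProduct_mulVec, Matrix.vecMul_mulVec, h, Matrix.vecMul_one]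

theorem rotate_smul (A : Matrix.orthogonalGroup (Fin m) ℝ) (c : ℝ)
    (z : EuclideanSpace ℝ (Fin m)) : rotate A (c • z) = c • rotate A z := by
  simp [rotate, Matrix.mulVec_smul]

/-- The contraction scales by a function of the norm, so it is equivariant and acts on homotopy
orbits. -/
theorem radialEmb_rotate (s : ℝ≥0) (A : Matrix.orthogonalGroup (Fin m) ℝ)
    (z : EuclideanSpace ℝ (Fin m)) :
    (radialEmb s).toFun (rotate A z) = rotate A ((radialEmb s).toFun z) := by
  rw [radialEmb_apply, radialEmb_apply, radial, radial, norm_rotate, rotate_smul]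

theorem rotate_zero (A : Matrix.orthogonalGroup (Fin m) ℝ) : rotate A 0 = 0 := by
  simp [rotate]

theorem continuous_radialEmb : Continuous (radialEmb (m := m)) := by
  refine continuous_iInf_rng.2 fun j => continuous_induced_rng.2 ?_
  -- The substitution `s = t ^ 2` extends the parameter to all of `ℝ`, giving a smooth family
  -- without boundary; continuity in `s` follows by inserting `t = √s`.
  let F : ℝ → (Man.euclid m).toModelled.Smooth (Man.euclid m).toModelled := fun t =>
    (radialEmb (Real.toNNReal (t ^ 2))).toSmooth
  have hF : ContMDiff (𝓘(ℝ, ℝ).prod (𝓡 m)) (𝓡 m) ∞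
      (fun x : ℝ × EuclideanSpace ℝ (Fin m) => F x.1 x.2) := by
    have h : ContDiff ℝ ∞ fun x : ℝ × EuclideanSpace ℝ (Fin m) => radial (x.1 ^ 2) x.2 :=
      contDiffOn_univ.1 (contDiffOn_radial.comp
        ((contDiff_fst.pow 2).prodMk contDiff_snd).contDiffOn
        fun x _ => one_add_pos (sq_nonneg x.1) x.2)
    have h' : ContMDiff (𝓘(ℝ, ℝ).prod (𝓡 m)) (𝓡 m) ∞
        (fun x : ℝ × EuclideanSpace ℝ (Fin m) => radial (x.1 ^ 2) x.2) := by
      rw [← modelWithCornersSelf_prod, chartedSpaceSelf_prod]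
      exact h.contMDiff
    refine h'.congr fun x => ?_
    change radial (Real.toNNReal (x.1 ^ 2) : ℝ) x.2 = _
    rw [Real.coe_toNNReal _ (sq_nonneg _)]
  have h₁ := continuous_iterTangentSmooth_of_family j F hF
  have h₂ : Continuous fun t : ℝ => ModelledMfd.iterTangentCont j (F t) :=
    (ContinuousMap.curry ⟨_, h₁⟩).continuous
  refine (h₂.comp (Real.continuous_sqrt.comp NNReal.continuous_coe)).congr fun s => ?_
  have e : Real.toNNReal (√(s : ℝ) ^ 2) = s := by
    rw [Real.sq_sqrt s.coe_nonneg, Real.toNNReal_coe]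
  exact congrArg (fun t => ModelledMfd.iterTangentCont j (radialEmb t).toSmooth) e

end Shrinking

/-! ## Shrinking strings of patches -/

section ShrinkingStrings

open scoped NNReal

variable {m : ℕ} {M : Man.{u} m} {r p q : SimplexCategory} {σ : FinString.{u} r}

theorem FinString.map_map (σ : FinString.{u} r) {a b c : Fin (r.len + 1)} (h : a ≤ b) (h' : b ≤ c)
    (i : Fin (σ.card c)) : σ.map h (σ.map h' i) = σ.map (h.trans h') i := by
  have e := σ.map_comp (homOfLE h) (homOfLE h')
  exact (congrFun (congrArg Quiver.Hom.unop e) i).symm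

theorem FinString.map_refl (σ : FinString.{u} r) (a : Fin (r.len + 1)) (i : Fin (σ.card a)) :
    σ.map (le_refl a) i = i :=
  congrFun (congrArg Quiver.Hom.unop (σ.map_id a)) i

theorem Man.Emb.range_comp_subset {M : Man.{u} m} {N : Man.{v} m} {P : Man.{w} m} (g : Emb N P)
    (f : Emb M N) : Set.range (g.comp f).toFun ⊆ Set.range g.toFun :=
  Set.range_comp_subset_range f.toFun g.toFun

/-- Closed disks in Euclidean space. -/
def disk (m : ℕ) (δ : ℝ) : Set (Man.euclid m).carrier :=
  (Metric.closedBall 0 δ : Set (EuclideanSpace ℝ (Fin m)))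

theorem isCompact_disk (δ : ℝ) : IsCompact (disk m δ) :=
  isCompact_closedBall (0 : EuclideanSpace ℝ (Fin m)) δ

theorem radialEmb_mem_disk {s : ℝ≥0} {δ : ℝ} (hδ : 0 < δ) (hs : δ⁻¹ ^ 2 ≤ s)
    (z : (Man.euclid m).carrier) : (radialEmb s).toFun z ∈ disk m δ :=
  mem_closedBall_zero_iff.2 (norm_radial_le hδ hs z)

theorem exists_disk_subset {U : Set (Man.euclid m).carrier} (hU : IsOpen U)
    (h : (0 : EuclideanSpace ℝ (Fin m)) ∈ U) : ∃ δ, 0 < δ ∧ disk m δ ⊆ U :=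
  Metric.nhds_basis_closedBall.mem_iff.1 (IsOpen.mem_nhds (X := EuclideanSpace ℝ (Fin m)) hU h)

namespace PatchString

/-- Shrinking of the first patches in a string. -/
def shrink (s : ℝ≥0) (x : PatchString M σ) : PatchString M σ where
  -- Every patch in `M` factors through a first patch. Only the last map, from the first patches to
  -- `M`, is precomposed with the contraction, so the embeddings between Euclidean spaces need not
  -- change.
  obj a i := (x.obj 0 (σ.map (Fin.zero_le a) i)).comp
    ((radialEmb s).comp (x.arr 0 a (Fin.zero_le a) i))
  arr := x.arr
  obj_disjoint a i j hij := by
    -- Patches inside the same first patch are disjoint because the `arr` are; otherwise they lie in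
    -- distinct, disjoint first patches.
    by_cases h : σ.map (Fin.zero_le a) i = σ.map (Fin.zero_le a) j
    · refine Set.disjoint_range_iff.2 fun y z e => ?_
      have e' : (x.obj 0 (σ.map (Fin.zero_le a) i)).toFun
          ((radialEmb s).toFun ((x.arr 0 a (Fin.zero_le a) i).toFun y)) =
          (x.obj 0 (σ.map (Fin.zero_le a) j)).toFun
          ((radialEmb s).toFun ((x.arr 0 a (Fin.zero_le a) j).toFun z)) := e
      rw [h] at e'
      exact Set.disjoint_range_iff.1 (x.arr_disjoint 0 a (Fin.zero_le a) i j hij h) y z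
        ((radialEmb s).injective ((x.obj 0 _).injective e'))
    · exact (x.obj_disjoint 0 _ _ h).mono (Man.Emb.range_comp_subset _ _)
        (Man.Emb.range_comp_subset _ _)
  arr_disjoint := x.arr_disjoint
  arr_refl := x.arr_refl
  arr_comp := x.arr_comp
  obj_arr a b h i z := by
    change (x.obj 0 (σ.map (Fin.zero_le a) (σ.map h i))).toFun ((radialEmb s).toFun
      ((x.arr 0 a (Fin.zero_le a) (σ.map h i)).toFun ((x.arr a b h i).toFun z))) = _
    rw [x.arr_comp, σ.map_map]
    rfl

theorem shrink_apply (s : ℝ≥0) (x : PatchString M σ) (a : Fin (r.len + 1)) (i : Fin (σ.card a))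
    (z : (Man.euclid m).carrier) : ((x.shrink s).obj a i).toFun z =
      (x.obj 0 (σ.map (Fin.zero_le a) i)).toFun ((radialEmb s).toFun
        ((x.arr 0 a (Fin.zero_le a) i).toFun z)) := rfl

theorem ext_apply {x y : PatchString M σ}
    (h : ∀ a i z, (x.obj a i).toFun z = (y.obj a i).toFun z)
    (h' : ∀ a b hab i z, (x.arr a b hab i).toFun z = (y.arr a b hab i).toFun z) : x = y :=
  PatchString.ext (funext fun a => funext fun i => Man.Emb.ext (funext (h a i)))
    (funext fun a => funext fun b => funext fun hab => funext fun i =>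
      Man.Emb.ext (funext (h' a b hab i)))

theorem shrink_zero (x : PatchString M σ) : x.shrink 0 = x :=
  ext_apply (fun _ i z => (congrArg (x.obj 0 _).toFun (radialEmb_zero _)).trans (x.obj_arr _ _ _ i z)) fun _ _ _ _ _ => rfl

theorem shrink_add (s t : ℝ≥0) (x : PatchString M σ) :
    x.shrink (s + t) = (x.shrink t).shrink s :=
  ext_apply (fun a i z => by
    rw [shrink_apply, shrink_apply, shrink_apply, add_comm s t, ← radialEmb_radialEmb]
    change _ = (x.obj 0 (σ.map _ (σ.map _ i))).toFun ((radialEmb t).toFun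
      ((x.arr 0 0 _ _).toFun ((radialEmb s).toFun ((x.arr 0 a _ i).toFun z))))
    rw [x.arr_refl, FinString.map_refl]) fun _ _ _ _ _ => rfl

theorem continuous_shrink :
    Continuous fun x : ℝ≥0 × PatchString M σ => x.2.shrink x.1 := by
  refine continuous_of_components (fun a i => ?_) fun a b h i => ?_
  swap
  · change Continuous fun x : ℝ≥0 × PatchString M σ => x.2.arr a b h i
    exact (continuous_arr a b h i).comp continuous_snd
  exact Man.Emb.continuous_comp.comp ((Man.Emb.continuous_comp.comp
    (((continuous_arr 0 a _ i).comp continuous_snd).prodMk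
      (continuous_radialEmb.comp continuous_fst))).prodMk
        ((continuous_obj 0 _).comp continuous_snd))

end PatchString

namespace PatchGrid

/-- Shrinking of the first patches in a grid. -/
def shrink (s : ℝ≥0) (x : PatchGrid M σ p) : PatchGrid M σ p where
  str c := (x.str c).shrink s
  rot := x.rot
  rot_mul := x.rot_mul
  obj_rot c d a i z := by
    exact (congrArg ((x.str c).obj 0 _).toFun ((congrArg (radialEmb s).toFun
      (x.arr_rot c d 0 a (Fin.zero_le a) i z)).trans (radialEmb_rotate s _ _))).trans
        (x.obj_rot c d 0 _ _)
  arr_rot := x.arr_rot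

theorem shrink_zero (x : PatchGrid M σ p) : x.shrink 0 = x :=
  PatchGrid.ext (funext fun c => (x.str c).shrink_zero) rfl

theorem shrink_add (s t : ℝ≥0) (x : PatchGrid M σ p) : x.shrink (s + t) = (x.shrink t).shrink s :=
  PatchGrid.ext (funext fun c => (x.str c).shrink_add s t) rfl

theorem continuous_str (c : Fin (p.len + 1)) : Continuous fun x : PatchGrid M σ p => x.str c :=
  (continuous_apply c).comp (continuous_fst.comp continuous_strRot)

theorem continuous_shrink : Continuous fun x : ℝ≥0 × PatchGrid M σ p => x.2.shrink x.1 := by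
  refine continuous_induced_rng.2 (Continuous.prodMk ?_ ?_)
  · exact continuous_pi fun c => PatchString.continuous_shrink.comp
      (continuous_fst.prodMk ((continuous_str c).comp continuous_snd))
  · exact continuous_snd.comp (continuous_strRot.comp continuous_snd)

theorem obj_center (x : PatchGrid M σ p) (c d : Fin (p.len + 1)) (a : Fin (r.len + 1))
    (i : Fin (σ.card a)) : ((x.str c).obj a i).toFun (0 : EuclideanSpace ℝ (Fin m)) =
      ((x.str d).obj a i).toFun (0 : EuclideanSpace ℝ (Fin m)) := by
  have h := x.obj_rot c d a i (0 : EuclideanSpace ℝ (Fin m))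
  rwa [rotate_zero] at h

end PatchGrid

/-- The spaces of grids of patches, with the shrinking of patches. -/
def patchSystem (k : ℕ∞) (M : Man.{u} m) (r : SimplexCategory) : ShrinkSystem.{u} where
  Idx := BoundedString.{u} k r
  space σ p := PatchGrid M σ.1 p
  map α := PatchGrid.reindexGroup α
  continuous_map α := PatchGrid.continuous_reindexGroup α
  map_id _ := rfl
  map_comp _ _ _ := rfl
  shrink s x := x.shrink s
  continuous_shrink := PatchGrid.continuous_shrink
  shrink_zero := PatchGrid.shrink_zero
  shrink_add := PatchGrid.shrink_add
  map_shrink _ _ _ := rfl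

/-- The grids all of whose patches are contained in a given set. -/
def gridsIn (U : Set M.carrier) : Set (PatchGrid M σ p) :=
  Set.ofPred fun x => ∀ c a i, Set.range ((x.str c).obj a i).toFun ⊆ U

/-- This is where the covering condition enters. The centres of the first patches are at most `k`
points and lie in the image of one `V_i`. A small closed disk around each is mapped into this open
image, and remains so for nearby grids. Shrinking into these disks brings in all patches, since the
later ones are contained in the first. -/
theorem exists_eventually_shrink_mem {k : ℕ} {ι : Type u} {V : ι → Man.{u} m} {f : ∀ i, V i ⟶ M}
    (hf : IsCovering k f) (hσ : σ.card 0 ≤ k) (x : PatchGrid M σ p) :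
    ∃ i s, ∀ᶠ y in nhds x, PatchGrid.shrink s y ∈ gridsIn (Set.range (Man.Emb.toFun (f i))) := by
  classical
  obtain ⟨i, hi⟩ := hf.subset_range (Finset.univ.image fun j : Fin (σ.card 0) =>
    ((x.str 0).obj 0 j).toFun (0 : EuclideanSpace ℝ (Fin m)))
    (Finset.card_image_le.trans (by simpa using hσ))
  have hopen := Man.Emb.isOpen_range (f i)
  have key : ∀ (c : Fin (p.len + 1)) (j : Fin (σ.card 0)), ∃ δ : ℝ, 0 < δ ∧
      ∀ᶠ y in nhds x, Set.MapsTo (PatchString.obj (PatchGrid.str y c) 0 j).toFun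
        (disk m δ) (Set.range (Man.Emb.toFun (f i))) := by
    intro c j
    have h₀ : ((x.str c).obj 0 j).toFun (0 : EuclideanSpace ℝ (Fin m)) ∈
        Set.range (Man.Emb.toFun (f i)) := by
      rw [x.obj_center c 0]
      exact hi (by simp)
    obtain ⟨δ, hδ, h⟩ := exists_disk_subset
      (hopen.preimage ((x.str c).obj 0 j).continuous_apply) h₀
    refine ⟨δ, hδ, ?_⟩
    exact ((PatchString.continuous_obj 0 j).comp (PatchGrid.continuous_str c)).continuousAt
      ((Man.Emb.isOpen_mapsTo (isCompact_disk δ) hopen).mem_nhds h)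
  choose δ hδ h using key
  obtain ⟨s, hs⟩ : ∃ s : ℝ≥0, ∀ c j, (δ c j)⁻¹ ^ 2 ≤ s := by
    obtain ⟨s, hs⟩ := (Set.finite_range fun x : Fin (p.len + 1) × Fin (σ.card 0) =>
      Real.toNNReal ((δ x.1 x.2)⁻¹ ^ 2)).bddAbove
    exact ⟨s, fun c j => (Real.le_coe_toNNReal _).trans
      (NNReal.coe_le_coe.2 (hs (Set.mem_range_self (c, j))))⟩
  refine ⟨i, s, ?_⟩
  filter_upwards [Filter.eventually_all.2 fun c => Filter.eventually_all.2 fun j => h c j] with y hy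
  rintro c a j _ ⟨z, rfl⟩
  exact hy c (σ.map (Fin.zero_le a) j) (radialEmb_mem_disk (hδ _ _) (hs _ _) _)

/-- The cover of the spaces of grids given by the patches in the members of a covering. -/
def patchCover {k : ℕ} {ι : Type u} {V : ι → Man.{u} m} (f : ∀ i, V i ⟶ M) (hf : IsCovering k f)
    (r : SimplexCategory) : (patchSystem k M r).Cover ι where
  carrier i _ _ := gridsIn (Set.range (Man.Emb.toFun (f i)))
  map_mem α _ hx c := hx (α.toOrderHom c)
  shrink_mem s _ hx c _ _ := (Man.Emb.range_comp_subset _ _).trans (hx c 0 _)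
  eventually_mem {σ _} x := exists_eventually_shrink_mem hf (by exact_mod_cast σ.2 0) x

/-- The simplices of the configuration category with all patches in a member of a covering. -/
def coveredSub {k : ℕ} {ι : Type u} {V : ι → Man.{u} m} (f : ∀ i, V i ⟶ M)
    (r : SimplexCategory) : (configLevel k M r).Subcomplex where
  obj p := Set.ofPred fun x : ConfigSimplex k M r p.unop => ∃ i, ∀ z, (x.2 z : PatchGrid _ _ _) ∈
    gridsIn (Set.range (Man.Emb.toFun (f i)))
  map α _ := fun ⟨i, h⟩ => ⟨i, fun _ c => h _ (α.unop.toOrderHom c)⟩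

/-- The whole topological simplex is `1`-small and shrinking by zero is the identity, so the covered
simplices are exactly those in `small 0`. -/
theorem isWeakEquiv_coveredSub_ι {k : ℕ} {ι : Type u} {V : ι → Man.{u} m} (f : ∀ i, V i ⟶ M)
    (hf : IsCovering k f) (r : SimplexCategory) :
    IsWeakEquiv (coveredSub (k := k) f r).ι := by
  have h : coveredSub (k := k) f r = ShrinkSystem.small (patchCover f hf r) 0 := by
    ext p x
    refine ⟨fun ⟨i, hi⟩ B _ => ⟨i, fun z _ => ?_⟩, fun hx => ?_⟩
    · rw [Nat.cast_zero, (patchSystem k M r).shrink_zero]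
      exact hi z
    · obtain ⟨i, hi⟩ := hx Set.univ (by simpa using isSmall_one _)
      refine ⟨i, fun z => ?_⟩
      have := hi z trivial
      rwa [Nat.cast_zero, (patchSystem k M r).shrink_zero] at this
  rw [h]
  exact ShrinkSystem.isWeakEquiv_small_zero_ι _

end ShrinkingStrings

/-! ## Homotopy colimits of coverings -/

section NerveHomotopies

variable {J : Type u} [PartialOrder J]

theorem composableArrows_ext {n : ℕ} {c d : ComposableArrows J n} (h : ∀ j, c.obj j = d.obj j) :
    c = d := CategoryTheory.Functor.ext h fun _ _ _ => Subsingleton.elim _ _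

/-- The underlying chain of a simplex of the nerve of a partially ordered set. -/
def nerveChain {p : SimplexCategoryᵒᵖ} (c : (nerve J).obj p) : Fin (p.unop.len + 1) →o J :=
  ⟨fun j => (show ComposableArrows J p.unop.len from c).toPrefunctor.obj j, fun _ _ h =>
    leOfHom ((show ComposableArrows J p.unop.len from c).toPrefunctor.map (homOfLE h))⟩

/-- The simplex of the nerve given by a chain. -/
def nerveMk (p : SimplexCategoryᵒᵖ) (c : Fin (p.unop.len + 1) →o J) : (nerve J).obj p :=
  c.monotone.functor

theorem nerve_ext {p : SimplexCategoryᵒᵖ} {c d : (nerve J).obj p}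
    (h : ∀ j, nerveChain c j = nerveChain d j) : c = d := composableArrows_ext h

/-- A stage of the homotopy of nerves between ordered monotone maps. -/
def blend (φ : Fin 2 →o J →o J) {n : ℕ} (c : Fin (n + 1) →o J) (α : Fin (n + 1) →o Fin 2) :
    Fin (n + 1) →o J :=
  ⟨fun j => φ (α j) (c j), fun i _ h => (φ.monotone (α.monotone h) (c i)).trans
    ((φ _).monotone (c.monotone h))⟩

end NerveHomotopies

/-! ### Homotopy colimits of finite intersections of subcomplexes. -/

section Coverings

variable {ι : Type u} {Z : SSet.{u}} (A : ι → Z.Subcomplex)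

/-- The pairs consisting of a chain of finite nonempty subsets and a simplex lying in all members
of a family of subcomplexes with index in the subsets in the chain. -/
def chainSub : (nerve (FinSubset ι) ⊗ Z).Subcomplex where
  obj p := Set.ofPred fun x => ∀ i ∈ (nerveChain x.1 (Fin.last _)).1, (x.2 : Z.obj p) ∈ (A i).obj p
  map θ x hx i hi := (A i).map θ (hx i ((nerveChain x.1).monotone
    (Fin.le_last (θ.unop.toOrderHom (Fin.last _))) hi))

/-- The projection from the homotopy colimit. -/
def chainProj : (chainSub A).toSSet ⟶ Z := (chainSub A).ι ⨟ snd _ _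

/-- The projection from the homotopy colimit of a cover is a weak equivalence. -/
theorem isWeakEquiv_chainProj (hA : ∀ (p : SimplexCategoryᵒᵖ) (z : Z.obj p), ∃ i, z ∈ (A i).obj p) :
    IsWeakEquiv (chainProj A) := by
  classical
  refine isWeakEquiv_of_cover _ A hA fun i C hC => ?_
  let single : FinSubset ι := ⟨{i}, Finset.singleton_nonempty i⟩
  let add : FinSubset ι →o FinSubset ι :=
    ⟨fun S => ⟨insert i S.1, Finset.insert_nonempty i S.1⟩, fun S T h => Finset.insert_subset_insert i h⟩
  let D := C.preimage (chainProj A)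
  -- Simplices of `C` already lie in `A i`, so adding `i` to the index sets of a chain is harmless.
  -- This keeps the homotopies through `S ⊆ S ∪ {i} ⊇ {i}` inside `chainSub A`.
  have hmem : ∀ {p : SimplexCategoryᵒᵖ} (c : (nerve (FinSubset ι)).obj p) (z : Z.obj p),
      z ∈ C.obj p → (∃ c', pairMk c' z ∈ (chainSub A).obj p ∧
        nerveChain c (Fin.last _) ≤ add (nerveChain c' (Fin.last _))) →
      pairMk c z ∈ (chainSub A).obj p := by
    rintro p c z hz ⟨c', hc', h⟩ j hj
    rcases Finset.mem_insert.1 (h hj) with rfl | hj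
    · exact hC _ hz
    · exact hc' j hj
  let H : ∀ φ : Fin 2 →o FinSubset ι →o FinSubset ι, (∀ a S, φ a S ≤ add S) →
      (D.toSSet ⊗ Δ[1] ⟶ D.toSSet) := fun φ hφ =>
    { app p := ↾(fun x : (D.toSSet ⊗ Δ[1] : SSet.{u}).obj p =>
        ⟨⟨pairMk (nerveMk p (blend φ (nerveChain x.1.1.1.1) (SSet.stdSimplex.asOrderHom.{u} x.2)))
          x.1.1.1.2, hmem _ _ x.1.2 ⟨_, x.1.1.2, hφ _ _⟩⟩, x.1.2⟩)
      naturality p q θ := ConcreteCategory.hom_ext _ _ fun x =>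
        Subtype.ext (Subtype.ext (Prod.ext (nerve_ext fun j => rfl) rfl)) }
  let s : C.toSSet ⟶ D.toSSet :=
    { app p := ↾(fun x : C.toSSet.obj p =>
        ⟨⟨pairMk (nerveMk p (OrderHom.const _ single)) x.1, fun j hj => by
          obtain rfl := Finset.mem_singleton.1 hj
          exact hC _ x.2⟩, x.2⟩)
      naturality p q θ := ConcreteCategory.hom_ext _ _ fun x =>
        Subtype.ext (Subtype.ext (Prod.ext (nerve_ext fun j => rfl) rfl)) }
  have mono : ∀ φ ψ : FinSubset ι →o FinSubset ι, φ ≤ ψ → Monotone ![φ, ψ] := by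
    intro φ ψ h
    rw [Fin.monotone_iff_le_succ]
    intro i
    fin_cases i
    exact h
  let φ₁ : Fin 2 →o FinSubset ι →o FinSubset ι := ⟨![.id, add], mono _ _ fun S =>
    Finset.subset_insert i S.1⟩
  let φ₂ : Fin 2 →o FinSubset ι →o FinSubset ι := ⟨![OrderHom.const _ single, add],
    mono _ _ fun S => Finset.singleton_subset_iff.2 (Finset.mem_insert_self i S.1)⟩
  have h₁ : ∀ a S, φ₁ a S ≤ add S := fun a S => φ₁.monotone (Fin.le_last a) S
  have h₂ : ∀ a S, φ₂ a S ≤ add S := fun a S => φ₂.monotone (Fin.le_last a) S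
  have e₁ : SSet.ι₀ ⨟ H φ₁ h₁ = 𝟙 _ := by
    ext p x
    exact Subtype.ext (Subtype.ext (Prod.ext (nerve_ext fun j => rfl) rfl))
  have e₂ : SSet.ι₀ ⨟ H φ₂ h₂ = restrict (chainProj A) (le_refl D) ⨟ s := by
    ext p x
    exact Subtype.ext (Subtype.ext (Prod.ext (nerve_ext fun j => rfl) rfl))
  have e₃ : SSet.ι₁ ⨟ H φ₁ h₁ = SSet.ι₁ ⨟ H φ₂ h₂ := by
    ext p x
    exact Subtype.ext (Subtype.ext (Prod.ext (nerve_ext fun j => rfl) rfl))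
  -- Both homotopies end at `S ↦ S ∪ {i}`; one starts at the identity, the other at the projection
  -- to `C` followed by the section with constant chain `{i}`.
  have w₁ : IsWeakEquiv (SSet.ι₁ ⨟ H φ₁ h₁) :=
    (IsWeakEquiv.id _).congr (hRel_iff.2 ⟨H φ₁ h₁, e₁, rfl⟩)
  have w₂ : IsWeakEquiv (restrict (chainProj A) (le_refl D) ⨟ s) :=
    w₁.congr' (hRel_iff.2 ⟨H φ₂ h₂, e₂, e₃.symm⟩)
  exact .of_homotopyEquiv (g := s) w₂ (IsWeakEquiv.id C.toSSet)

/-- The union of a family of subcomplexes. -/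
def coverSub : Z.Subcomplex where
  obj p := Set.ofPred fun x => ∃ i, x ∈ (A i).obj p
  map θ _ := fun ⟨i, h⟩ => ⟨i, (A i).map θ h⟩

/-- The homotopy colimit of the intersections of a family of subcomplexes is weakly equivalent to
the union of the family. -/
theorem isWeakEquiv_hocolimDesc {X : (FinSubset ι)ᵒᵖ ⥤ SSet.{u}} (s : Cocone X)
    (A : ι → s.pt.Subcomplex)
    (hinj : ∀ S (p : SimplexCategoryᵒᵖ), Function.Injective ((s.ι.app S).app p))
    (hrange : ∀ S (p : SimplexCategoryᵒᵖ) (z : s.pt.obj p),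
      (∃ x, (s.ι.app S).app p x = z) ↔ ∀ i ∈ S.unop.1, z ∈ (A i).obj p)
    (hA : IsWeakEquiv (coverSub A).ι) : IsWeakEquiv (hocolimDesc s) := by
  let A' : ι → (coverSub A).toSSet.Subcomplex := fun i => (A i).preimage (coverSub A).ι
  have hmem : ∀ {p : SimplexCategoryᵒᵖ} (x : HocolimSimplex X p.unop),
      ∀ i ∈ (x.1.toPrefunctor.obj (Fin.last _)).1, (hocolimDesc s).app p x ∈ (A i).obj p :=
    fun x => (hrange _ _ _).1 ⟨x.2, rfl⟩
  let e : hocolim X ⟶ (chainSub A').toSSet :=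
    { app p := ↾(fun x : HocolimSimplex X p.unop =>
        ⟨(x.1, ⟨(hocolimDesc s).app p x, _, hmem x _
          (x.1.toPrefunctor.obj (Fin.last _)).2.choose_spec⟩), hmem x⟩)
      naturality p q θ := by
        refine ConcreteCategory.hom_ext _ _ fun (x : HocolimSimplex X p.unop) => ?_
        refine Subtype.ext (Prod.ext ?_ ?_)
        · rfl
        · exact Subtype.ext (app_map (hocolimDesc s) θ x) }
  have he : hocolimDesc s = e ⨟ chainProj A' ⨟ (coverSub A).ι := rfl
  -- The simplices of each `X S` are those of the intersection of the `A i` with `i ∈ S`, so a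
  -- simplex of the homotopy colimit is a chain together with a simplex of the intersection at its
  -- last, largest set.
  have : IsIso e := by
    refine (NatTrans.isIso_iff_isIso_app e).2 fun p => (isIso_iff_bijective _).2 ⟨?_, ?_⟩
    · rintro ⟨c, x⟩ ⟨d, y⟩ h
      have h₁ : c = d := congrArg (fun z => z.1.1) h
      subst h₁
      have h₂ := congrArg (fun z => z.1.2.1) h
      exact Sigma.ext rfl (heq_of_eq (hinj _ _ h₂))
    · rintro ⟨⟨c, z⟩, hz⟩
      obtain ⟨x, hx⟩ := (hrange (op ((nerveChain c) (Fin.last _))) p z.1).2 hz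
      exact ⟨(⟨c, x⟩ : HocolimSimplex X p.unop), Subtype.ext (Prod.ext rfl (Subtype.ext hx))⟩
  rw [he]
  exact (IsWeakEquiv.of_isIso e).comp ((isWeakEquiv_chainProj A' fun p z => z.2).comp hA)

end Coverings

/-! ### Patches in an open submanifold, and the cosheaf property. -/

section Cosheaf

variable {m : ℕ} {M : Man.{u} m} {r p : SimplexCategory} {σ : FinString.{u} r}

namespace PatchString

theorem isInducing_postcomp {N : Man.{u} m} (g : M ⟶ N) :
    Topology.IsInducing (postcomp g : PatchString M σ → PatchString N σ) := by
  refine ⟨?_⟩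
  change (⨅ a, ⨅ i, _) ⊓ (⨅ a, ⨅ b, ⨅ h, ⨅ i, _) = TopologicalSpace.induced _
    ((⨅ a, ⨅ i, _) ⊓ (⨅ a, ⨅ b, ⨅ h, ⨅ i, _))
  simp only [induced_inf, induced_iInf, induced_compose]
  congr 1
  refine iInf_congr fun a => iInf_congr fun i => ?_
  rw [(Man.Emb.isInducing_comp_left (M := Man.euclid m) (show Man.Emb M N from g)).eq_induced,
    induced_compose]
  rfl

theorem postcomp_injective {N : Man.{u} m} (g : M ⟶ N) :
    Function.Injective (postcomp g : PatchString M σ → PatchString N σ) := fun _ _ h =>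
  ext_apply (fun a i z => Man.Emb.injective (show Man.Emb M N from g)
    (congrArg (fun w : PatchString N σ => (w.obj a i).toFun z) h))
    fun a b hab i z => congrArg (fun w : PatchString N σ => (w.arr a b hab i).toFun z) h

theorem exists_postcomp_eq {N : Man.{u} m} (g : M ⟶ N) (y : PatchString N σ)
    (h : ∀ a i, Set.range (y.obj a i).toFun ⊆ Set.range (Man.Emb.toFun g)) :
    ∃ x, postcomp g x = y := by
  choose f hf using fun a i => Man.Emb.exists_comp_eq (show Man.Emb M N from g) (y.obj a i) (h a i)
  have hg := Man.Emb.injective (show Man.Emb M N from g)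
  have hf' : ∀ a i z, Man.Emb.toFun g ((f a i).toFun z) = (y.obj a i).toFun z := fun a i z =>
    congrArg (fun w : Man.Emb (Man.euclid m) N => w.toFun z) (hf a i)
  refine ⟨{ y with
    obj := f
    obj_disjoint := fun a i j hij => Set.disjoint_range_iff.2 fun z w e =>
      Set.disjoint_range_iff.1 (y.obj_disjoint a i j hij) z w (by rw [← hf', ← hf', e])
    obj_arr := fun a b hab i z => hg (by
      rw [hf', hf']
      exact y.obj_arr a b hab i z) }, ?_⟩
  exact ext_apply (fun a i z => hf' a i z) fun _ _ _ _ _ => rfl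

end PatchString

namespace PatchGrid

theorem isInducing_strRot :
    Topology.IsInducing (fun x : PatchGrid M σ p => (x.str, x.rot)) := ⟨rfl⟩

theorem isInducing_postcomp {N : Man.{u} m} (g : M ⟶ N) :
    Topology.IsInducing (postcomp g : PatchGrid M σ p → PatchGrid N σ p) := by
  refine isInducing_strRot.of_comp_iff.1 ?_
  exact ((Topology.IsInducing.piMap fun _ => PatchString.isInducing_postcomp g).prodMap .id).comp
    isInducing_strRot

theorem postcomp_injective {N : Man.{u} m} (g : M ⟶ N) :
    Function.Injective (postcomp g : PatchGrid M σ p → PatchGrid N σ p) := fun _ _ h =>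
  PatchGrid.ext (funext fun c => PatchString.postcomp_injective g
    (congrArg (fun w : PatchGrid N σ p => w.str c) h))
    (congrArg (fun w : PatchGrid N σ p => w.rot) h)

theorem exists_postcomp_eq {N : Man.{u} m} (g : M ⟶ N) (y : PatchGrid N σ p)
    (h : y ∈ gridsIn (Set.range (Man.Emb.toFun g))) : ∃ x, postcomp g x = y := by
  choose f hf using fun c => PatchString.exists_postcomp_eq g (y.str c) (h c)
  have hg := Man.Emb.injective (show Man.Emb M N from g)
  have hf' : ∀ c a i z, Man.Emb.toFun g (((f c).obj a i).toFun z) = ((y.str c).obj a i).toFun z :=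
    fun c a i z => congrArg (fun w : PatchString N σ => (w.obj a i).toFun z) (hf c)
  have hf'' : ∀ c a b hab i z, ((f c).arr a b hab i).toFun z = ((y.str c).arr a b hab i).toFun z :=
    fun c a b hab i z => congrArg (fun w : PatchString N σ => (w.arr a b hab i).toFun z) (hf c)
  refine ⟨{ str := f
            rot := y.rot
            rot_mul := y.rot_mul
            obj_rot := fun c d a i z => hg ((hf' c a i _).trans ((y.obj_rot c d a i z).trans
              (hf' d a i z).symm))
            arr_rot := fun c d a b hab i z => (hf'' c a b hab i _).trans
              ((y.arr_rot c d a b hab i z).trans (congrArg (rotate _) (hf'' d a b hab i z).symm)) }, PatchGrid.ext (funext hf) rfl⟩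

theorem postcomp_mem_gridsIn {N : Man.{u} m} (g : M ⟶ N) (x : PatchGrid M σ p) :
    postcomp g x ∈ gridsIn (Set.range (Man.Emb.toFun g)) := fun c a i =>
  Man.Emb.range_comp_subset (show Man.Emb M N from g) ((x.str c).obj a i)

end PatchGrid

namespace ConfigSimplex

variable {k : ℕ∞} {N : Man.{u} m}

theorem mapMan_injective (g : M ⟶ N) :
    Function.Injective (mapMan g : ConfigSimplex k M r p → ConfigSimplex k N r p) := by
  rintro ⟨σ, x⟩ ⟨τ, y⟩ h
  obtain rfl : σ = τ := congrArg Sigma.fst h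
  have h' := eq_of_heq (Sigma.mk.inj h).2
  exact Sigma.ext rfl (heq_of_eq (ContinuousMap.ext fun z => PatchGrid.postcomp_injective g
    (congrArg (fun w : C(topSimplex p, PatchGrid N σ.1 p) => w z) h')))

/-- Grids with patches in the range of `g` lift uniquely through `g`; the lifted family is
continuous because postcomposition with `g` is inducing. -/
theorem exists_mapMan_eq_iff (g : M ⟶ N) (y : ConfigSimplex k N r p) :
    (∃ x, mapMan g x = y) ↔ ∀ z, y.2 z ∈ gridsIn (Set.range (Man.Emb.toFun g)) := by
  constructor
  · rintro ⟨x, rfl⟩ z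
    exact PatchGrid.postcomp_mem_gridsIn g (x.2 z)
  · intro h
    choose f hf using fun z => PatchGrid.exists_postcomp_eq g (y.2 z) (h z)
    refine ⟨⟨y.1, f, (PatchGrid.isInducing_postcomp g).continuous_iff.2 ?_⟩,
      Sigma.ext rfl (heq_of_eq (ContinuousMap.ext hf))⟩
    have : PatchGrid.postcomp g ∘ f = y.2 := funext hf
    rw [this]
    exact y.2.continuous

end ConfigSimplex

theorem isHomotopyCosheaf_con (m k : ℕ) : IsHomotopyCosheaf k (con.{u} m k) := by
  intro M ι V f hf r
  refine isWeakEquiv_hocolimDesc _ (fun i =>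
    { obj p := Set.ofPred fun x : ConfigSimplex k M r.unop p.unop =>
        ∀ z, (x.2 z : PatchGrid _ _ _) ∈ gridsIn (Set.range (Man.Emb.toFun (f i)))
      map α _ := fun h z c => h _ (α.unop.toOrderHom c) }) (fun S p => ?_) (fun S p z => ?_) ?_
  · exact ConfigSimplex.mapMan_injective (M.inclusionTop (interOpen f S.unop))
  · refine (ConfigSimplex.exists_mapMan_eq_iff (M.inclusionTop (interOpen f S.unop)) z).trans ?_
    have : Set.range (Man.Emb.toFun (M.inclusionTop (interOpen f S.unop))) =
        ⋂ i ∈ S.unop.1, Set.range (Man.Emb.toFun (f i)) := Subtype.range_coe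
    rw [this]
    constructor
    · exact fun h i hi w c a j => (h w c a j).trans (Set.biInter_subset_of_mem hi)
    · exact fun h w c a j => Set.subset_iInter₂ fun i hi => h i hi w c a j
  · exact isWeakEquiv_coveredSub_ι f hf r.unop

end Cosheaf

/-! ## Mapping spaces of simplicial spaces over a base -/

section Tensor

variable {B : SimplicialSpace.{u}} {X X' Y : Over B} {K L : SSet.{u}}

/-- The value of a map `X × K ⟶ Y` at a pair of simplices. -/
def tensorVal (ψ : (tensorOver.obj X).obj K ⟶ Y) {r q : SimplexCategoryᵒᵖ}
    (x : (X.left.obj r).obj q) (k : K.obj q) : (Y.left.obj r).obj q :=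
  (ψ.left.app r).app q (pairMk x k)

theorem tensor_ext {ψ ψ' : (tensorOver.obj X).obj K ⟶ Y}
    (h : ∀ r q (x : (X.left.obj r).obj q) (k : K.obj q), tensorVal ψ x k = tensorVal ψ' x k) :
    ψ = ψ' := by
  refine Over.OverMorphism.ext (NatTrans.ext (funext fun r => NatTrans.ext (funext fun q => ?_)))
  exact ConcreteCategory.hom_ext _ _ fun x => h r q x.1 x.2

theorem tensorVal_map (ψ : (tensorOver.obj X).obj K ⟶ Y) {r q q' : SimplexCategoryᵒᵖ} (α : q ⟶ q')
    (x : (X.left.obj r).obj q) (k : K.obj q) :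
    tensorVal ψ ((X.left.obj r).map α x) (K.map α k) = (Y.left.obj r).map α (tensorVal ψ x k) :=
  app_map (ψ.left.app r) α (pairMk x k)

theorem tensorVal_mapString (ψ : (tensorOver.obj X).obj K ⟶ Y) {r r' q : SimplexCategoryᵒᵖ}
    (θ : r ⟶ r') (x : (X.left.obj r).obj q) (k : K.obj q) :
    tensorVal ψ ((X.left.map θ).app q x) k = (Y.left.map θ).app q (tensorVal ψ x k) :=
  app_congr (ψ.left.naturality θ) (x := (pairMk x k : (X.left.obj r ⊗ K : SSet.{u}).obj q))

theorem hom_tensorVal (ψ : (tensorOver.obj X).obj K ⟶ Y) {r q : SimplexCategoryᵒᵖ}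
    (x : (X.left.obj r).obj q) (k : K.obj q) :
    (Y.hom.app r).app q (tensorVal ψ x k) = (X.hom.app r).app q x :=
  app_congr (NatTrans.congr_app (Over.w ψ) r) (x := (pairMk x k : (X.left.obj r ⊗ K : SSet.{u}).obj q))

/-- A map `X × K ⟶ Y` given by its values. -/
def tensorMk (v : ∀ r q, (X.left.obj r).obj q → K.obj q → (Y.left.obj r).obj q)
    (hv : ∀ r {q q'} (α : q ⟶ q') x k,
      v r q' ((X.left.obj r).map α x) (K.map α k) = (Y.left.obj r).map α (v r q x k))
    (hv' : ∀ {r r'} (θ : r ⟶ r') q x k,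
      v r' q ((X.left.map θ).app q x) k = (Y.left.map θ).app q (v r q x k))
    (hB : ∀ r q x k, (Y.hom.app r).app q (v r q x k) = (X.hom.app r).app q x) :
    (tensorOver.obj X).obj K ⟶ Y :=
  Over.homMk
    { app r :=
        { app q := ↾(fun x : (X.left.obj r ⊗ K : SSet.{u}).obj q => v r q x.1 x.2)
          naturality q q' α := ConcreteCategory.hom_ext _ _ fun x => hv r α x.1 x.2 }
      naturality r r' θ := NatTrans.ext (funext fun q => ConcreteCategory.hom_ext _ _ fun x =>
        hv' θ q x.1 x.2) }
    (NatTrans.ext (funext fun r => NatTrans.ext (funext fun q => ConcreteCategory.hom_ext _ _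
      fun x => hB r q x.1 x.2)))

/-- The map `K ⟶ map(X, Y)` adjoint to a map `X × K ⟶ Y`. -/
def mapOverCurry (ψ : (tensorOver.obj X).obj K ⟶ Y) : K ⟶ (mapOver Y).obj (op X) where
  app q := ↾(fun k => (tensorOver.obj X).map (SSet.yonedaEquiv.symm k) ⨟ ψ)
  naturality q q' α := ConcreteCategory.hom_ext _ _ fun k => by
    refine (congrArg (fun g => (tensorOver.obj X).map g ⨟ ψ)
      (SSet.yonedaEquiv_symm_naturality_left α.unop k)).symm.trans ?_
    rfl

/-- The identity operator as a simplex of the standard simplex. -/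
def topSimplexId (q : SimplexCategoryᵒᵖ) : (SSet.stdSimplex.{u}.obj q.unop).obj q :=
  SSet.stdSimplex.objEquiv.symm (𝟙 _)

/-- Evaluation of a simplex of the mapping space at a simplex of the same dimension. -/
def mapOverEval {q : SimplexCategoryᵒᵖ} (φ : ((mapOver Y).obj (op X)).obj q) {r : SimplexCategoryᵒᵖ}
    (x : (X.left.obj r).obj q) : (Y.left.obj r).obj q :=
  tensorVal (show (tensorOver.obj X).obj (SSet.stdSimplex.obj q.unop) ⟶ Y from φ) x (topSimplexId q)

/-- The Yoneda lemma: a simplex of the mapping space is determined by evaluating its images under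
all simplicial operators at the universal simplex. -/
theorem tensorVal_eq_mapOverEval {q q' : SimplexCategoryᵒᵖ} (φ : ((mapOver Y).obj (op X)).obj q)
    {r : SimplexCategoryᵒᵖ} (x : (X.left.obj r).obj q') (s : (SSet.stdSimplex.{u}.obj q.unop).obj q') :
    tensorVal (show (tensorOver.obj X).obj (SSet.stdSimplex.obj q.unop) ⟶ Y from φ) x s =
      mapOverEval (((mapOver Y).obj (op X)).map (SSet.stdSimplex.objEquiv s).op φ) x := by
  refine congrArg (tensorVal _ x) ((SSet.stdSimplex.objEquiv.symm_apply_apply s).symm.trans ?_)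
  exact congrArg SSet.stdSimplex.objEquiv.symm (Category.id_comp _).symm

theorem mapOver_ext {q : SimplexCategoryᵒᵖ} {φ φ' : ((mapOver Y).obj (op X)).obj q}
    (h : ∀ q' (α : q ⟶ q') r (x : (X.left.obj r).obj q'),
      mapOverEval (((mapOver Y).obj (op X)).map α φ) x =
        mapOverEval (((mapOver Y).obj (op X)).map α φ') x) : φ = φ' :=
  tensor_ext fun r q' x s => (tensorVal_eq_mapOverEval φ x s).trans
    ((h q' _ r x).trans (tensorVal_eq_mapOverEval φ' x s).symm)

theorem mapOverEval_map {q q' : SimplexCategoryᵒᵖ} (φ : ((mapOver Y).obj (op X)).obj q) (α : q ⟶ q')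
    {r : SimplexCategoryᵒᵖ} (x : (X.left.obj r).obj q) :
    mapOverEval (((mapOver Y).obj (op X)).map α φ) ((X.left.obj r).map α x) =
      (Y.left.obj r).map α (mapOverEval φ x) := by
  let ψ : (tensorOver.obj X).obj (SSet.stdSimplex.obj q.unop) ⟶ Y := φ
  refine Eq.trans ?_ (tensorVal_map ψ α x (topSimplexId q))
  exact congrArg (fun s => tensorVal ψ ((X.left.obj r).map α x) (SSet.stdSimplex.objEquiv.symm s))
    ((Category.id_comp _).trans (Category.comp_id α.unop).symm)

theorem mapOverEval_mapString {q : SimplexCategoryᵒᵖ} (φ : ((mapOver Y).obj (op X)).obj q)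
    {r r' : SimplexCategoryᵒᵖ} (θ : r ⟶ r') (x : (X.left.obj r).obj q) :
    mapOverEval φ ((X.left.map θ).app q x) = (Y.left.map θ).app q (mapOverEval φ x) :=
  tensorVal_mapString _ θ x _

theorem hom_mapOverEval {q : SimplexCategoryᵒᵖ} (φ : ((mapOver Y).obj (op X)).obj q)
    {r : SimplexCategoryᵒᵖ} (x : (X.left.obj r).obj q) :
    (Y.hom.app r).app q (mapOverEval φ x) = (X.hom.app r).app q x := hom_tensorVal _ x _

theorem mapOverEval_curry (ψ : (tensorOver.obj X).obj K ⟶ Y) {r q : SimplexCategoryᵒᵖ}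
    (k : K.obj q) (x : (X.left.obj r).obj q) :
    mapOverEval ((mapOverCurry ψ).app q k) x = tensorVal ψ x k := by
  refine congrArg (tensorVal ψ x) ?_
  exact ConcreteCategory.congr_hom (K.map_id q) k

theorem hom_mapOver_ext {φ φ' : K ⟶ (mapOver Y).obj (op X)}
    (h : ∀ r q k (x : (X.left.obj r).obj q),
      mapOverEval (φ.app q k) x = mapOverEval (φ'.app q k) x) : φ = φ' := by
  refine NatTrans.ext (funext fun q => ConcreteCategory.hom_ext _ _ fun k => mapOver_ext ?_)
  intro q' α r x
  refine (congrArg (fun z => mapOverEval z x) (app_map φ α k)).symm.trans ((h _ _ _ _).trans ?_)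
  exact congrArg (fun z => mapOverEval z x) (app_map φ' α k)

end Tensor

/-! ### Restriction along levelwise injective weak equivalences. -/

section Mono

/-- The inclusion of `S ⊗ K` into the union is a cobase change of `S ⊗ T ⟶ X ⊗ T`, hence acyclic,
and `S ⊗ K ⟶ X ⊗ K` is a weak equivalence. -/
theorem isWeakEquiv_unionProd_ι {X K : SSet.{u}} (S : X.Subcomplex) (T : K.Subcomplex)
    (hS : IsWeakEquiv S.ι) : IsWeakEquiv (S.unionProd T).ι := by
  have h₁ : acyclic (S.ι ▷ (T : SSet.{u})) := (hS.whiskerRight _).acyclic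
  have h₂ : acyclic (SSet.Subcomplex.unionProd.ι₂ S T) :=
    acyclic.of_isPushout (SSet.Subcomplex.unionProd.isPushout S T).flip h₁
  exact IsWeakEquiv.of_comp_left h₂.isWeakEquiv (g := (S.unionProd T).ι) (hS.whiskerRight K)

theorem isWeakEquiv_range_ι {X Y : SSet.{u}} (f : X ⟶ Y) [Mono f] (hf : IsWeakEquiv f) :
    IsWeakEquiv (SSet.Subcomplex.range f).ι := by
  have : IsWeakEquiv (SSet.Subcomplex.toRange f ⨟ (SSet.Subcomplex.range f).ι) := hf
  exact IsWeakEquiv.of_comp_left (IsWeakEquiv.of_isIso _) this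

variable {B : SimplicialSpace.{u}} {X X' Y : Over B}

/-- Precomposition with a monomorphism that is a levelwise weak equivalence is a weak equivalence
of mapping spaces into a fibrant object. -/
theorem isWeakEquiv_mapOver_of_mono (hY : IsInjectiveFibration Y.hom) (i : X' ⟶ X)
    (hi : ∀ r, Mono (i.left.app r)) (hi' : IsLevelwiseWeakEquiv i.left) :
    IsWeakEquiv ((mapOver Y).map i.op) := by
  -- Restriction is shown to be a trivial fibration. By adjunction, a lifting problem against `l : K
  -- ⟶ L` asks to extend a map over `B` from `X' × L ∪ X × K` to `X × L`, and fibrancy of `Y` over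
  -- `B` solves it.
  refine isWeakEquiv_of_rlp fun {K L} l _ => ⟨fun {f g} sq => ?_⟩
  let S : ∀ r, (X.left.obj r).Subcomplex := fun r => SSet.Subcomplex.range (i.left.app r)
  let T := SSet.Subcomplex.range l
  have hl : ∀ q, Function.Injective (l.app q) := fun q =>
    (mono_iff_injective _).1 inferInstance
  have hi'' : ∀ r q, Function.Injective ((i.left.app r).app q) := fun r q =>
    (mono_iff_injective _).1 inferInstance
  let P : SimplicialSpace.{u} :=
    { obj r := ((S r).unionProd T).toSSet
      map {r r'} θ :=
        { app q := ↾(fun z => ⟨((X.left.map θ).app q z.1.1, z.1.2),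
            z.2.imp (fun h => ⟨trivial, h.2⟩) (fun h => by
              obtain ⟨⟨x, hx⟩, -⟩ := h
              exact ⟨⟨(X'.left.map θ).app q x, (app_congr (i.left.naturality θ) x).trans
                (congrArg ((X.left.map θ).app q) hx)⟩, trivial⟩)⟩)
          naturality q q' α := by
            refine ConcreteCategory.hom_ext _ _ fun z => Subtype.ext (Prod.ext ?_ ?_)
            · exact app_map (X.left.map θ) α z.1.1
            · rfl }
      map_id r := by
        refine NatTrans.ext (funext fun q => ConcreteCategory.hom_ext _ _ fun z => ?_)
        refine Subtype.ext (Prod.ext ?_ ?_)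
        · exact app_congr (X.left.map_id r) z.1.1
        · rfl
      map_comp θ η := by
        refine NatTrans.ext (funext fun q => ConcreteCategory.hom_ext _ _ fun z => ?_)
        refine Subtype.ext (Prod.ext ?_ ?_)
        · exact app_congr (X.left.map_comp θ η) z.1.1
        · rfl }
  let ι : P ⟶ ((tensorOver.obj X).obj L).left := { app r := ((S r).unionProd T).ι }
  have hι : IsLevelwiseWeakEquiv ι := fun r =>
    isWeakEquiv_unionProd_ι _ _ (isWeakEquiv_range_ι _ (hi' r))
  have hι' : Mono ι := by
    have : ∀ r, Mono (ι.app r) := fun r =>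
      inferInstanceAs (Mono ((S r).unionProd T).ι)
    exact NatTrans.mono_of_mono_app ι
  have hfg : ∀ {r q} (k : K.obj q) (x : (X'.left.obj r).obj q),
      mapOverEval (g.app q (l.app q k)) x = mapOverEval (f.app q k) ((i.left.app r).app q x) :=
    fun k x => congrArg (fun z => mapOverEval z x) (app_congr sq.w k).symm
  have hP : ∀ {r q} {x : (X.left.obj r).obj q} {k : L.obj q},
      pairMk x k ∈ ((S r).unionProd T).obj q →
        (∃ k', l.app q k' = k) ∨ ∃ x', (i.left.app r).app q x' = x :=
    fun h => h.imp (fun h => h.2) (fun h => h.1)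
  -- The values prescribed by `f` on `X × K` and by `g` on `X' × L` agree on the overlap, and
  -- injectivity of `l` and `i` makes the preimages unique.
  have hex : ∀ r q (z : (P.obj r).obj q), ∃ y : (Y.left.obj r).obj q,
      (∀ k, l.app q k = z.1.2 → mapOverEval (f.app q k) z.1.1 = y) ∧
      ∀ x, (i.left.app r).app q x = z.1.1 → mapOverEval (g.app q z.1.2) x = y := by
    rintro r q ⟨⟨x, k⟩, hz⟩
    obtain ⟨k, rfl⟩ | ⟨x, rfl⟩ := hP hz
    · refine ⟨mapOverEval (f.app q k) x, fun k' h => ?_, fun x' h => ?_⟩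
      · rw [hl q h]
      · subst h
        exact hfg k x'
    · refine ⟨mapOverEval (g.app q k) x, fun k' h => ?_, fun x' h => ?_⟩
      · subst h
        exact (hfg k' x).symm
      · rw [hi'' r q h]
  choose v hv hv' using hex
  let G : P ⟶ Y.left :=
    { app r :=
        { app q := ↾(v r q)
          naturality q q' α := ConcreteCategory.hom_ext _ _ fun z => by
            obtain ⟨⟨x, k⟩, hz⟩ := z
            obtain ⟨k, rfl⟩ | ⟨x, rfl⟩ := hP hz
            · refine (hv _ _ _ (K.map α k) (app_map l α k)).symm.trans ?_
              refine Eq.trans ?_ (congrArg ((Y.left.obj r).map α) (hv _ _ _ k rfl))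
              exact (congrArg (fun z => mapOverEval z ((X.left.obj r).map α x))
                (app_map f α k)).trans (mapOverEval_map _ _ _)
            · refine (hv' _ _ _ ((X'.left.obj r).map α x) (app_map (i.left.app r) α x)).symm.trans ?_
              refine Eq.trans ?_ (congrArg ((Y.left.obj r).map α) (hv' _ _ _ x rfl))
              exact (congrArg (fun z => mapOverEval z ((X'.left.obj r).map α x))
                (app_map g α k)).trans (mapOverEval_map _ _ _) }
      naturality r r' θ := NatTrans.ext (funext fun q => ConcreteCategory.hom_ext _ _ fun z => by
        obtain ⟨⟨x, k⟩, hz⟩ := z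
        obtain ⟨k, rfl⟩ | ⟨x, rfl⟩ := hP hz
        · refine (hv _ _ _ k rfl).symm.trans ?_
          refine Eq.trans ?_ (congrArg ((Y.left.map θ).app q) (hv _ _ _ k rfl))
          exact mapOverEval_mapString _ θ x
        · refine (hv' _ _ _ ((X'.left.map θ).app q x)
            (by exact app_congr (i.left.naturality θ) x)).symm.trans ?_
          refine Eq.trans ?_ (congrArg ((Y.left.map θ).app q) (hv' _ _ _ x rfl))
          exact mapOverEval_mapString _ θ x) }
  have sq' : CommSq G ι Y.hom ((tensorOver.obj X).obj L).hom := ⟨by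
    refine NatTrans.ext (funext fun r => NatTrans.ext (funext fun q =>
      ConcreteCategory.hom_ext _ _ fun z => ?_))
    obtain ⟨⟨x, k⟩, hz⟩ := z
    obtain ⟨k, rfl⟩ | ⟨x, rfl⟩ := hP hz
    · exact (congrArg ((Y.hom.app r).app q) (hv _ _ _ k rfl)).symm.trans (hom_mapOverEval _ x)
    · refine (congrArg ((Y.hom.app r).app q) (hv' _ _ _ x rfl)).symm.trans ?_
      exact (hom_mapOverEval _ x).trans (app_congr (NatTrans.congr_app (Over.w i) r) x).symm⟩
  have := hY ι hι' hι
  let D : (tensorOver.obj X).obj L ⟶ Y := Over.homMk sq'.lift sq'.fac_right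
  have hD : ∀ {r q} (z : (P.obj r).obj q), tensorVal D z.1.1 z.1.2 = v r q z := fun z =>
    app_congr (NatTrans.congr_app sq'.fac_left _) z
  refine ⟨⟨mapOverCurry D, hom_mapOver_ext fun r q k x => ?_, hom_mapOver_ext fun r q k x => ?_⟩⟩
  · refine (mapOverEval_curry D (l.app q k) x).trans ?_
    exact (hD ⟨(x, l.app q k), Or.inl ⟨trivial, k, rfl⟩⟩).trans (hv _ _ _ k rfl).symm
  · refine (mapOverEval_curry D k ((i.left.app r).app q x)).trans ?_
    exact (hD ⟨((i.left.app r).app q x, k), Or.inr ⟨⟨x, rfl⟩, trivial⟩⟩).trans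
      (hv' _ _ _ x rfl).symm

end Mono

/-! ## Homotopy limits of mapping spaces -/

section OverNerve

variable {J : Type u} [PartialOrder J]

theorem overNerve_ext {j : J} {q : SimplexCategoryᵒᵖ} {c d : ((overNerve J).obj j).obj q}
    (h : ∀ a, ((show ComposableArrows (Over j) q.unop.len from c).obj a).left =
      ((show ComposableArrows (Over j) q.unop.len from d).obj a).left) : c = d := by
  have : ∀ a b : Over j, Subsingleton (a ⟶ b) := fun a b =>
    ⟨fun f g => Over.OverMorphism.ext (Subsingleton.elim _ _)⟩
  have hob : ∀ a b : Over j, a.left = b.left → a = b := by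
    rintro ⟨a, ⟨⟨⟩⟩, f⟩ ⟨b, ⟨⟨⟩⟩, g⟩ h
    obtain rfl : a = b := h
    obtain rfl : f = g := Subsingleton.elim _ _
    rfl
  exact CategoryTheory.Functor.ext (fun a => hob _ _ (h a)) fun _ _ _ => (this _ _).elim _ _

/-- A chain over its last vertex, mapped to a larger element. -/
def overChain {q : SimplexCategoryᵒᵖ} (c : ComposableArrows J q.unop.len) {j : J}
    (f : c.toPrefunctor.obj (Fin.last _) ⟶ j) : ((overNerve J).obj j).obj q :=
  show ComposableArrows (Over j) q.unop.len from
  { obj a := Over.mk (c.toPrefunctor.map (homOfLE (Fin.le_last a)) ⨟ f)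
    map g := Over.homMk (c.toPrefunctor.map g)
      (Subsingleton.elim (α := c.toPrefunctor.obj _ ⟶ j) _ _)
    map_id a := Over.OverMorphism.ext (c.map_id a)
    map_comp f g := Over.OverMorphism.ext (c.map_comp f g) }

/-- The underlying chain of a simplex of `N(J/j)`. -/
def overNerveChain {q : SimplexCategoryᵒᵖ} {j : J} (d : ((overNerve J).obj j).obj q) :
    ComposableArrows J q.unop.len :=
  (show ComposableArrows (Over j) q.unop.len from d) ⋙ Over.forget j

/-- The morphism from the last vertex of a simplex of `N(J/j)`. -/
def overNerveLast {q : SimplexCategoryᵒᵖ} {j : J} (d : ((overNerve J).obj j).obj q) :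
    (overNerveChain d).toPrefunctor.obj (Fin.last _) ⟶ j :=
  ((show ComposableArrows (Over j) q.unop.len from d).toPrefunctor.obj (Fin.last _)).hom

end OverNerve

section HocolimOver

variable {J : Type u} [PartialOrder J] {B : SimplicialSpace.{u}} (X : Jᵒᵖ ⥤ Over B) {Y : Over B}

/-- The degreewise homotopy colimit of a diagram of simplicial spaces over `B`. -/
def hocolimOver : Over B :=
  Over.mk (Y :=
    { obj r := hocolim (X ⋙ Over.forget B ⋙ (evaluation SimplexCategoryᵒᵖ SSet.{u}).obj r)
      map {r r'} θ :=
        { app q := ↾(fun x : HocolimSimplex (X ⋙ Over.forget B ⋙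
            (evaluation SimplexCategoryᵒᵖ SSet.{u}).obj r) q.unop =>
              (⟨x.1, ((X.obj _).left.map θ).app _ x.2⟩ : HocolimSimplex (X ⋙ Over.forget B ⋙
                (evaluation SimplexCategoryᵒᵖ SSet.{u}).obj r') q.unop))
          naturality q q' α := by
            refine ConcreteCategory.hom_ext _ _ fun (x : HocolimSimplex _ q.unop) => ?_
            refine Sigma.ext ?_ (heq_of_eq ?_)
            · rfl
            refine (app_congr ((X.map (lastVertexMap α.unop x.1).op).left.naturality θ) _).symm.trans
              ?_
            exact congrArg (((X.map (lastVertexMap α.unop x.1).op).left.app r').app q')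
              (app_map ((X.obj _).left.map θ) α x.2) }
      map_id r := by
        refine NatTrans.ext (funext fun q => ConcreteCategory.hom_ext _ _ fun x => ?_)
        refine Sigma.ext ?_ (heq_of_eq ?_)
        · rfl
        · exact app_congr ((X.obj _).left.map_id r) x.2
      map_comp θ η := by
        refine NatTrans.ext (funext fun q => ConcreteCategory.hom_ext _ _ fun x => ?_)
        refine Sigma.ext ?_ (heq_of_eq ?_)
        · rfl
        · exact app_congr ((X.obj _).left.map_comp θ η) x.2 })
    { app r :=
        { app q := ↾(fun x : HocolimSimplex (X ⋙ Over.forget B ⋙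
            (evaluation SimplexCategoryᵒᵖ SSet.{u}).obj r) q.unop => ((X.obj _).hom.app r).app _ x.2)
          naturality q q' α := by
            refine ConcreteCategory.hom_ext _ _ fun x => ?_
            refine (app_congr (NatTrans.congr_app
              (Over.w (X.map (lastVertexMap α.unop x.1).op)) r) _).trans ?_
            exact app_map ((X.obj _).hom.app r) α x.2 }
      naturality r r' θ := NatTrans.ext (funext fun q => ConcreteCategory.hom_ext _ _ fun x =>
        app_congr ((X.obj _).hom.naturality θ) x.2) }

variable {X} {r p q : SimplexCategoryᵒᵖ} {j : J}

/-- A simplex of the homotopy colimit. -/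
def hocolimOverMk (c : ComposableArrows J q.unop.len)
    (x : ((X.obj (op (c.toPrefunctor.obj (Fin.last _)))).left.obj r).obj q) :
    ((hocolimOver X).left.obj r).obj q :=
  (⟨c, x⟩ : HocolimSimplex (X ⋙ Over.forget B ⋙
    (evaluation SimplexCategoryᵒᵖ SSet.{u}).obj r) q.unop)

/-- The simplex of the homotopy colimit determined by a simplex of `N(J/j) × X(j)`. -/
def hocolimOverOf (d : ((overNerve J).obj j).obj q) (x : ((X.obj (op j)).left.obj r).obj q) :
    ((hocolimOver X).left.obj r).obj q :=
  hocolimOverMk (overNerveChain d) (((X.map (overNerveLast d).op).left.app r).app q x)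

theorem left_map_comp_apply {a b c : Jᵒᵖ} (f : a ⟶ b) (g : b ⟶ c)
    (x : ((X.obj a).left.obj r).obj q) : ((X.map (f ⨟ g)).left.app r).app q x =
      ((X.map g).left.app r).app q (((X.map f).left.app r).app q x) :=
  app_congr (NatTrans.congr_app (congrArg (fun f => f.left) (X.map_comp f g)) r) x

/-- Every simplex of the homotopy colimit comes from its own chain, regarded as a chain over its
last vertex. This is the universal case used to invert the comparison. -/
theorem hocolimOverOf_overChain (c : ComposableArrows J q.unop.len)
    (x : ((X.obj (op (c.toPrefunctor.obj (Fin.last _)))).left.obj r).obj q) :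
    hocolimOverOf (overChain c (𝟙 _)) x = hocolimOverMk c x := by
  refine Sigma.ext rfl (heq_of_eq ?_)
  have h : overNerveLast (overChain c (𝟙 _)) = 𝟙 (c.toPrefunctor.obj (Fin.last _)) :=
    Subsingleton.elim (α := c.toPrefunctor.obj _ ⟶ c.toPrefunctor.obj _) _ _
  refine (congrArg (fun f : c.toPrefunctor.obj (Fin.last _) ⟶ c.toPrefunctor.obj (Fin.last _) =>
    ((X.map f.op).left.app r).app q x) h).trans ?_
  exact app_congr (NatTrans.congr_app (congrArg (fun f => f.left) (X.map_id _)) r) x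

theorem hocolimOverOf_map {q' : SimplexCategoryᵒᵖ} (α : q ⟶ q') (d : ((overNerve J).obj j).obj q)
    (x : ((X.obj (op j)).left.obj r).obj q) :
    hocolimOverOf (((overNerve J).obj j).map α d) (((X.obj (op j)).left.obj r).map α x) =
      ((hocolimOver X).left.obj r).map α (hocolimOverOf d x) := by
  refine Sigma.ext rfl (heq_of_eq ?_)
  have h : overNerveLast (((overNerve J).obj j).map α d) =
      lastVertexMap α.unop (overNerveChain d) ⨟ overNerveLast d :=
    Subsingleton.elim (α := (overNerveChain (((overNerve J).obj j).map α d)).toPrefunctor.obj _ ⟶ j)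
      _ _
  refine (congrArg (fun f => ((X.map f.op).left.app r).app q' _) h).trans ?_
  refine (left_map_comp_apply (overNerveLast d).op (lastVertexMap α.unop (overNerveChain d)).op
    _).trans ?_
  exact congrArg (((X.map (lastVertexMap α.unop (overNerveChain d)).op).left.app r).app q')
    (app_map ((X.map (overNerveLast d).op).left.app r) α x)

theorem hocolimOverOf_mapString {r' : SimplexCategoryᵒᵖ} (θ : r ⟶ r')
    (d : ((overNerve J).obj j).obj q) (x : ((X.obj (op j)).left.obj r).obj q) :
    hocolimOverOf d (((X.obj (op j)).left.map θ).app q x) =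
      ((hocolimOver X).left.map θ).app q (hocolimOverOf d x) :=
  Sigma.ext rfl (heq_of_eq (app_congr ((X.map (overNerveLast d).op).left.naturality θ) x))

/-- The relation presenting the homotopy colimit as a quotient of the pieces `N(J/j) × X(j)`; it
makes restricted maps compatible in `j`. -/
theorem hocolimOverOf_precomp {i : J} (g : i ⟶ j) (d : ((overNerve J).obj i).obj q)
    (x : ((X.obj (op j)).left.obj r).obj q) :
    hocolimOverOf (((overNerve J).map g).app q d) x =
      hocolimOverOf d (((X.map g.op).left.app r).app q x) := by
  refine Sigma.ext rfl (heq_of_eq ?_)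
  have h : overNerveLast (((overNerve J).map g).app q d) = overNerveLast d ⨟ g :=
    Subsingleton.elim (α := (overNerveChain d).toPrefunctor.obj _ ⟶ j) _ _
  refine (congrArg (fun f => ((X.map f.op).left.app r).app q x) h).trans ?_
  exact left_map_comp_apply g.op (overNerveLast d).op x

theorem hom_hocolimOverOf (d : ((overNerve J).obj j).obj q)
    (x : ((X.obj (op j)).left.obj r).obj q) :
    ((hocolimOver X).hom.app r).app q (hocolimOverOf d x) = ((X.obj (op j)).hom.app r).app q x :=
  app_congr (NatTrans.congr_app (Over.w (X.map (overNerveLast d).op)) r) x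

/-- The map `X(j) × K ⟶ (hocolim X) × L` determined by maps from `K` to `N(J/j)` and `L`. -/
def hocolimOverPair {K L : SSet.{u}} (δ : K ⟶ (overNerve J).obj j) (τ : K ⟶ L) :
    (tensorOver.obj (X.obj (op j))).obj K ⟶ (tensorOver.obj (hocolimOver X)).obj L :=
  tensorMk (fun _ q x k => pairMk (hocolimOverOf (δ.app q k) x) (τ.app q k))
    (fun r _ _ α x k => Prod.ext ((congrArg (fun d => hocolimOverOf d
      (((X.obj (op j)).left.obj r).map α x)) (app_map δ α k)).trans (hocolimOverOf_map _ _ _))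
        (app_map τ α k))
    (fun θ _ _ _ => Prod.ext (hocolimOverOf_mapString θ _ _) rfl)
    (fun _ _ _ _ => hom_hocolimOverOf _ _)

variable (X Y) in
/-- The comparison of the mapping space of a homotopy colimit with the homotopy limit of the
mapping spaces. -/
def mapOverHocolim : (mapOver Y).obj (op (hocolimOver X)) ⟶ holim (X.rightOp ⋙ mapOver Y) where
  app p := ↾(fun h =>
    { app j :=
        { app q := ↾(fun z => hocolimOverPair (SSet.yonedaEquiv.symm z.1)
            (SSet.yonedaEquiv.symm z.2) ⨟ h)
          naturality q q' α := ConcreteCategory.hom_ext _ _ fun z => by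
            refine (congrArg₂ (fun δ τ => hocolimOverPair δ τ ⨟ h)
              (SSet.yonedaEquiv_symm_naturality_left α.unop z.1)
              (SSet.yonedaEquiv_symm_naturality_left α.unop z.2)).symm.trans ?_
            rfl }
      naturality i j g := NatTrans.ext (funext fun q => ConcreteCategory.hom_ext _ _ fun z => by
        refine tensor_ext fun r q' x s => ?_
        exact congrArg (fun w => tensorVal h w ((SSet.yonedaEquiv.symm z.2).app q' s))
          ((congrArg (fun d => hocolimOverOf d x)
            (app_map ((overNerve J).map g) (SSet.stdSimplex.objEquiv s).op z.1)).symm.trans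
              (hocolimOverOf_precomp g _ x))) })
  naturality p p' α := ConcreteCategory.hom_ext _ _ fun h => NatTrans.ext (funext fun j =>
    NatTrans.ext (funext fun q => ConcreteCategory.hom_ext _ _ fun z => by
      refine tensor_ext fun r q' x s => ?_
      exact congrArg (tensorVal h _) (app_map (SSet.stdSimplex.map α.unop)
        (SSet.stdSimplex.objEquiv s).op z.2).symm))

/-- Evaluation of a simplex of a homotopy limit of mapping spaces. -/
def holimEval (γ : (holim (X.rightOp ⋙ mapOver Y)).obj p) (d : ((overNerve J).obj j).obj q)
    (t : (SSet.stdSimplex.{u}.obj p.unop).obj q) (x : ((X.obj (op j)).left.obj r).obj q) :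
    (Y.left.obj r).obj q :=
  mapOverEval (((show (tensorDiagram (overNerve J)).obj (SSet.stdSimplex.obj p.unop) ⟶ _
    from γ).app j).app q (pairMk d t)) x

theorem holim_ext {γ γ' : (holim (X.rightOp ⋙ mapOver Y)).obj p}
    (h : ∀ j q r (d : ((overNerve J).obj j).obj q) t (x : ((X.obj (op j)).left.obj r).obj q),
      holimEval γ d t x = holimEval γ' d t x) : γ = γ' := by
  let δ : (tensorDiagram (overNerve J)).obj (SSet.stdSimplex.obj p.unop) ⟶ X.rightOp ⋙ mapOver Y := γ
  let δ' : (tensorDiagram (overNerve J)).obj (SSet.stdSimplex.obj p.unop) ⟶ X.rightOp ⋙ mapOver Y := γ'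
  refine NatTrans.ext (funext fun j => NatTrans.ext (funext fun q =>
    ConcreteCategory.hom_ext _ _ fun z => mapOver_ext fun q' α r x => ?_))
  refine (congrArg (fun w => mapOverEval w x) (app_map (δ.app j) α z)).symm.trans ?_
  exact (h _ _ _ _ _ x).trans (congrArg (fun w => mapOverEval w x) (app_map (δ'.app j) α z))

theorem holimEval_map (γ : (holim (X.rightOp ⋙ mapOver Y)).obj p) {q' : SimplexCategoryᵒᵖ}
    (α : q ⟶ q') (d : ((overNerve J).obj j).obj q) (t : (SSet.stdSimplex.{u}.obj p.unop).obj q)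
    (x : ((X.obj (op j)).left.obj r).obj q) :
    holimEval γ (((overNerve J).obj j).map α d) ((SSet.stdSimplex.obj p.unop).map α t)
      (((X.obj (op j)).left.obj r).map α x) = (Y.left.obj r).map α (holimEval γ d t x) := by
  let δ : (tensorDiagram (overNerve J)).obj (SSet.stdSimplex.obj p.unop) ⟶ X.rightOp ⋙ mapOver Y := γ
  exact (congrArg (fun w => mapOverEval w _) (app_map (δ.app j) α (pairMk d t))).trans
    (mapOverEval_map _ _ _)

theorem holimEval_precomp (γ : (holim (X.rightOp ⋙ mapOver Y)).obj p) {i : J} (g : i ⟶ j)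
    (d : ((overNerve J).obj i).obj q) (t : (SSet.stdSimplex.{u}.obj p.unop).obj q)
    (x : ((X.obj (op j)).left.obj r).obj q) :
    holimEval γ (((overNerve J).map g).app q d) t x =
      holimEval γ d t (((X.map g.op).left.app r).app q x) := by
  let δ : (tensorDiagram (overNerve J)).obj (SSet.stdSimplex.obj p.unop) ⟶ X.rightOp ⋙ mapOver Y := γ
  exact congrArg (fun w => mapOverEval w x) (app_congr (δ.naturality g) (pairMk d t))

theorem holimEval_mapOverHocolim (h : ((mapOver Y).obj (op (hocolimOver X))).obj p)
    (d : ((overNerve J).obj j).obj q) (t : (SSet.stdSimplex.{u}.obj p.unop).obj q)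
    (x : ((X.obj (op j)).left.obj r).obj q) :
    holimEval ((mapOverHocolim X Y).app p h) d t x =
      tensorVal (show (tensorOver.obj (hocolimOver X)).obj (SSet.stdSimplex.obj p.unop) ⟶ Y from h)
        (hocolimOverOf d x) t := by
  let ψ : (tensorOver.obj (hocolimOver X)).obj (SSet.stdSimplex.obj p.unop) ⟶ Y := h
  exact congrArg₂ (fun d t => tensorVal ψ (hocolimOverOf d x) t)
    (ConcreteCategory.congr_hom (((overNerve J).obj j).map_id q) d)
    (ConcreteCategory.congr_hom ((SSet.stdSimplex.obj p.unop).map_id q) t)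

theorem overNerve_map_overChain (d : ((overNerve J).obj j).obj q) :
    ((overNerve J).map (overNerveLast d)).app q (overChain (overNerveChain d) (𝟙 _)) = d :=
  overNerve_ext fun _ => rfl

theorem overChain_reindex {q' : SimplexCategoryᵒᵖ} (α : q ⟶ q')
    (c : ComposableArrows J q.unop.len) :
    ((overNerve J).map (lastVertexMap α.unop c)).app q' (overChain (chainReindex α.unop c) (𝟙 _)) =
      ((overNerve J).obj _).map α (overChain c (𝟙 _)) :=
  overNerve_ext fun _ => rfl

/-- The homotopy colimit is the coend of `N(J/j) × X(j)`, so maps out of it are compatible families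
on these pieces. The inverse evaluates a family on a chain over its last vertex; compatibility in
`j` recovers all other values. -/
instance isIso_mapOverHocolim : IsIso (mapOverHocolim X Y) := by
  refine (NatTrans.isIso_iff_isIso_app _).2 fun p => (isIso_iff_bijective _).2
    ⟨fun h h' e => tensor_ext fun r q z t => ?_, fun γ => ?_⟩
  · obtain ⟨c, x⟩ := z
    have e' := congrArg (fun γ => holimEval γ (overChain c (𝟙 _)) t x) e
    have e'' := (holimEval_mapOverHocolim h _ _ _).symm.trans
      (e'.trans (holimEval_mapOverHocolim h' _ _ _))
    have hc := hocolimOverOf_overChain c x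
    exact (congrArg (fun z => tensorVal h z t) hc).symm.trans
      (e''.trans (congrArg (fun z => tensorVal h' z t) hc))
  · let ψ : (tensorOver.obj (hocolimOver X)).obj (SSet.stdSimplex.obj p.unop) ⟶ Y :=
      tensorMk (fun r q z t => holimEval γ (overChain (show HocolimSimplex _ q.unop from z).1 (𝟙 _)) t
        (show HocolimSimplex _ q.unop from z).2)
        (fun r q q' α z t => by
          obtain ⟨c, x⟩ := z
          refine (holimEval_precomp γ (lastVertexMap α.unop c) _ _ _).symm.trans ?_
          refine Eq.trans ?_ (holimEval_map γ α (overChain c (𝟙 _)) t x)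
          exact congrArg (fun d => holimEval γ d _ _) (overChain_reindex α c))
        (fun θ q z t => mapOverEval_mapString _ θ _)
        (fun r q z t => hom_mapOverEval _ _)
    refine ⟨ψ, holim_ext fun j q r d t x => (holimEval_mapOverHocolim ψ d t x).trans ?_⟩
    refine (holimEval_precomp γ (overNerveLast d) _ t x).symm.trans ?_
    exact congrArg (fun d => holimEval γ d t x) (overNerve_map_overChain d)

/-- The map from the homotopy colimit to the vertex of a cocone. -/
def hocolimOverDesc (s : Cocone X) : hocolimOver X ⟶ s.pt :=
  Over.homMk
    { app r := hocolimDesc ((Over.forget B ⋙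
        (evaluation SimplexCategoryᵒᵖ SSet.{u}).obj r).mapCocone s)
      naturality r r' θ := NatTrans.ext (funext fun q => ConcreteCategory.hom_ext _ _ fun x => by
        exact app_congr ((s.ι.app _).left.naturality θ) x.2) }
    (NatTrans.ext (funext fun r => NatTrans.ext (funext fun q => ConcreteCategory.hom_ext _ _
      fun x => by exact app_congr (NatTrans.congr_app (Over.w (s.ι.app _)) r) x.2)))

/-- The cone of mapping spaces of a cocone. -/
def mapOverCone (Y : Over B) (s : Cocone X) : Cone (X.rightOp ⋙ mapOver Y) where
  pt := (mapOver Y).obj (op s.pt)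
  π := { app j := (mapOver Y).map (s.ι.app (op j)).op
         naturality i j g := by
          have h : s.ι.app (op j) = X.map g.op ⨟ s.ι.app (op i) := (s.w g.op).symm
          have h' : (mapOver Y).map (s.ι.app (op j)).op =
              (mapOver Y).map (s.ι.app (op i)).op ⨟ (mapOver Y).map (X.map g.op).op := by
            rw [h, op_comp, Functor.map_comp]
          exact (Category.id_comp _).trans h' }

/-- Identifies the canonical map to the homotopy limit with restriction along the canonical map out
of the homotopy colimit. -/
theorem mapOver_hocolimOverDesc (s : Cocone X) :
    (mapOver Y).map (hocolimOverDesc s).op ⨟ mapOverHocolim X Y = holimLift (mapOverCone Y s) := by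
  refine NatTrans.ext (funext fun p => ConcreteCategory.hom_ext _ _ fun φ =>
    holim_ext fun j q r d t x => ?_)
  refine (holimEval_mapOverHocolim _ d t x).trans ?_
  let ψ : (tensorOver.obj s.pt).obj (SSet.stdSimplex.obj p.unop) ⟶ Y := φ
  have h : ((hocolimOverDesc s).left.app r).app q (hocolimOverOf d x) =
      ((s.ι.app (op j)).left.app r).app q x :=
    app_congr (NatTrans.congr_app (congrArg (fun f => f.left) (s.w (overNerveLast d).op)) r) x
  refine (congrArg (fun z => tensorVal ψ z t) h).trans ?_
  exact tensorVal_eq_mapOverEval φ _ t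

end HocolimOver

/-! ## The homotopy sheaf property of mapping spaces -/

section Contractible

variable {J : Type u} [PartialOrder J]

/-- If `j₀ ≤ a(j) ≥ j` for a monotone map `a`, then the nerve is contractible. -/
theorem isWeakEquiv_fst_nerve (T : SSet.{u}) (j₀ : J) (a : J →o J) (h₁ : OrderHom.id ≤ a)
    (h₂ : OrderHom.const J j₀ ≤ a) : IsWeakEquiv (fst T (nerve J)) := by
  let H : (Fin 2 →o J →o J) → (nerve J ⊗ Δ[1] ⟶ nerve J) := fun φ =>
    { app p := ↾(fun x : (nerve J ⊗ Δ[1] : SSet.{u}).obj p =>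
        nerveMk p (blend φ (nerveChain x.1) (SSet.stdSimplex.asOrderHom.{u} x.2)))
      naturality p q θ := ConcreteCategory.hom_ext _ _ fun x => nerve_ext fun j => rfl }
  have mono : ∀ φ : J →o J, φ ≤ a → Monotone ![φ, a] := by
    intro φ h
    rw [Fin.monotone_iff_le_succ]
    intro i
    fin_cases i
    exact h
  let s : Δ[0] ⟶ nerve J := SSet.const (nerveMk (op ⦋0⦌) (OrderHom.const _ j₀))
  let t : nerve J ⟶ Δ[0] := SSet.const (SSet.stdSimplex.obj₀Equiv.{u}.symm (0 : Fin 1))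
  have e₁ : SSet.ι₀ ⨟ H ⟨_, mono _ h₁⟩ = 𝟙 _ := by
    refine NatTrans.ext (funext fun p => ConcreteCategory.hom_ext _ _ fun x => ?_)
    exact nerve_ext (J := J) fun j => rfl
  have e₂ : SSet.ι₀ ⨟ H ⟨_, mono _ h₂⟩ = t ⨟ s := by
    refine NatTrans.ext (funext fun p => ConcreteCategory.hom_ext _ _ fun x => ?_)
    exact nerve_ext (J := J) fun j => rfl
  have e₃ : SSet.ι₁ ⨟ H ⟨_, mono _ h₁⟩ = SSet.ι₁ ⨟ H ⟨_, mono _ h₂⟩ := by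
    refine NatTrans.ext (funext fun p => ConcreteCategory.hom_ext _ _ fun x => ?_)
    exact nerve_ext (J := J) fun j => rfl
  have w₁ : IsWeakEquiv (SSet.ι₁ ⨟ H ⟨_, mono _ h₁⟩) :=
    (IsWeakEquiv.id _).congr (hRel_iff.2 ⟨_, e₁, rfl⟩)
  have w₂ : IsWeakEquiv (t ⨟ s) := w₁.congr' (hRel_iff.2 ⟨_, e₂, e₃.symm⟩)
  have w₃ : IsWeakEquiv (s ⨟ t) := by
    have : s ⨟ t = 𝟙 _ := SSet.stdSimplex.isTerminalObj₀.hom_ext _ _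
    rw [this]
    exact .id _
  have w : IsWeakEquiv t := .of_homotopyEquiv (g := s) w₂ w₃
  have : IsIso (fst T (Δ[0] : SSet.{u})) :=
    ⟨lift (𝟙 _) (SSet.const (SSet.stdSimplex.obj₀Equiv.{u}.symm (0 : Fin 1))),
      CartesianMonoidalCategory.hom_ext _ _ rfl (SSet.stdSimplex.isTerminalObj₀.hom_ext _ _), rfl⟩
  have h : T ◁ t ⨟ fst T (Δ[0] : SSet.{u}) = fst T (nerve J) := rfl
  rw [← h]
  exact (w.whiskerLeft T).comp (.of_isIso _)

end Contractible

/-! ### From the degreewise cosheaf property to the sheaf property of mapping spaces. -/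

section Sheaf

variable {J : Type u} [PartialOrder J] {B : SimplicialSpace.{u}} {X : Jᵒᵖ ⥤ Over B} {Y : Over B}

/-- Precomposition with the projection from the product with a contractible nerve. -/
theorem isWeakEquiv_mapOver_fst (hY : IsInjectiveFibration Y.hom) (Z : Over B) (j₀ : J)
    (hJ : ∀ T : SSet.{u}, IsWeakEquiv (fst T (nerve J))) :
    IsWeakEquiv ((mapOver Y).map (Over.homMk (U := (tensorOver.obj Z).obj (nerve J)) (V := Z)
      (tensorDiagramFst Z.left (nerve J)) rfl).op) := by
  let π : (tensorOver.obj Z).obj (nerve J) ⟶ Z := Over.homMk (tensorDiagramFst Z.left (nerve J)) rfl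
  -- The projection is not injective, but the section at the vertex `j₀` is, and restriction along
  -- it inverts restriction along the projection up to weak equivalence.
  let σ : Z ⟶ (tensorOver.obj Z).obj (nerve J) := Over.homMk
    { app r := lift (𝟙 _) (SSet.const (nerveMk (op ⦋0⦌) (OrderHom.const _ j₀)))
      naturality r r' θ := rfl } (by exact Category.id_comp Z.hom)
  have hσ : σ ⨟ π = 𝟙 Z := rfl
  have hσ' : ∀ r, σ.left.app r ⨟ π.left.app r = 𝟙 _ := fun r => rfl
  have w : IsWeakEquiv ((mapOver Y).map σ.op) :=
    isWeakEquiv_mapOver_of_mono hY σ (fun r => mono_of_mono_fac (hσ' r)) fun r =>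
      IsWeakEquiv.of_comp_right (g := π.left.app r) (hJ _) (by rw [hσ']; exact .id _)
  refine IsWeakEquiv.of_comp_right w ?_
  have : (mapOver Y).map π.op ⨟ (mapOver Y).map σ.op = 𝟙 _ := by
    rw [← Functor.map_comp, ← op_comp, hσ, op_id, CategoryTheory.Functor.map_id]
  exact this ▸ .id _

/-- Mapping spaces into a fibrant object over `B` send a degreewise homotopy colimit of subobjects
to a homotopy limit. -/
theorem isWeakEquiv_holimLift_mapOverCone (hY : IsInjectiveFibration Y.hom) (s : Cocone X) (j₀ : J)
    (hJ : ∀ T : SSet.{u}, IsWeakEquiv (fst T (nerve J)))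
    (hinj : ∀ S r q, Function.Injective (((s.ι.app S).left.app r).app q))
    (hs : ∀ r, IsWeakEquiv (hocolimDesc ((Over.forget B ⋙
      (evaluation SimplexCategoryᵒᵖ SSet.{u}).obj r).mapCocone s))) :
    IsWeakEquiv (holimLift (mapOverCone Y s)) := by
  let π : (tensorOver.obj s.pt).obj (nerve J) ⟶ s.pt :=
    Over.homMk (tensorDiagramFst s.pt.left (nerve J)) rfl
  -- The map from the homotopy colimit to the vertex of the cocone forgets the chain. Recording the
  -- chain in the nerve makes it injective, since the components of the cocone are.
  let e : hocolimOver X ⟶ (tensorOver.obj s.pt).obj (nerve J) := Over.homMk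
    { app r := lift ((hocolimOverDesc s).left.app r)
        { app q := ↾(fun x : HocolimSimplex (X ⋙ Over.forget B ⋙
            (evaluation SimplexCategoryᵒᵖ SSet.{u}).obj r) q.unop => x.1) }
      naturality r r' θ := NatTrans.ext (funext fun q => ConcreteCategory.hom_ext _ _ fun x => by
        refine Prod.ext ?_ ?_
        · exact app_congr ((hocolimOverDesc s).left.naturality θ) x
        · rfl) } (Over.w (hocolimOverDesc s))
  have he : e ⨟ π = hocolimOverDesc s := rfl
  have w : IsWeakEquiv ((mapOver Y).map e.op) := by
    refine isWeakEquiv_mapOver_of_mono hY e (fun r => ?_) fun r =>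
      IsWeakEquiv.of_comp_right (g := π.left.app r) (hJ _) (hs r)
    have : ∀ q, Mono ((e.left.app r).app q) := fun q => (mono_iff_injective _).2 (by
      rintro ⟨c, x⟩ ⟨d, y⟩ h
      obtain rfl : c = d := congrArg Prod.snd h
      exact Sigma.ext rfl (heq_of_eq (hinj _ r q (congrArg Prod.fst h))))
    exact NatTrans.mono_of_mono_app _
  rw [← mapOver_hocolimOverDesc, ← he, op_comp, Functor.map_comp]
  exact ((isWeakEquiv_mapOver_fst hY s.pt j₀ hJ).comp w).comp (.of_isIso _)

/-- The poset of finite nonempty index sets is contracted through `S ⊆ S ∪ {i} ⊇ {i}` for a fixed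
index `i`; the remaining input is the cosheaf property. -/
theorem isHomotopySheaf_mapFin (m k : ℕ) (Y : Over nerveFin.{u}) (hY : IsInjectiveFibration Y.hom) :
    IsHomotopySheaf k (mapFin.{u} m k Y) := by
  classical
  intro M ι V f hf
  obtain ⟨i⟩ := hf.nonempty
  refine isWeakEquiv_holimLift_mapOverCone hY ((con.{u} m k).mapCocone (interCocone f))
    (⟨{i}, Finset.singleton_nonempty i⟩ : FinSubset ι) (fun T => ?_) (fun S r q => ?_)
    (isHomotopyCosheaf_con m k f hf)
  · exact isWeakEquiv_fst_nerve T ⟨{i}, Finset.singleton_nonempty i⟩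
      ⟨fun S => ⟨insert i S.1, Finset.insert_nonempty i S.1⟩,
        fun S T h => Finset.insert_subset_insert i h⟩
      (fun S => Finset.subset_insert i S.1)
      (fun S => Finset.singleton_subset_iff.2 (Finset.mem_insert_self i S.1))
  · exact ConfigSimplex.mapMan_injective (M.inclusionTop (interOpen f S.unop))

end Sheaf

end

end ConfigCat

theorem theorem3p4 (m n k : ℕ) :
    ConfigCat.IsHomotopyCosheaf k (ConfigCat.con.{u} m k) ∧
    ∀ (N : ConfigCat.Man.{u} n) (Y : CategoryTheory.Over ConfigCat.nerveFin.{u})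
      (j : (ConfigCat.con.{u} n ⊤).obj N ⟶ Y), ConfigCat.IsFibrantReplacement j →
      ConfigCat.IsHomotopySheaf k (ConfigCat.mapFin.{u} m k Y) :=
  ⟨ConfigCat.isHomotopyCosheaf_con m k, fun _ Y _ hj =>
    ConfigCat.isHomotopySheaf_mapFin m k Y hj.fibration⟩
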